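/- **Theorem 4.1.** Let $n\ge 0$ and let $a_1,\dots,a_n\ge 1$ be integers. *Notation.* Let $e,f,h$ be the standard basis of $\mathfrak{sl}_2$. For $d\ge 1$ let $\mathbb C^{d}$ be the irreducible $\mathfrak{sl}_2$-module of dimension $d$, with basis $v_0,\dots,v_{d-1}$ and $e v_p=v_{p+1}$ (where $v_d=0$), $f v_p=p(d-p)v_{p-1}$, $h v_p=(2p-d+1)v_p$; the vector $v_0$ (annihilated by $f$) is called the highest vector. For $i<j$ let $\mathbb C^{a_i}\otimes\mathbb C^{a_j}=\bigoplus_{k=0}^{\min(a_i,a_j)-1}\mathbb C^{a_i+a_j-1-2k}$ be the decomposition into irreducible $\mathfrak{sl}_2$-modules, and put $V^{(i,j)}(l)=\bigoplus_{k=0}^{l}\mathbb C^{a_i+a_j-1-2k}$, with $V^{(i,j)}(l)=\mathbb C^{a_i}\otimes\mathbb C^{a_j}$ for $l\ge \min(a_i,a_j)-1$. Let $L^{(i,j)}$ be the tensor product of all factors of $\mathbb C^{a_1}\otimes\dots\otimes\mathbb C^{a_n}$ except the $i$-th and the $j$-th one, and let $\sigma^{(i,j)}:\mathbb C^{a_i}\otimes\mathbb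 C^{a_j}\otimes L^{(i,j)}\to\mathbb C^{a_1}\otimes\dots\otimes\mathbb C^{a_n}$ be the isomorphism that puts the factors back in their places. Let $F$ be the $\mathbb C[z_1,\dots,z_n]$-module of $\mathbb C^{a_1}\otimes\dots\otimes\mathbb C^{a_n}$-valued polynomials $f(z_1,\dots,z_n)$. For $i<j$ write $f=\sum_{k\ge0}(z_i-z_j)^k f^{(i,j)}_k$, where $f^{(i,j)}_k$ is a polynomial in $z_i+z_j$ and the $z_l$, $l\ne i,j$. Let $F^c\subset F$ be the submodule of all $f$ such that for all $i<j$ and all $k\ge 0$ the values of $f^{(i,j)}_k$ lie in $\sigma^{(i,j)}\bigl(V^{(i,j)}(k)\otimes L^{(i,j)}\bigr)$. For $k=0,\dots,n-1$ let $e_k$ act on $F$ as $\sum_{i=1}^n z_i^k e^{(i)}$, where $e^{(i)}$ is $e$ acting on the $i$-th tensor factor; these commuting operators preserve $F^c$ and define on it an action of the abelian Lie algebra $\mathcal A_n$ with basis $e_0,\dots,e_{n-1}$. Let $u\in F^c$ be the constant polynomial equal to the tensor product of the highest vectors. For $T=(t_1,\dots,t_n)\in\mathbb C^n$ let $R(T)\subset\mathbb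 C[z_1,\dots,z_n]$ be the ideal generated by $z_i-t_i$, $i=1,\dots,n$, and let $M(T)=F^c/R(T)F^c$, with the induced action of $\mathcal A_n$. Let $\Sigma\subset\mathbb C^n$ be the set of points with pairwise distinct coordinates. For $Z\in\Sigma$ let $I(Z)$ be the kernel of the homomorphism of algebras $\mathbb C[e_0,\dots,e_{n-1}]\to\bigotimes_{i=1}^n\mathbb C[y_i]/(y_i^{a_i})$, $e_k\mapsto\sum_{i=1}^n Z_i^k y_i$. For arbitrary $T\in\mathbb C^n$ let $I(T)$ be the ideal of all coefficientwise limits of polynomials $q_Z\in I(Z)$ of bounded degree, as $Z\to T$, $Z\in\Sigma$. *Statement.* 1. $F^c$ is a free $\mathbb C[z_1,\dots,z_n]$-module of rank $\prod_{i=1}^n a_i$. 2. For every $T\in\mathbb C^n$ one has $I(T)=\lim_{Z\to T,\ Z\in\Sigma} I(Z)$ (for every $d$, the spaces of elements of degree at most $d$ in $I(Z)$ converge, as subspaces of the finite-dimensional space of polynomials of degree at most $d$, to the space of elements of degree at most $d$ in $I(T)$), and there is an isomorphism of $\mathcal A_n$-modules $$\mathbb C[e_0,\dots,e_{n-1}]/I(T)\;\cong\;M(T)$$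 that maps $1$ to the class of $u$. -/

import Mathlib

open scoped Kronecker Topology

namespace FusionSl2

/-! ### The irreducible `sl₂`-modules `ℂ^d` and the Clebsch–Gordan filtration

`ℂ^d = (Fin d → ℂ)` has the standard basis `v_0, …, v_{d-1}`, on which
`e v_p = v_{p+1}`, `f v_p = p (d - p) v_{p-1}`, `h v_p = (2 p - (d - 1)) v_p`.
The vector `v_0` (annihilated by `f`, generating `ℂ^d` under the powers of `e`) is the one called
the highest vector. -/

/-- `e v_p = v_{p+1}`. -/
def matE (d : ℕ) : Matrix (Fin d) (Fin d) ℂ :=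
  Matrix.of fun p q => if (p : ℕ) = q + 1 then 1 else 0

/-- `f v_q = q (d - q) v_{q-1}`. -/
def matF (d : ℕ) : Matrix (Fin d) (Fin d) ℂ :=
  Matrix.of fun p q => if (q : ℕ) = p + 1 then (q : ℂ) * ((d : ℂ) - q) else 0

/-- `h v_p = (2 p - (d - 1)) v_p`. -/
def matH (d : ℕ) : Matrix (Fin d) (Fin d) ℂ :=
  Matrix.diagonal fun p => 2 * (p : ℂ) - ((d : ℂ) - 1)

/-- The action `x ⊗ 1 + 1 ⊗ y` on `ℂ^a ⊗ ℂ^b`, where `ℂ^a ⊗ ℂ^b = (Fin a × Fin b → ℂ)` through the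
basis `v_p ⊗ v_q`. -/
def tens {a b : ℕ} (x : Matrix (Fin a) (Fin a) ℂ) (y : Matrix (Fin b) (Fin b) ℂ) :
    Matrix (Fin a × Fin b) (Fin a × Fin b) ℂ :=
  x ⊗ₖ (1 : Matrix (Fin b) (Fin b) ℂ) + (1 : Matrix (Fin a) (Fin a) ℂ) ⊗ₖ y

/-- `Φ` is (the matrix of) a homomorphism of `sl₂`-modules `ℂ^d → ℂ^a ⊗ ℂ^b`. -/
structure IsSl2Hom (a b d : ℕ) (Φ : Matrix (Fin a × Fin b) (Fin d) ℂ) : Prop where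
  map_e : Φ * matE d = tens (matE a) (matE b) * Φ
  map_f : Φ * matF d = tens (matF a) (matF b) * Φ
  map_h : Φ * matH d = tens (matH a) (matH b) * Φ

/-- The component of `ℂ^a ⊗ ℂ^b` of type `ℂ^d`: the sum of the images of all `sl₂`-homomorphisms
`ℂ^d → ℂ^a ⊗ ℂ^b`. -/
def component (a b d : ℕ) : Submodule ℂ (Fin a × Fin b → ℂ) :=
  ⨆ Φ : {Φ : Matrix (Fin a × Fin b) (Fin d) ℂ // IsSl2Hom a b d Φ}, LinearMap.range Φ.1.mulVecLin

/-- The Clebsch–Gordan filtration of `ℂ^a ⊗ ℂ^b = ⨁_{k < min a b} ℂ^{a+b-1-2k}`: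
`V(l)` is the sum of the components `ℂ^{a+b-1-2k}` with `k ≤ l`.
(For `k ≥ min a b` the component is zero, so that no bound on `k` is needed, and
`V(l) = ℂ^a ⊗ ℂ^b` as soon as `l ≥ min a b - 1`.) -/
def cgFiltration (a b l : ℕ) : Submodule ℂ (Fin a × Fin b → ℂ) :=
  ⨆ k : Fin (l + 1), component a b (a + b - 1 - 2 * (k : ℕ))

section helpers

lemma matEF (d : ℕ) : matE d * matF d = matF d * matE d + matH d := by
  ext p r
  simp only [matE, matF, matH, Matrix.mul_apply, Matrix.add_apply, Matrix.of_apply,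
    Matrix.diagonal_apply]
  have h1 : ∀ q : Fin d, ((if (p : ℕ) = q + 1 then (1 : ℂ) else 0) *
      (if (r : ℕ) = q + 1 then (r : ℂ) * ((d : ℂ) - r) else 0)) =
      if (p : ℕ) = q + 1 then (if p = r then (r : ℂ) * ((d : ℂ) - r) else 0) else 0 := by
    intro q
    have := @Fin.ext_iff d p r
    split_ifs <;> first | (exfalso; omega) | simp
  have h2 : ∀ q : Fin d, ((if (q : ℕ) = p + 1 then (q : ℂ) * ((d : ℂ) - q) else 0) *
      (if (q : ℕ) = r + 1 then (1 : ℂ) else 0)) =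
      if (q : ℕ) = p + 1 then
        (if p = r then ((p : ℂ) + 1) * ((d : ℂ) - ((p : ℂ) + 1)) else 0) else 0 := by
    intro q
    have := @Fin.ext_iff d p r
    split_ifs with h <;> first | (exfalso; omega) | simp [h]
  rw [Finset.sum_congr rfl (fun q _ => h1 q), Finset.sum_congr rfl (fun q _ => h2 q)]
  by_cases hpr : p = r
  · subst hpr
    simp only [if_true]
    have e1 : (∑ q : Fin d, if (p : ℕ) = q + 1 then (p : ℂ) * ((d : ℂ) - p) else 0)
        = (p : ℂ) * ((d : ℂ) - p) := by
      rcases Nat.eq_zero_or_pos (p : ℕ) with h0 | h0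
      · simp [h0]
      · rw [Finset.sum_eq_single (⟨p - 1, by omega⟩ : Fin d)]
        · rw [if_pos]; simp only; omega
        · intro q _ hq
          rw [if_neg]
          intro h; apply hq; ext; simp only; omega
        · simp
    have e2 : (∑ q : Fin d, if (q : ℕ) = p + 1 then
        ((p : ℂ) + 1) * ((d : ℂ) - ((p : ℂ) + 1)) else 0)
        = ((p : ℂ) + 1) * ((d : ℂ) - ((p : ℂ) + 1)) := by
      rcases Nat.lt_or_ge ((p : ℕ) + 1) d with h0 | h0
      · rw [Finset.sum_eq_single (⟨p + 1, h0⟩ : Fin d)]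
        · rw [if_pos rfl]
        · intro q _ hq
          rw [if_neg]
          intro h; apply hq; ext; simp only; omega
        · simp
      · have : (d : ℂ) = (p : ℂ) + 1 := by
          have : d = p + 1 := by omega
          exact_mod_cast this
        simp [this]
    rw [e1, e2]; ring
  · simp [hpr]

lemma matHE (d : ℕ) : matH d * matE d = matE d * matH d + (2 : ℂ) • matE d := by
  ext p q
  simp only [matE, matH, Matrix.diagonal_mul, Matrix.mul_diagonal, Matrix.add_apply,
    Matrix.smul_apply, Matrix.of_apply, smul_eq_mul]
  split_ifs with h
  · rw [h]; push_cast; ring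
  · ring

lemma matHF (d : ℕ) : matH d * matF d = matF d * matH d - (2 : ℂ) • matF d := by
  ext p q
  simp only [matF, matH, Matrix.diagonal_mul, Matrix.mul_diagonal, Matrix.sub_apply,
    Matrix.smul_apply, Matrix.of_apply, smul_eq_mul]
  split_ifs with h
  · rw [h]; push_cast; ring
  · ring

variable {M : Type*} [AddCommGroup M] [Module ℂ M]

/-- The relations of `sl₂` between three operators, together with a weak finiteness of `e`. -/
structure Sl2Ops (E F H : Module.End ℂ M) : Prop where
  ef : ∀ x, E (F x) = F (E x) + H x
  he : ∀ x, H (E x) = E (H x) + (2 : ℂ) • E x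
  hf : ∀ x, H (F x) = F (H x) - (2 : ℂ) • F x
  nil : ∀ x (c : ℂ), H x = c • x → ∃ N, (E ^ N) x = 0

lemma Sl2Ops.h_pow {E F H : Module.End ℂ M} (S : Sl2Ops E F H) {w : M} {μ : ℂ}
    (hw : H w = -μ • w) (j : ℕ) : H ((E ^ j) w) = (2 * j - μ) • (E ^ j) w := by
  induction j with
  | zero => simp [hw]
  | succ j ih =>
    rw [pow_succ', Module.End.mul_apply, S.he, ih, map_smul, ← add_smul]
    congr 1; push_cast; ring

lemma Sl2Ops.f_pow {E F H : Module.End ℂ M} (S : Sl2Ops E F H) {w : M} {μ : ℂ}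
    (hf : F w = 0) (hw : H w = -μ • w) (j : ℕ) :
    F ((E ^ (j + 1)) w) = ((j + 1) * (μ - j)) • (E ^ j) w := by
  induction j with
  | zero =>
    have := S.ef w
    rw [hf, map_zero, hw] at this
    have h2 : F (E w) = μ • w := by
      rw [eq_comm, neg_smul, add_neg_eq_zero] at this; exact this
    simp [h2]
  | succ j ih =>
    have h1 := S.ef ((E ^ (j + 1)) w)
    rw [S.h_pow hw, ih, map_smul, ← Module.End.mul_apply E, ← pow_succ',
      ← Module.End.mul_apply E, ← pow_succ'] at h1
    rw [← sub_eq_iff_eq_add] at h1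
    rw [← h1, ← sub_smul]
    congr 1; push_cast; ring

lemma Sl2Ops.eq_zero {E F H : Module.End ℂ M} (S : Sl2Ops E F H) {w : M} {μ : ℂ}
    (hf : F w = 0) (hw : H w = -μ • w) (hμ : ∀ j : ℕ, μ ≠ j) : w = 0 := by
  obtain ⟨N, hN⟩ := S.nil w (-μ) hw
  induction N with
  | zero => simpa using hN
  | succ N ih =>
    apply ih
    have := S.f_pow hf hw N
    rw [hN, map_zero, eq_comm, smul_eq_zero] at this
    rcases this with h | h
    · exfalso
      rcases mul_eq_zero.1 h with h | h
      · exact Nat.cast_add_one_ne_zero N h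
      · exact hμ N (sub_eq_zero.1 h)
    · exact h

lemma Sl2Ops.pow_eq_zero {E F H : Module.End ℂ M} (S : Sl2Ops E F H) {w : M} {m : ℕ}
    (hf : F w = 0) (hw : H w = -(m : ℂ) • w) : (E ^ (m + 1)) w = 0 := by
  apply S.eq_zero (μ := -((m : ℂ) + 2))
  · rw [S.f_pow hf hw]; simp
  · rw [S.h_pow hw]; congr 1; push_cast; ring
  · intro j hj
    have : ((m + 2 + j : ℕ) : ℂ) = 0 := by push_cast; rw [← hj]; ring
    rw [Nat.cast_eq_zero] at this; omega

/-- Decomposition of `E₁ v`, where `v` is singular and `(E₁, F₁, H₁)` transforms under the adjoint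
representation. -/
lemma Sl2Ops.decomp {E F H : Module.End ℂ M} (S : Sl2Ops E F H) {E₁ F₁ H₁ : Module.End ℂ M}
    (c1 : ∀ x, E (E₁ x) = E₁ (E x)) (c2 : ∀ x, F (E₁ x) = E₁ (F x) - H₁ x)
    (c3 : ∀ x, F (H₁ x) = H₁ (F x) + (2 : ℂ) • F₁ x) (c4 : ∀ x, F (F₁ x) = F₁ (F x))
    (c5 : ∀ x, H (E₁ x) = E₁ (H x) + (2 : ℂ) • E₁ x)
    {v : M} {m : ℕ} (hf : F v = 0) (hw : H v = -(m : ℂ) • v) :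
    ∃ w₀ w₁ w₂ : M, E₁ v = w₀ + E w₁ + (E ^ 2) w₂ ∧
      F w₀ = 0 ∧ F w₁ = 0 ∧ F w₂ = 0 ∧ H w₀ = -((m : ℂ) - 2) • w₀ ∧ H w₁ = -(m : ℂ) • w₁ ∧
      H w₂ = -((m : ℂ) + 2) • w₂ := by
  have hx : H (E₁ v) = -((m : ℂ) - 2) • E₁ v := by
    rw [c5, hw, map_smul, ← add_smul]; congr 1; ring
  have hfx : F (E₁ v) = -H₁ v := by rw [c2, hf]; simp
  have hffx : F (F (E₁ v)) = -((2 : ℂ) • F₁ v) := by rw [hfx, map_neg, c3, hf]; simp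
  have hfffx : F (F (F (E₁ v))) = 0 := by rw [hffx, map_neg, map_smul, c4, hf]; simp
  have hhfx : H (F (E₁ v)) = -(m : ℂ) • F (E₁ v) := by
    rw [S.hf, hx, map_smul, ← sub_smul]; congr 1; ring
  have hhffx : H (F (F (E₁ v))) = -((m : ℂ) + 2) • F (F (E₁ v)) := by
    rw [S.hf, hhfx, map_smul, ← sub_smul]; congr 1; ring
  set x := E₁ v with hxdef
  rcases Nat.eq_zero_or_pos m with rfl | hm
  · -- trivial representation
    have hev : E v = 0 := by simpa using S.pow_eq_zero hf hw
    have hex : E x = 0 := by rw [hxdef, c1, hev, map_zero]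
    have e1 : E (F x) = (2 : ℂ) • x := by rw [S.ef, hex, hx]; simp
    have e2 : E (F (F x)) = (2 : ℂ) • F x := by rw [S.ef, e1, hhfx]; simp
    have e3 : (E ^ 2) (F (F x)) = (4 : ℂ) • x := by
      rw [pow_two, Module.End.mul_apply, e2, map_smul, e1, smul_smul]; norm_num
    refine ⟨0, 0, (1 / 4 : ℂ) • F (F x), ?_, by simp, by simp, ?_, by simp, by simp, ?_⟩
    · rw [map_smul, e3, smul_smul]; norm_num
    · rw [map_smul, hfffx, smul_zero]
    · rw [map_smul, hhffx, smul_comm]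
  · have hm0 : (m : ℂ) ≠ 0 := by exact_mod_cast hm.ne'
    have hm1 : (m : ℂ) + 1 ≠ 0 := Nat.cast_add_one_ne_zero m
    have hm2 : (m : ℂ) + 2 ≠ 0 := by exact_mod_cast (by omega : m + 2 ≠ 0)
    obtain ⟨β, hβ⟩ : ∃ β : ℂ, β * (2 * (m + 1) * (m + 2)) = 1 :=
      ⟨(2 * (m + 1) * (m + 2))⁻¹, inv_mul_cancel₀ (by
        simp only [ne_eq, mul_eq_zero, not_or]; exact ⟨⟨two_ne_zero, hm1⟩, hm2⟩)⟩
    set y := F (F x) with hy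
    have g1 : F ((E ^ 2) y) = (2 * ((m : ℂ) + 1)) • E y := by
      have := S.f_pow hfffx hhffx 1
      rw [this]; simp only [pow_one]; congr 1; push_cast; ring
    have g2 : F (E y) = ((m : ℂ) + 2) • y := by
      have := S.f_pow hfffx hhffx 0
      simpa using this
    have g3 : H ((E ^ 2) y) = -((m : ℂ) - 2) • (E ^ 2) y := by
      rw [S.h_pow hhffx]; congr 1; push_cast; ring
    set x' := x - β • (E ^ 2) y with hx'
    have k1 : F x' = F x - (β * (2 * ((m : ℂ) + 1))) • E y := by
      rw [hx', map_sub, map_smul, g1, smul_smul]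
    have k2 : F (F x') = 0 := by
      rw [k1, map_sub, map_smul, g2, smul_smul, ← hy]
      rw [show β * (2 * ((m : ℂ) + 1)) * ((m : ℂ) + 2) = 1 by
        linear_combination hβ]
      simp
    have k3 : H x' = -((m : ℂ) - 2) • x' := by
      rw [hx', map_sub, map_smul, hx, g3, smul_sub, smul_comm β]
    have k4 : H (F x') = -(m : ℂ) • F x' := by
      rw [S.hf, k3, map_smul, ← sub_smul]; congr 1; ring
    have k5 : F (E (F x')) = (m : ℂ) • F x' := by
      have := S.f_pow k2 k4 0
      simpa using this
    have k6 : H (E (F x')) = -((m : ℂ) - 2) • E (F x') := by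
      rw [S.he, k4, map_smul, ← add_smul]; congr 1; ring
    refine ⟨x' - (m : ℂ)⁻¹ • E (F x'), (m : ℂ)⁻¹ • F x', β • y, ?_, ?_, ?_, ?_, ?_, ?_, ?_⟩
    · rw [map_smul, map_smul, hx']; abel
    · rw [map_sub, map_smul, k5, smul_smul, inv_mul_cancel₀ hm0]; simp
    · rw [map_smul, k2, smul_zero]
    · rw [map_smul, hfffx, smul_zero]
    · rw [map_sub, map_smul, k3, k6, smul_comm (m : ℂ)⁻¹, ← smul_sub]
    · rw [map_smul, k4, smul_comm]
    · rw [map_smul, hhffx, smul_comm]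

lemma tens_mul {a b : ℕ} {x x' z : Matrix (Fin a) (Fin a) ℂ} {y y' w : Matrix (Fin b) (Fin b) ℂ}
    (hx : x * x' = x' * x + z) (hy : y * y' = y' * y + w) :
    tens x y * tens x' y' = tens x' y' * tens x y + tens z w := by
  simp only [tens, add_mul, mul_add, ← Matrix.mul_kronecker_mul, Matrix.mul_one, Matrix.one_mul,
    hx, hy, Matrix.add_kronecker, Matrix.kronecker_add]
  abel

lemma tens_smul {a b : ℕ} (c : ℂ) (x : Matrix (Fin a) (Fin a) ℂ) (y : Matrix (Fin b) (Fin b) ℂ) :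
    tens (c • x) (c • y) = c • tens x y := by
  simp [tens, Matrix.smul_kronecker, Matrix.kronecker_smul]

lemma tens_zero_zero (a b : ℕ) :
    tens (0 : Matrix (Fin a) (Fin a) ℂ) (0 : Matrix (Fin b) (Fin b) ℂ) = 0 := by
  simp [tens]

lemma tens_h_mulVec {a b : ℕ} (w : Fin a × Fin b → ℂ) (p : Fin a × Fin b) :
    (tens (matH a) (matH b)).mulVec w p =
      (2 * ((p.1 : ℂ) + p.2) - ((a : ℂ) + b - 2)) * w p := by
  have : tens (matH a) (matH b) = Matrix.diagonal fun p : Fin a × Fin b =>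
      (2 * ((p.1 : ℂ) + p.2) - ((a : ℂ) + b - 2)) := by
    ext p q
    obtain ⟨p1, p2⟩ := p
    obtain ⟨q1, q2⟩ := q
    simp only [tens, matH, Matrix.add_apply, Matrix.kroneckerMap_apply, Matrix.diagonal_apply,
      Matrix.one_apply, Prod.mk.injEq]
    by_cases h1 : p1 = q1 <;> by_cases h2 : p2 = q2 <;> simp [h1, h2]
    ring
  rw [this, Matrix.mulVec_diagonal]

lemma tens_comm_mulVec {a b : ℕ} {x x' z : Matrix (Fin a) (Fin a) ℂ}
    {y y' w : Matrix (Fin b) (Fin b) ℂ}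
    (hx : x * x' = x' * x + z) (hy : y * y' = y' * y + w) (v : Fin a × Fin b → ℂ) :
    (tens x y).mulVecLin ((tens x' y').mulVecLin v) =
      (tens x' y').mulVecLin ((tens x y).mulVecLin v) + (tens z w).mulVecLin v := by
  simp only [Matrix.mulVecLin_apply, Matrix.mulVec_mulVec, tens_mul hx hy, Matrix.add_mulVec]

lemma smul_tens_mulVec {a b : ℕ} (c : ℂ) (x : Matrix (Fin a) (Fin a) ℂ)
    (y : Matrix (Fin b) (Fin b) ℂ) (v : Fin a × Fin b → ℂ) :
    (tens (c • x) (c • y)).mulVecLin v = c • (tens x y).mulVecLin v := by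
  simp [tens_smul]

lemma matHF' (d : ℕ) : matH d * matF d = matF d * matH d + (-2 : ℂ) • matF d := by
  rw [matHF, sub_eq_add_neg, neg_smul]

lemma tens_sl2Ops (a b : ℕ) :
    Sl2Ops (tens (matE a) (matE b)).mulVecLin (tens (matF a) (matF b)).mulVecLin
      (tens (matH a) (matH b)).mulVecLin where
  ef v := tens_comm_mulVec (matEF a) (matEF b) v
  he v := by rw [tens_comm_mulVec (matHE a) (matHE b) v, smul_tens_mulVec]
  hf v := by
    rw [tens_comm_mulVec (matHF' a) (matHF' b) v, smul_tens_mulVec, neg_smul, sub_eq_add_neg]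
  nil v c hv := by
    obtain ⟨N, hN⟩ := exists_nat_gt ((a : ℝ) + b - c.re)
    refine ⟨N, ?_⟩
    set E := (tens (matE a) (matE b)).mulVecLin with hE
    have key : ∀ j : ℕ, (tens (matH a) (matH b)).mulVecLin ((E ^ j) v) = (c + 2 * j) • (E ^ j) v := by
      intro j
      induction j with
      | zero => simp [hv]
      | succ j ih =>
        rw [pow_succ', Module.End.mul_apply, hE, tens_comm_mulVec (matHE a) (matHE b),
          smul_tens_mulVec, ← hE, ih, map_smul, ← add_smul]
        congr 1; push_cast; ring
    have h := key N
    ext p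
    have hp := congrFun h p
    rw [Matrix.mulVecLin_apply, tens_h_mulVec, Pi.smul_apply, smul_eq_mul] at hp
    rcases mul_eq_mul_right_iff.1 hp with h0 | h0
    · exfalso
      have hre := congrArg Complex.re h0
      have p1 : ((p.1 : ℕ) : ℝ) + 1 ≤ a := by exact_mod_cast p.1.2
      have p2 : ((p.2 : ℕ) : ℝ) + 1 ≤ b := by exact_mod_cast p.2.2
      simp at hre
      have hN0 : (0 : ℝ) ≤ N := Nat.cast_nonneg N
      linarith
    · exact h0

lemma isSl2Hom_of_singular {a b m : ℕ} {w : Fin a × Fin b → ℂ}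
    (hf : (tens (matF a) (matF b)).mulVecLin w = 0)
    (hw : (tens (matH a) (matH b)).mulVecLin w = -(m : ℂ) • w) :
    IsSl2Hom a b (m + 1) (Matrix.of fun p (j : Fin (m + 1)) =>
      (((tens (matE a) (matE b)).mulVecLin ^ (j : ℕ)) w) p) := by
  have S := tens_sl2Ops a b
  set E := (tens (matE a) (matE b)).mulVecLin with hE
  set G := (tens (matF a) (matF b)).mulVecLin with hG
  have hcol : ∀ (A : Matrix (Fin a × Fin b) (Fin a × Fin b) ℂ) (p) (j : Fin (m + 1)),
      (A * (Matrix.of fun p (j : Fin (m + 1)) => ((E ^ (j : ℕ)) w) p)) p j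
        = A.mulVecLin ((E ^ (j : ℕ)) w) p := by
    intro A p j
    simp [Matrix.mul_apply, Matrix.mulVec, dotProduct]
  constructor
  · ext p j
    rw [hcol, ← hE, ← Module.End.mul_apply, ← pow_succ']
    simp only [Matrix.mul_apply, matE, Matrix.of_apply, mul_ite, mul_one, mul_zero]
    rcases Nat.lt_or_ge ((j : ℕ) + 1) (m + 1) with h0 | h0
    · rw [Finset.sum_eq_single (⟨j + 1, h0⟩ : Fin (m + 1))]
      · simp
      · intro q _ hq
        rw [if_neg]
        intro h; apply hq; ext; simp only; omega
      · simp
    · have : (j : ℕ) = m := by omega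
      rw [this, S.pow_eq_zero hf hw, Finset.sum_eq_zero]
      · rfl
      · intro q _
        rw [if_neg]; omega
  · ext p j
    rw [hcol, ← hG]
    simp only [Matrix.mul_apply, matF, Matrix.of_apply, mul_ite, mul_zero]
    rcases Nat.eq_zero_or_pos (j : ℕ) with h0 | h0
    · rw [h0, pow_zero, Module.End.one_apply, hf, Finset.sum_eq_zero]
      · rfl
      · intro q _
        rw [if_neg]; omega
    · obtain ⟨i, hi⟩ : ∃ i, (j : ℕ) = i + 1 := ⟨j - 1, by omega⟩
      rw [hi, S.f_pow hf hw, Finset.sum_eq_single (⟨i, by omega⟩ : Fin (m + 1))]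
      · simp; ring
      · intro q _ hq
        rw [if_neg]
        intro h; apply hq; ext; simp only; omega
      · simp
  · ext p j
    rw [hcol, S.h_pow hw]
    simp [matH, Matrix.mul_diagonal]; ring

lemma range_le_cgFiltration {a b l k : ℕ} (hk : k ≤ l)
    {Φ : Matrix (Fin a × Fin b) (Fin (a + b - 1 - 2 * k)) ℂ} (hΦ : IsSl2Hom a b _ Φ)
    (v : Fin (a + b - 1 - 2 * k) → ℂ) : Φ.mulVec v ∈ cgFiltration a b l := by
  have h1 : Φ.mulVec v ∈ component a b (a + b - 1 - 2 * k) :=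
    Submodule.mem_iSup_of_mem ⟨Φ, hΦ⟩ ⟨v, rfl⟩
  exact Submodule.mem_iSup_of_mem (⟨k, by omega⟩ : Fin (l + 1)) h1

lemma singular_mem {a b k l : ℕ} (hkl : k ≤ l) {w : Fin a × Fin b → ℂ}
    (hf : (tens (matF a) (matF b)).mulVecLin w = 0)
    (hw : (tens (matH a) (matH b)).mulVecLin w = -((a : ℂ) + b - 2 - 2 * k) • w) (j : ℕ) :
    ((tens (matE a) (matE b)).mulVecLin ^ j) w ∈ cgFiltration a b l := by
  by_cases hw0 : w = 0
  · simp [hw0]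
  have S := tens_sl2Ops a b
  obtain ⟨p, hp⟩ := Function.ne_iff.1 hw0
  have hp1 := p.1.2
  have hp2 := p.2.2
  by_cases hk : 2 * k + 2 ≤ a + b
  · obtain ⟨m, hm⟩ : ∃ m, m + 1 = a + b - 1 - 2 * k := ⟨a + b - 2 - 2 * k, by omega⟩
    have hmc : (a : ℂ) + b - 2 - 2 * k = m := by
      have : a + b = m + 2 + 2 * k := by omega
      have : (a : ℂ) + b = m + 2 + 2 * k := by exact_mod_cast this
      rw [this]; ring
    rw [hmc] at hw
    rcases Nat.lt_or_ge j (m + 1) with hj | hj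
    · have h := isSl2Hom_of_singular hf hw
      have h2 : (((tens (matE a) (matE b)).mulVecLin ^ j) w) ∈ component a b (m + 1) := by
        refine Submodule.mem_iSup_of_mem ⟨_, h⟩ ⟨Pi.single ⟨j, hj⟩ 1, ?_⟩
        ext q
        simp
      rw [hm] at h2
      exact Submodule.mem_iSup_of_mem (⟨k, by omega⟩ : Fin (l + 1)) h2
    · obtain ⟨i, rfl⟩ : ∃ i, j = i + (m + 1) := ⟨j - (m + 1), by omega⟩
      rw [pow_add, Module.End.mul_apply, S.pow_eq_zero hf hw]
      simp
  · exfalso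
    apply hw0
    refine S.eq_zero hf hw ?_
    intro i hi
    have : ((a + b : ℕ) : ℂ) = ((i + 2 + 2 * k : ℕ) : ℂ) := by
      push_cast; linear_combination hi
    have := Nat.cast_injective this
    omega

lemma cg_mono {a b l l' : ℕ} (h : l ≤ l') : cgFiltration a b l ≤ cgFiltration a b l' := by
  refine iSup_le fun k => ?_
  exact le_iSup (fun k : Fin (l' + 1) => component a b (a + b - 1 - 2 * (k : ℕ)))
    (⟨k, by omega⟩ : Fin (l' + 1))

lemma cg_induction {a b l : ℕ} {P : (Fin a × Fin b → ℂ) → Prop} (h0 : P 0)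
    (hadd : ∀ x y, P x → P y → P (x + y))
    (h : ∀ k ≤ l, ∀ Φ : Matrix (Fin a × Fin b) (Fin (a + b - 1 - 2 * k)) ℂ,
      IsSl2Hom a b _ Φ → ∀ v, P (Φ.mulVec v)) {w} (hw : w ∈ cgFiltration a b l) : P w := by
  induction hw using Submodule.iSup_induction' with
  | mem k x hx =>
    induction hx using Submodule.iSup_induction' with
    | mem Φ x hx =>
      obtain ⟨v, rfl⟩ := hx
      exact h k (by omega) Φ.1 Φ.2 v
    | zero => exact h0
    | add x y _ _ hx hy => exact hadd _ _ hx hy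
  | zero => exact h0
  | add x y _ _ hx hy => exact hadd _ _ hx hy

lemma tensE_mem {a b l : ℕ} {w : Fin a × Fin b → ℂ} (hw : w ∈ cgFiltration a b l) :
    (tens (matE a) (matE b)).mulVecLin w ∈ cgFiltration a b l := by
  refine cg_induction (P := fun w => (tens (matE a) (matE b)).mulVecLin w ∈ cgFiltration a b l)
    ?_ ?_ ?_ hw
  · simp
  · intro x y hx hy
    rw [map_add]; exact add_mem hx hy
  · intro k hk Φ hΦ v
    rw [Matrix.mulVecLin_apply, Matrix.mulVec_mulVec, ← hΦ.map_e, ← Matrix.mulVec_mulVec]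
    exact range_le_cgFiltration hk hΦ _

lemma tensE_pow_mem {a b l : ℕ} {w : Fin a × Fin b → ℂ} (hw : w ∈ cgFiltration a b l) (j : ℕ) :
    ((tens (matE a) (matE b)).mulVecLin ^ j) w ∈ cgFiltration a b l := by
  induction j with
  | zero => simpa
  | succ j ih => rw [pow_succ', Module.End.mul_apply]; exact tensE_mem ih

/-- `e ⊗ 1` raises the filtration degree by at most one: case of a singular vector. -/
lemma tensE1_singular {a b k l : ℕ} (hkl : k ≤ l) {w : Fin a × Fin b → ℂ} {m : ℕ}
    (hm : (a : ℂ) + b - 2 - 2 * k = m)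
    (hf : (tens (matF a) (matF b)).mulVecLin w = 0)
    (hw : (tens (matH a) (matH b)).mulVecLin w = -(m : ℂ) • w) :
    (tens (matE a) (0 : Matrix (Fin b) (Fin b) ℂ)).mulVecLin w ∈ cgFiltration a b (l + 1) := by
  have S := tens_sl2Ops a b
  obtain ⟨w₀, w₁, w₂, hsum, f0, f1, f2, h0, h1, h2⟩ :=
    S.decomp (E₁ := (tens (matE a) (0 : Matrix (Fin b) (Fin b) ℂ)).mulVecLin)
      (F₁ := (tens (matF a) (0 : Matrix (Fin b) (Fin b) ℂ)).mulVecLin)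
      (H₁ := (tens (matH a) (0 : Matrix (Fin b) (Fin b) ℂ)).mulVecLin)
      (by
        intro x
        rw [tens_comm_mulVec (z := 0) (w := 0) (by simp) (by simp), tens_zero_zero]; simp)
      (by
        intro x
        rw [tens_comm_mulVec (z := (-1 : ℂ) • matH a) (w := (-1 : ℂ) • 0)
          (by rw [matEF]; simp) (by simp), smul_tens_mulVec]
        simp [sub_eq_add_neg])
      (by
        intro x
        rw [tens_comm_mulVec (z := (2 : ℂ) • matF a) (w := (2 : ℂ) • 0)
          (by rw [matHF]; simp) (by simp), smul_tens_mulVec])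
      (by
        intro x
        rw [tens_comm_mulVec (z := 0) (w := 0) (by simp) (by simp), tens_zero_zero]; simp)
      (by
        intro x
        rw [tens_comm_mulVec (z := (2 : ℂ) • matE a) (w := (2 : ℂ) • 0)
          (by rw [matHE]) (by simp), smul_tens_mulVec])
      hf hw
  rw [hsum]
  refine add_mem (add_mem ?_ ?_) ?_
  · refine singular_mem (k := k + 1) (by omega) f0 ?_ 0
    rw [h0]; congr 1; rw [← hm]; push_cast; ring
  · have := singular_mem (k := k) (l := l + 1) (by omega) f1 (by rw [h1, ← hm]) 1
    simpa using this
  · rcases k with _ | k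
    · have : w₂ = 0 := by
        ext p
        have hp := congrFun h2 p
        rw [Matrix.mulVecLin_apply, tens_h_mulVec, Pi.smul_apply, smul_eq_mul] at hp
        rcases mul_eq_mul_right_iff.1 hp with hh | hh
        · exfalso
          have : ((2 * ((p.1 : ℕ) + p.2) + 2 : ℕ) : ℂ) = 0 := by
            rw [← hm] at hh
            push_cast at hh ⊢; linear_combination hh
          rw [Nat.cast_eq_zero] at this; omega
        · exact hh
      rw [this]; simp
    · refine singular_mem (k := k) (by omega) f2 ?_ 2
      rw [h2]; congr 1; rw [← hm]; push_cast; ring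

/-- `e ⊗ 1` raises the filtration degree by at most one. -/
lemma tensE1_mem {a b l : ℕ} {w : Fin a × Fin b → ℂ} (hw : w ∈ cgFiltration a b l) :
    (tens (matE a) (0 : Matrix (Fin b) (Fin b) ℂ)).mulVecLin w ∈ cgFiltration a b (l + 1) := by
  refine cg_induction (P := fun w =>
    (tens (matE a) (0 : Matrix (Fin b) (Fin b) ℂ)).mulVecLin w ∈ cgFiltration a b (l + 1))
    ?_ ?_ ?_ hw
  · simp
  · intro x y hx hy
    rw [map_add]; exact add_mem hx hy
  · intro k hk
    generalize hd : a + b - 1 - 2 * k = d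
    intro Φ hΦ v
    have hv : v = ∑ j : Fin d, v j • Pi.single j (1 : ℂ) := by
      ext q; simp [Finset.sum_apply, Pi.single_apply]
    rw [hv, Matrix.mulVec_sum, map_sum]
    refine Submodule.sum_mem _ fun j _ => ?_
    rw [Matrix.mulVec_smul, map_smul]
    refine Submodule.smul_mem _ _ ?_
    have hd0 : 0 < d := by have := j.2; omega
    set w := Φ.mulVec (Pi.single ⟨0, hd0⟩ 1) with hwdef
    have hpow : ∀ i : ℕ, ∀ hi : i < d, Φ.mulVec (Pi.single (⟨i, hi⟩ : Fin d) (1 : ℂ)) =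
        ((tens (matE a) (matE b)).mulVecLin ^ i) w := by
      intro i
      induction i with
      | zero => intro hi; simp [hwdef]
      | succ i ih =>
        intro hi
        rw [pow_succ', Module.End.mul_apply, ← ih (by omega), Matrix.mulVecLin_apply,
          Matrix.mulVec_mulVec, ← hΦ.map_e, ← Matrix.mulVec_mulVec]
        congr 1
        ext q
        simp [matE, Pi.single_apply, Fin.ext_iff]
    have hf : (tens (matF a) (matF b)).mulVecLin w = 0 := by
      rw [hwdef, Matrix.mulVecLin_apply, Matrix.mulVec_mulVec, ← hΦ.map_f, ← Matrix.mulVec_mulVec]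
      have h0 : (matF d).mulVec (Pi.single ⟨0, hd0⟩ 1) = 0 := by
        ext q
        simp [matF]
      rw [h0, Matrix.mulVec_zero]
    have hm : (a : ℂ) + b - 2 - 2 * k = ((d - 1 : ℕ) : ℂ) := by
      have : a + b = (d - 1) + 2 + 2 * k := by omega
      have : (a : ℂ) + b = ((d - 1 : ℕ) : ℂ) + 2 + 2 * k := by exact_mod_cast this
      rw [this]; ring
    have hh : (tens (matH a) (matH b)).mulVecLin w = -((d - 1 : ℕ) : ℂ) • w := by
      rw [hwdef, Matrix.mulVecLin_apply, Matrix.mulVec_mulVec, ← hΦ.map_h, ← Matrix.mulVec_mulVec,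
        ← Matrix.mulVec_smul]
      congr 1
      ext q
      rw [matH, Matrix.mulVec_diagonal]
      by_cases hq : q = ⟨0, hd0⟩
      · subst hq
        rw [Nat.cast_sub (by omega)]
        simp
      · simp [hq]
    have hcomm : ∀ (i : ℕ) (x : Fin a × Fin b → ℂ),
        (tens (matE a) (0 : Matrix (Fin b) (Fin b) ℂ)).mulVecLin
          (((tens (matE a) (matE b)).mulVecLin ^ i) x) =
        ((tens (matE a) (matE b)).mulVecLin ^ i)
          ((tens (matE a) (0 : Matrix (Fin b) (Fin b) ℂ)).mulVecLin x) := by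
      intro i
      induction i with
      | zero => intro x; simp
      | succ i ih =>
        intro x
        rw [pow_succ, Module.End.mul_apply, Module.End.mul_apply, ih,
          tens_comm_mulVec (z := 0) (w := 0) (by simp) (by simp), tens_zero_zero]
        simp
    rw [hpow j.1 j.2, hcomm]
    exact tensE_pow_mem (tensE1_singular hk hm hf hh) _

lemma tensE2_mem {a b l : ℕ} {w : Fin a × Fin b → ℂ} (hw : w ∈ cgFiltration a b l) :
    (tens (0 : Matrix (Fin a) (Fin a) ℂ) (matE b)).mulVecLin w ∈ cgFiltration a b (l + 1) := by
  have h : (tens (0 : Matrix (Fin a) (Fin a) ℂ) (matE b)).mulVecLin w =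
      (tens (matE a) (matE b)).mulVecLin w -
        (tens (matE a) (0 : Matrix (Fin b) (Fin b) ℂ)).mulVecLin w := by
    simp [tens]
  rw [h]
  exact sub_mem (tensE_mem (cg_mono (Nat.le_succ l) hw)) (tensE1_mem hw)

lemma highest_mem {a b : ℕ} (l : ℕ) (w : Fin a × Fin b → ℂ)
    (hw : ∀ p, ((p.1 : ℕ) ≠ 0 ∨ (p.2 : ℕ) ≠ 0) → w p = 0) : w ∈ cgFiltration a b l := by
  have h := singular_mem (a := a) (b := b) (k := 0) (l := l) (Nat.zero_le l) (w := w) ?_ ?_ 0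
  · simpa using h
  · ext p
    rw [Matrix.mulVecLin_apply, Matrix.mulVec, dotProduct]
    refine Finset.sum_eq_zero fun q _ => ?_
    by_cases hq : (q.1 : ℕ) ≠ 0 ∨ (q.2 : ℕ) ≠ 0
    · rw [hw q hq, mul_zero]
    · push Not at hq
      have : tens (matF a) (matF b) p q = 0 := by
        simp [tens, matF, hq.1, hq.2]
      rw [this, zero_mul]
  · ext p
    rw [Matrix.mulVecLin_apply, tens_h_mulVec]
    by_cases hq : (p.1 : ℕ) ≠ 0 ∨ (p.2 : ℕ) ≠ 0
    · simp [hw p hq]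
    · push Not at hq
      simp [hq.1, hq.2]

end helpers

/-! ### Polynomials with values in `ℂ^{a_1} ⊗ ⋯ ⊗ ℂ^{a_n}` -/

section functional

variable {n : ℕ}

/-- The index set of the basis `v_{m_1} ⊗ ⋯ ⊗ v_{m_n}` of `ℂ^{a_1} ⊗ ⋯ ⊗ ℂ^{a_n}`. -/
abbrev Idx (a : Fin n → ℕ) : Type := (i : Fin n) → Fin (a i)

/-- `ℂ^{a_1} ⊗ ⋯ ⊗ ℂ^{a_n}`-valued polynomials `f(z_1, …, z_n)`, given by their coordinates in the
basis `v_{m_1} ⊗ ⋯ ⊗ v_{m_n}`. -/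
abbrev PolyF (a : Fin n → ℕ) : Type := Idx a → MvPolynomial (Fin n) ℂ

/-- The substitution `z_i = (t + s) / 2`, `z_j = (t - s) / 2` expressing a polynomial in `z_1, …, z_n`
through `s = z_i - z_j`, `t = z_i + z_j` and the `z_l`, `l ≠ i, j`. In the result `s` is the variable
`Polynomial.X` and `t` is the variable `MvPolynomial.X i`
(the variable `MvPolynomial.X j` does not occur). -/
noncomputable def diagSubst (i j : Fin n) :
    MvPolynomial (Fin n) ℂ →ₐ[ℂ] Polynomial (MvPolynomial (Fin n) ℂ) :=
  MvPolynomial.aeval fun l =>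
    if l = i then
      (1 / 2 : ℂ) • (Polynomial.C (MvPolynomial.X i) + Polynomial.X)
    else if l = j then
      (1 / 2 : ℂ) • (Polynomial.C (MvPolynomial.X i) - Polynomial.X)
    else Polynomial.C (MvPolynomial.X l)

/-- The value at a point `x` (that is, `t = x i` and `z_l = x l` for `l ≠ i, j`) of the coefficient
`f_k^{(i,j)}` in the decomposition `f = ∑ₖ s^k f_k^{(i,j)}(t, (z_l)_{l ≠ i, j})`. -/
noncomputable def diagCoeff {a : Fin n → ℕ} (i j : Fin n) (k : ℕ) (f : PolyF a) (x : Fin n → ℂ) :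
    Idx a → ℂ :=
  fun m => MvPolynomial.eval x ((diagSubst i j (f m)).coeff k)

/-- The slice of a tensor in the directions `i, j`, all other indices being those of `m`. -/
def slice {a : Fin n → ℕ} {R : Type*} (i j : Fin n) (m : Idx a) (w : Idx a → R) :
    Fin (a i) × Fin (a j) → R :=
  fun p => w (Function.update (Function.update m i p.1) j p.2)

/-- The tensor `w` belongs to `σ^{(i,j)}(V ⊗ L^{(i,j)})`, where `L^{(i,j)}` is the tensor product of
all factors but the `i`-th and the `j`-th: all its slices in the directions `i, j` lie in `V`. -/
def SliceMem {a : Fin n → ℕ} (i j : Fin n) (V : Submodule ℂ (Fin (a i) × Fin (a j) → ℂ))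
    (w : Idx a → ℂ) : Prop :=
  ∀ m : Idx a, slice i j m w ∈ V

/-- The space `F^c`: the polynomials `f` such that, for all `i < j` and all `k`, the values of the
coefficient `f_k^{(i,j)}` of `(z_i - z_j)^k` belong to `σ^{(i,j)}(V^{(i,j)}(k) ⊗ L^{(i,j)})`. -/
noncomputable def Fc (a : Fin n → ℕ) : Submodule (MvPolynomial (Fin n) ℂ) (PolyF a) where
  carrier := {f | ∀ i j : Fin n, i < j → ∀ (k : ℕ) (x : Fin n → ℂ),
    SliceMem i j (cgFiltration (a i) (a j) k) (diagCoeff i j k f x)}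
  add_mem' := by
    intro f g hf hg i j hij k x m
    have : slice i j m (diagCoeff i j k (f + g) x) =
        slice i j m (diagCoeff i j k f x) + slice i j m (diagCoeff i j k g x) := by
      ext p; simp [slice, diagCoeff]
    rw [this]
    exact add_mem (hf i j hij k x m) (hg i j hij k x m)
  zero_mem' := by
    intro i j hij k x m
    have : slice i j m (diagCoeff i j k (0 : PolyF a) x) = 0 := by
      ext p; simp [slice, diagCoeff]
    rw [this]
    exact zero_mem _
  smul_mem' := by
    intro c f hf i j hij k x m
    have : slice i j m (diagCoeff i j k (c • f) x) =
        ∑ y ∈ Finset.HasAntidiagonal.antidiagonal k, (MvPolynomial.eval x ((diagSubst i j c).coeff y.1)) •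
          slice i j m (diagCoeff i j y.2 f x) := by
      ext p
      simp [slice, diagCoeff, Polynomial.coeff_mul, Finset.sum_apply]
    rw [this]
    refine Submodule.sum_mem _ fun y hy => Submodule.smul_mem _ _ ?_
    rw [Finset.HasAntidiagonal.mem_antidiagonal] at hy
    exact cg_mono (by omega) (hf i j hij y.2 x m)

/-- A matrix acting on the `i`-th tensor factor of vector-valued polynomials. -/
noncomputable def actOn {a : Fin n → ℕ} (i : Fin n) (g : Matrix (Fin (a i)) (Fin (a i)) ℂ) :
    PolyF a →ₗ[MvPolynomial (Fin n) ℂ] PolyF a where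
  toFun f := fun m => ∑ p : Fin (a i), MvPolynomial.C (g (m i) p) * f (Function.update m i p)
  map_add' f g := by ext1 m; simp [mul_add, Finset.sum_add_distrib]
  map_smul' c f := by
    ext1 m
    simp only [Pi.smul_apply, smul_eq_mul, RingHom.id_apply, Finset.mul_sum]
    exact Finset.sum_congr rfl fun p _ => by ring

/-- The action of `e_k = e ⊗ t^k` on vector-valued polynomials: `∑_i z_i^k e^{(i)}`, where `e^{(i)}` is
`e` acting on the `i`-th tensor factor. -/
noncomputable def currentE (a : Fin n → ℕ) (k : ℕ) :
    PolyF a →ₗ[MvPolynomial (Fin n) ℂ] PolyF a :=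
  ∑ i : Fin n, (MvPolynomial.X i ^ k : MvPolynomial (Fin n) ℂ) • actOn i (matE (a i))

/-- The same operator on scalar-valued tensors, used in proofs. -/
def actC {a : Fin n → ℕ} (i : Fin n) (g : Matrix (Fin (a i)) (Fin (a i)) ℂ) (w : Idx a → ℂ) :
    Idx a → ℂ :=
  fun m => ∑ p : Fin (a i), g (m i) p * w (Function.update m i p)

lemma diagCoeff_actOn {a : Fin n → ℕ} (i j : Fin n) (k : ℕ) (l : Fin n)
    (g : Matrix (Fin (a l)) (Fin (a l)) ℂ) (f : PolyF a) (x : Fin n → ℂ) :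
    diagCoeff i j k (actOn l g f) x = actC l g (diagCoeff i j k f x) := by
  ext m
  simp [diagCoeff, actOn, actC]

lemma slice_actC_left {a : Fin n → ℕ} {i j : Fin n} (hij : i ≠ j)
    (g : Matrix (Fin (a i)) (Fin (a i)) ℂ) (w : Idx a → ℂ) (m : Idx a) :
    slice i j m (actC i g w) =
      (tens g (0 : Matrix (Fin (a j)) (Fin (a j)) ℂ)).mulVecLin (slice i j m w) := by
  ext ⟨p, q⟩
  simp only [slice, actC, tens, Matrix.kronecker_zero, add_zero, Matrix.mulVecLin_apply,
    Matrix.mulVec, dotProduct, Fintype.sum_prod_type, Matrix.kroneckerMap_apply,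
    Matrix.one_apply]
  refine Finset.sum_congr rfl fun p' _ => ?_
  rw [Finset.sum_eq_single q]
  · rw [Function.update_of_ne hij, Function.update_self, if_pos rfl, mul_one,
      Function.update_comm hij, Function.update_comm hij, Function.update_idem]
  · intro b _ hb
    rw [if_neg (Ne.symm hb)]; simp
  · simp

lemma slice_actC_right {a : Fin n → ℕ} {i j : Fin n}
    (g : Matrix (Fin (a j)) (Fin (a j)) ℂ) (w : Idx a → ℂ) (m : Idx a) :
    slice i j m (actC j g w) =
      (tens (0 : Matrix (Fin (a i)) (Fin (a i)) ℂ) g).mulVecLin (slice i j m w) := by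
  ext ⟨p, q⟩
  simp only [slice, actC, tens, Matrix.zero_kronecker, zero_add, Matrix.mulVecLin_apply,
    Matrix.mulVec, dotProduct, Fintype.sum_prod_type_right, Matrix.kroneckerMap_apply,
    Matrix.one_apply]
  refine Finset.sum_congr rfl fun q' _ => ?_
  rw [Finset.sum_eq_single p]
  · rw [Function.update_self, if_pos rfl, one_mul, Function.update_idem]
  · intro b _ hb
    rw [if_neg (Ne.symm hb)]; simp
  · simp

lemma slice_actC_other {a : Fin n → ℕ} {i j l : Fin n} (hi : l ≠ i) (hj : l ≠ j)
    (g : Matrix (Fin (a l)) (Fin (a l)) ℂ) (w : Idx a → ℂ) (m : Idx a) :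
    slice i j m (actC l g w) =
      ∑ p : Fin (a l), g (m l) p • slice i j (Function.update m l p) w := by
  ext ⟨p, q⟩
  simp only [slice, actC, Finset.sum_apply, Pi.smul_apply, smul_eq_mul]
  refine Finset.sum_congr rfl fun p' _ => ?_
  rw [Function.update_of_ne hj, Function.update_of_ne hi, Function.update_comm hj.symm,
    Function.update_comm hi.symm]

/-- `F^c` is stable under the operators `e_k`. -/
lemma currentE_mem {a : Fin n → ℕ} (k : ℕ) {f : PolyF a} (hf : f ∈ Fc a) :
    currentE a k f ∈ Fc a := by
  intro i j hij r x m
  -- the coefficients of `z_l^k` in the expansion along `s`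
  set c : Fin n → ℕ → ℂ := fun l y =>
    MvPolynomial.eval x ((diagSubst i j (MvPolynomial.X l ^ k)).coeff y) with hc
  have hexp : slice i j m (diagCoeff i j r (currentE a k f) x) =
      ∑ l : Fin n, ∑ y ∈ Finset.HasAntidiagonal.antidiagonal r, c l y.1 •
        slice i j m (actC l (matE (a l)) (diagCoeff i j y.2 f x)) := by
    have h1 : diagCoeff i j r (currentE a k f) x = ∑ l : Fin n, ∑ y ∈ Finset.HasAntidiagonal.antidiagonal r,
        c l y.1 • actC l (matE (a l)) (diagCoeff i j y.2 f x) := by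
      ext m'
      simp only [← diagCoeff_actOn]
      simp [diagCoeff, currentE, hc, Polynomial.finsetSum_coeff, Polynomial.coeff_mul,
        LinearMap.sum_apply, Finset.sum_apply]
    rw [h1]
    ext p
    simp [slice, Finset.sum_apply]
  rw [hexp, Finset.sum_comm]
  refine Submodule.sum_mem _ fun y hy => ?_
  rw [Finset.HasAntidiagonal.mem_antidiagonal] at hy
  have hfy := hf i j hij y.2 x
  have hother : ∀ l, l ≠ i → l ≠ j → slice i j m (actC l (matE (a l)) (diagCoeff i j y.2 f x)) ∈
      cgFiltration (a i) (a j) r := by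
    intro l hi hj
    rw [slice_actC_other hi hj]
    exact Submodule.sum_mem _ fun p _ => Submodule.smul_mem _ _ (cg_mono (by omega) (hfy _))
  by_cases hy0 : y.1 = 0
  · have hcij : c i 0 = c j 0 := by
      simp [hc, diagSubst, hij.ne', Polynomial.coeff_zero_eq_eval_zero]
    have hyr : y.2 = r := by omega
    rw [hy0]
    rw [← Finset.add_sum_erase _ _ (Finset.mem_univ i),
      ← Finset.add_sum_erase _ _ (Finset.mem_erase.2 ⟨hij.ne', Finset.mem_univ j⟩), ← add_assoc]
    refine add_mem ?_ (Submodule.sum_mem _ fun l hl => Submodule.smul_mem _ _ ?_)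
    · rw [hcij, ← smul_add, slice_actC_left hij.ne, slice_actC_right]
      refine Submodule.smul_mem _ _ ?_
      have := tensE_mem (hfy m)
      rw [hyr] at this ⊢
      convert this using 1
      simp [tens]
    · simp only [Finset.mem_erase] at hl
      exact hother l hl.2.1 hl.1
  · refine Submodule.sum_mem _ fun l _ => Submodule.smul_mem _ _ ?_
    by_cases hli : l = i
    · subst hli
      rw [slice_actC_left hij.ne]
      exact cg_mono (by omega) (tensE1_mem (hfy m))
    · by_cases hlj : l = j
      · subst hlj
        rw [slice_actC_right]
        exact cg_mono (by omega) (tensE2_mem (hfy m))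
      · exact hother l hli hlj

/-- The constant polynomial equal to the tensor product `v_0 ⊗ ⋯ ⊗ v_0` of the highest vectors. -/
noncomputable def highest (a : Fin n → ℕ) : PolyF a :=
  fun m => if ∀ i, (m i : ℕ) = 0 then 1 else 0

lemma highest_mem_Fc (a : Fin n → ℕ) : highest a ∈ Fc a := by
  intro i j hij k x m
  refine highest_mem k _ fun p hp => ?_
  have : ¬ ∀ l, ((Function.update (Function.update m i p.1) j p.2) l : ℕ) = 0 := by
    intro h
    rcases hp with hp | hp
    · apply hp
      have := h i
      rwa [Function.update_of_ne hij.ne, Function.update_self] at this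
    · apply hp
      have := h j
      rwa [Function.update_self] at this
  simp [slice, diagCoeff, highest, if_neg this]

/-- The ideal `R(T)` generated by the `z_i - t_i`. -/
noncomputable def pointIdeal (T : Fin n → ℂ) : Ideal (MvPolynomial (Fin n) ℂ) :=
  Ideal.span (Set.range fun i => MvPolynomial.X i - MvPolynomial.C (T i))

/-- The fiber `M(T) = F^c / R(T) F^c`. -/
abbrev Fiber (a : Fin n → ℕ) (T : Fin n → ℂ) : Type :=
  Fc a ⧸ (pointIdeal T • ⊤ : Submodule (MvPolynomial (Fin n) ℂ) (Fc a))

/-- The operator `e_k` on `F^c`. -/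
noncomputable def fcE (a : Fin n → ℕ) (k : ℕ) : Fc a →ₗ[MvPolynomial (Fin n) ℂ] Fc a :=
  (currentE a k).restrict fun _ hf => currentE_mem k hf

/-- The operator `e_k` on `M(T)`. -/
noncomputable def fiberE (a : Fin n → ℕ) (T : Fin n → ℂ) (k : ℕ) :
    Fiber a T →ₗ[MvPolynomial (Fin n) ℂ] Fiber a T :=
  Submodule.mapQ _ _ (fcE a k) (Submodule.smul_top_le_comap_smul_top (pointIdeal T) (fcE a k))

/-- The class of the highest vector `u` in `M(T)`. -/
noncomputable def fiberU (a : Fin n → ℕ) (T : Fin n → ℂ) : Fiber a T :=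
  Submodule.Quotient.mk ⟨highest a, highest_mem_Fc a⟩

end functional

/-! ### The ideals `I(T)` in `ℂ[e_0, …, e_{n-1}]` -/

section ideals

variable {n : ℕ}

/-- The set `Σ` of the points of `ℂ^n` with pairwise distinct coordinates. -/
def distinctPoints (n : ℕ) : Set (Fin n → ℂ) := {Z | Function.Injective Z}

/-- For `Z` with pairwise distinct coordinates, `I(Z)` is the kernel of the (surjective) homomorphism
`ℂ[e_0, …, e_{n-1}] → ⨂_i ℂ[y_i] / (y_i^{a_i}) = ℂ[y_1, …, y_n] / (y_1^{a_1}, …, y_n^{a_n})`,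
`e_k ↦ ∑_i z_i^k y_i`. -/
noncomputable def genericIdeal (a : Fin n → ℕ) (Z : Fin n → ℂ) : Ideal (MvPolynomial (Fin n) ℂ) :=
  RingHom.ker ((Ideal.Quotient.mk
      (Ideal.span (Set.range fun i => (MvPolynomial.X i : MvPolynomial (Fin n) ℂ) ^ a i))).comp
    (MvPolynomial.aeval (R := ℂ) (S₁ := MvPolynomial (Fin n) ℂ) fun k : Fin n =>
      ∑ i : Fin n, MvPolynomial.C (Z i ^ (k : ℕ)) * MvPolynomial.X i).toRingHom)

/-- Convergence `I(Z) → J` of a family of ideals of a polynomial ring along a filter: for every `d`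
the spaces `I(Z)_{≤ d}` of elements of degree at most `d` converge to `J_{≤ d}` as subspaces of the
finite-dimensional space of polynomials of degree at most `d`, that is, every element of `J_{≤ d}` is
a limit of elements of `I(Z)_{≤ d}`, and every limit point of elements of `I(Z)_{≤ d}` is in `J`. -/
structure IdealTendsto {α : Type*} (I : α → Ideal (MvPolynomial (Fin n) ℂ)) (l : Filter α)
    (J : Ideal (MvPolynomial (Fin n) ℂ)) : Prop where
  lower : ∀ (d : ℕ), ∀ p ∈ J, p.totalDegree ≤ d →
    ∃ q : α → MvPolynomial (Fin n) ℂ, (∀ᶠ Z in l, q Z ∈ I Z ∧ (q Z).totalDegree ≤ d) ∧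
      ∀ m, Filter.Tendsto (fun Z => (q Z).coeff m) l (𝓝 (p.coeff m))
  upper : ∀ (d : ℕ) (p : MvPolynomial (Fin n) ℂ) (Z : ℕ → α) (q : ℕ → MvPolynomial (Fin n) ℂ),
    Filter.Tendsto Z Filter.atTop l → (∀ r, q r ∈ I (Z r) ∧ (q r).totalDegree ≤ d) →
      (∀ m, Filter.Tendsto (fun r => (q r).coeff m) Filter.atTop (𝓝 (p.coeff m))) → p ∈ J

/-- The ideal `I(T)` for an arbitrary `T ∈ ℂ^n`: all limits of elements of `I(Z)` (of bounded degree)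
as `Z → T` through the points with pairwise distinct coordinates. -/
noncomputable def limitIdeal (a : Fin n → ℕ) (T : Fin n → ℂ) : Ideal (MvPolynomial (Fin n) ℂ) where
  carrier := {p | ∃ (d : ℕ) (q : (Fin n → ℂ) → MvPolynomial (Fin n) ℂ),
    (∀ᶠ Z in 𝓝[distinctPoints n] T, q Z ∈ genericIdeal a Z ∧ (q Z).totalDegree ≤ d) ∧
      ∀ m, Filter.Tendsto (fun Z => (q Z).coeff m) (𝓝[distinctPoints n] T) (𝓝 (p.coeff m))}
  add_mem' := by
    rintro p p' ⟨d, q, h1, h2⟩ ⟨d', q', h1', h2'⟩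
    refine ⟨max d d', fun Z => q Z + q' Z, ?_, fun m => ?_⟩
    · filter_upwards [h1, h1'] with Z hZ hZ'
      exact ⟨add_mem hZ.1 hZ'.1, (MvPolynomial.totalDegree_add _ _).trans
        (max_le_max hZ.2 hZ'.2)⟩
    · simpa using (h2 m).add (h2' m)
  zero_mem' := ⟨0, fun _ => 0, by simp, fun m => by
    simpa using tendsto_const_nhds⟩
  smul_mem' := by
    rintro c p ⟨d, q, h1, h2⟩
    refine ⟨c.totalDegree + d, fun Z => c * q Z, ?_, fun m => ?_⟩
    · filter_upwards [h1] with Z hZ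
      exact ⟨Ideal.mul_mem_left _ _ hZ.1, (MvPolynomial.totalDegree_mul _ _).trans
        (Nat.add_le_add_left hZ.2 _)⟩
    · simp only [smul_eq_mul, MvPolynomial.coeff_mul]
      exact tendsto_finsetSum _ fun y _ => (h2 y.2).const_mul _

end ideals

end FusionSl2

open scoped Polynomial

namespace FusionSl2

/-! Put A = ℂ[z_1, …, z_n] and write y_i for e^{(i)}. Through `box`, the module F is
A[y]/(y_i^{a_i}), with u corresponding to 1. Let N = `orbitModule a` be the submodule generated by u
under the e_k = ∑ z_i^k y_i. The proof shows that N is free with a basis of monomials in the e_k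
applied to u, and that N = F^c. The limits and the fibers are then read off from coordinates in that
basis.

Upper bound at z = 0. The generating polynomial ∑_j y_j ∏_{l≠j} (X - z_l) of the e_k has r-th power
divisible by ∏_l (X - z_l)^{r-(a_l-1)}, because y_l^{a_l} = 0 (`prod_pow_dvd_pow_sum`). At z = 0
this becomes divisibility by a power of X (`isCurrent_fiberZero`). `IsCurrent.rank_le` shows that
such relations bound the dimension by ∏ a_i. It splits the algebra by an ideal (w), where w is a
power of the value at the origin, and this mirrors ℂ^a ⊗ ℂ^b ≅ (ℂ^{a-1} ⊗ ℂ^{b+1}) ⊕ ℂ^{b-a+1} for a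
≤ b.

Basis of N. A graded Nakayama argument, with e_k of weight k, lifts at most ∏ a_i spanning monomials
from the origin to generators of N over A (`orbit_mem_span`). Where the coordinates are distinct,
the y_i are linear combinations of the e_k, so these generators specialize to a spanning set of a
space of dimension ∏ a_i. They are therefore a basis there, and also over the fraction field
(`exists_isOrbitBasis`).

N = F^c. The inclusion N ⊆ F^c holds because the e_k preserve F^c. Conversely, near a generic point
of z_i = z_j, the algebra generated by the e_k contains y_i + y_j, (z_i - z_j) y_i and the other
y_l. These already produce everything that the Clebsch–Gordan condition allows (`insertPair_mem`,
`mem_map_box_of_diagonal`). So an element f of F^c enters N after multiplication by a polynomial not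
vanishing identically on that diagonal. Since N is free, factors z_i - z_j can then be cancelled one
by one from a relation Δ^M f ∈ N (`IsOrbitBasis.orbitModule_eq`).

Limits and fibers. The coordinates of p(e)u in the basis are polynomials in z. Their vanishing at Z
characterizes I(Z) for distinct coordinates (`IsOrbitBasis.mem_genericIdeal_iff`), and by continuity
and explicit correction it characterizes the limit ideal at every T. It also characterizes
membership of p(e)u in R(T)F^c, whence the isomorphism. -/

/-! ### An upper bound for the dimension of an algebra generated by a nilpotent current -/

/-- The order of vanishing at the origin of the `r`-th power of a current which is a limit of
currents whose values `y` at the points indexed by `s` satisfy `y ^ (x + 1) = 0`, `x ∈ s`. -/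
def vanOrd (s : Multiset ℕ) (r : ℕ) : ℕ := (s.map fun x => r - x).sum

@[simp] lemma vanOrd_zero (r : ℕ) : vanOrd 0 r = 0 := by simp [vanOrd]

@[simp] lemma vanOrd_cons (x : ℕ) (s : Multiset ℕ) (r : ℕ) :
    vanOrd (x ::ₘ s) r = (r - x) + vanOrd s r := by simp [vanOrd]

lemma vanOrd_eq_zero {s : Multiset ℕ} {r : ℕ} (h : ∀ x ∈ s, r ≤ x) : vanOrd s r = 0 := by
  induction s using Multiset.induction with
  | empty => simp
  | cons x s ih =>
    have h1 := h x (Multiset.mem_cons_self x s)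
    have h2 := ih fun z hz => h z (Multiset.mem_cons_of_mem hz)
    rw [vanOrd_cons]; omega

/-- The function `vanOrd s` is convex and piecewise linear. The affine function of q whose slope is
the number of elements below k bounds it from below, and `vanOrd_add_sum_filter` says that the two
agree at q = k. Linear bounds are needed because the improvement by powers of `e.coeff 0` is proved
for linear orders only. -/
lemma card_filter_mul_le (s : Multiset ℕ) (k q : ℕ) :
    (s.filter (· < k)).card * q ≤ vanOrd s q + (s.filter (· < k)).sum := by
  induction s using Multiset.induction with
  | empty => simp
  | cons x s ih =>
    by_cases hx : x < k
    · rw [Multiset.filter_cons_of_pos (p := (· < k)) s hx, Multiset.card_cons, Multiset.sum_cons,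
        vanOrd_cons, add_mul, one_mul]
      omega
    · rw [Multiset.filter_cons_of_neg (p := (· < k)) s hx, vanOrd_cons]
      omega

lemma vanOrd_add_sum_filter (s : Multiset ℕ) (k : ℕ) :
    vanOrd s k + (s.filter (· < k)).sum = (s.filter (· < k)).card * k := by
  induction s using Multiset.induction with
  | empty => simp
  | cons x s ih =>
    by_cases hx : x < k
    · rw [Multiset.filter_cons_of_pos (p := (· < k)) s hx, Multiset.card_cons, Multiset.sum_cons,
        vanOrd_cons, add_mul, one_mul]
      omega
    · rw [Multiset.filter_cons_of_neg (p := (· < k)) s hx, vanOrd_cons]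
      omega

lemma exists_min_cons {s : Multiset ℕ} (hs : s ≠ 0) :
    ∃ x t, s = x ::ₘ t ∧ ∀ z ∈ t, x ≤ z := by
  induction s using Multiset.induction with
  | empty => exact absurd rfl hs
  | cons x s ih =>
    rcases eq_or_ne s 0 with rfl | h0
    · exact ⟨x, 0, rfl, by simp⟩
    · obtain ⟨y, t, rfl, ht⟩ := ih h0
      rcases le_total x y with h | h
      · refine ⟨x, y ::ₘ t, rfl, fun z hz => ?_⟩
        rcases Multiset.mem_cons.1 hz with rfl | hz
        · exact h
        · exact h.trans (ht z hz)
      · refine ⟨y, x ::ₘ t, Multiset.cons_swap _ _ _, fun z hz => ?_⟩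
        rcases Multiset.mem_cons.1 hz with rfl | hz
        · exact h
        · exact ht z hz

/-! ### Currents over a commutative ring and the vanishing orders of their powers. -/

section currents

variable {R : Type*} [CommRing R]

lemma X_pow_dvd_X_mul_derivative {K : ℕ} {g : R[X]} (h : Polynomial.X ^ K ∣ g) :
    Polynomial.X ^ K ∣ Polynomial.X * Polynomial.derivative g := by
  rw [Polynomial.X_pow_dvd_iff] at h ⊢
  intro d hd
  rcases d with _ | d
  · simp
  · rw [Polynomial.coeff_X_mul, Polynomial.coeff_derivative, h _ hd, zero_mul]

/-- The coefficient of X^d in e - X e' is (1 - d) e_d, which is e_0 for d = 0 and vanishes for d =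
1. -/
lemma exists_second_order_expansion (e : R[X]) : ∃ g : R[X],
    Polynomial.C (e.coeff 0) =
      e - Polynomial.X * Polynomial.derivative e + Polynomial.X ^ 2 * g := by
  have h : (Polynomial.X ^ 2 : R[X]) ∣
      Polynomial.C (e.coeff 0) - (e - Polynomial.X * Polynomial.derivative e) := by
    rw [Polynomial.X_pow_dvd_iff]
    intro d hd
    rcases d with _ | _ | d
    · simp
    · simp [Polynomial.coeff_derivative]
    · omega
  obtain ⟨g, hg⟩ := h
  exact ⟨g, by rw [← hg]; ring⟩

variable [Algebra ℂ R]

/-- Multiplication by the value at the origin of a current improves by two the order of vanishing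
of its powers. -/
lemma X_pow_dvd_mul_coeff_zero {e : R[X]} {v : R} {m t S : ℕ} (hm : 2 ≤ m)
    (h : ∀ q, Polynomial.X ^ (m * q + t - S) ∣ Polynomial.C v * e ^ q) (q : ℕ) :
    Polynomial.X ^ (m * q + (t + 2) - S) ∣ Polynomial.C (v * e.coeff 0) * e ^ q := by
  obtain ⟨g, hg⟩ := exists_second_order_expansion e
  -- Passing from the power q to q + 1 gains m, which pays for the required 2 because 2 ≤ m.
  have hle : m * q + (t + 2) - S ≤ m * (q + 1) + t - S := by rw [mul_add]; omega
  have h1 : Polynomial.X ^ (m * q + (t + 2) - S) ∣ Polynomial.C v * e ^ (q + 1) :=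
    (pow_dvd_pow _ hle).trans (h (q + 1))
  -- Up to the factor q + 1, invertible over ℂ, the polynomial v e^q e' is the derivative of v
  -- e^{q+1}, and the operator X d/dX does not lower the order of vanishing.
  have h2 : Polynomial.X ^ (m * q + (t + 2) - S) ∣
      Polynomial.X * (Polynomial.C v * e ^ q * Polynomial.derivative e) := by
    have h3 := X_pow_dvd_X_mul_derivative h1
    have h4 : Polynomial.X * (Polynomial.C v * e ^ q * Polynomial.derivative e) =
        Polynomial.C (algebraMap ℂ R ((q : ℂ) + 1)⁻¹) * (Polynomial.X *
          Polynomial.derivative (Polynomial.C v * e ^ (q + 1))) := by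
      have hu : Polynomial.C (algebraMap ℂ R ((q : ℂ) + 1)⁻¹) * ((q : R[X]) + 1) = 1 := by
        have : ((q : R[X]) + 1) = Polynomial.C (algebraMap ℂ R ((q : ℂ) + 1)) := by simp
        rw [this, ← Polynomial.C_mul, ← map_mul, inv_mul_cancel₀ (Nat.cast_add_one_ne_zero q)]
        simp
      rw [Polynomial.derivative_C_mul, Polynomial.derivative_pow_succ]
      simp only [map_add, map_natCast, map_one]
      linear_combination (-(Polynomial.X * (Polynomial.C v * e ^ q * Polynomial.derivative e))) * hu
    rw [h4]
    exact Dvd.dvd.mul_left h3 _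
  have h5 : Polynomial.X ^ (m * q + (t + 2) - S) ∣
      Polynomial.X ^ 2 * (Polynomial.C v * e ^ q) * g := by
    refine Dvd.dvd.mul_right ?_ _
    refine (pow_dvd_pow _ (by omega : _ ≤ 2 + (m * q + t - S))).trans ?_
    rw [pow_add]
    exact mul_dvd_mul_left _ (h q)
  have : Polynomial.C (v * e.coeff 0) * e ^ q = Polynomial.C v * e ^ (q + 1) -
      Polynomial.X * (Polynomial.C v * e ^ q * Polynomial.derivative e) +
      Polynomial.X ^ 2 * (Polynomial.C v * e ^ q) * g := by
    rw [Polynomial.C_mul, hg]; ring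
  rw [this]
  exact dvd_add (dvd_sub h1 h2) h5

lemma X_pow_dvd_coeff_zero_pow_mul {e : R[X]} {m S : ℕ} (hm : 2 ≤ m)
    (h : ∀ q, Polynomial.X ^ (m * q - S) ∣ e ^ q) (y q : ℕ) :
    Polynomial.X ^ (m * q + 2 * y - S) ∣ Polynomial.C (e.coeff 0 ^ y) * e ^ q := by
  induction y generalizing q with
  | zero => simpa using h q
  | succ y ih => rw [pow_succ]; exact X_pow_dvd_mul_coeff_zero hm ih q

/-- A current all of whose powers vanish to the order prescribed by `s`, and which generates the
algebra. -/
structure IsCurrent (s : Multiset ℕ) (e : R[X]) : Prop where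
  degree_lt : ∀ k, s.card ≤ k → e.coeff k = 0
  adjoin_eq : Algebra.adjoin ℂ (Set.range e.coeff) = ⊤
  dvd : ∀ r, Polynomial.X ^ vanOrd s r ∣ e ^ r

lemma adjoin_map_coeff {R' : Type*} [CommRing R'] [Algebra ℂ R'] {f : R →ₐ[ℂ] R'}
    (hf : Function.Surjective f) {e : R[X]} (he : Algebra.adjoin ℂ (Set.range e.coeff) = ⊤) :
    Algebra.adjoin ℂ (Set.range (e.map f.toRingHom).coeff) = ⊤ := by
  have h : Set.range (e.map f.toRingHom).coeff = f '' Set.range e.coeff := by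
    rw [← Set.range_comp]; congr 1; ext k; simp
  rw [h, ← AlgHom.map_adjoin, he, Algebra.map_top]
  exact (AlgHom.range_eq_top f).2 hf

/-- Division by the parameter of a current vanishing at the origin. -/
lemma isCurrent_divX {s t : Multiset ℕ} {e : R[X]} (hst : s.card ≤ t.card + 1)
    (hdeg : ∀ k, s.card ≤ k → e.coeff k = 0)
    (hgen : Algebra.adjoin ℂ (Set.range e.coeff) = ⊤) (h0 : e.coeff 0 = 0)
    (hd : ∀ r, Polynomial.X ^ (r + vanOrd t r) ∣ e ^ r) : IsCurrent t e.divX where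
  degree_lt k hk := by rw [Polynomial.coeff_divX]; exact hdeg _ (by omega)
  adjoin_eq := by
    rw [eq_top_iff, ← hgen]
    refine Algebra.adjoin_le ?_
    rintro _ ⟨k, rfl⟩
    rcases k with _ | k
    · rw [h0]; exact zero_mem _
    · rw [← Polynomial.coeff_divX]; exact Algebra.subset_adjoin ⟨k, rfl⟩
  dvd r := by
    have he : e = Polynomial.X * e.divX := by
      conv_lhs => rw [← Polynomial.X_mul_divX_add e, h0]
      simp
    have := hd r
    rw [he, mul_pow, Polynomial.X_pow_dvd_iff] at this
    rw [Polynomial.X_pow_dvd_iff]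
    intro d hd
    have h2 := this (d + r) (by omega)
    rwa [Polynomial.coeff_X_pow_mul] at h2

/-- The element y alone contributes 1 to the order of vanishing of the (y + 1)-st power. -/
lemma IsCurrent.pow_coeff_zero {s : Multiset ℕ} {y : ℕ} {e : R[X]}
    (h : IsCurrent (y ::ₘ s) e) : e.coeff 0 ^ (y + 1) = 0 := by
  have h2 := Polynomial.X_pow_dvd_iff.1 (h.dvd (y + 1)) 0 (by rw [vanOrd_cons]; omega)
  rwa [Polynomial.coeff_zero_eq_eval_zero, Polynomial.eval_pow,
    ← Polynomial.coeff_zero_eq_eval_zero] at h2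

end currents

/-- The quotient by the top power of the value of a current at the origin. -/
lemma IsCurrent.quotient {R : Type*} [CommRing R] [Algebra ℂ R] {s : Multiset ℕ} {x y : ℕ}
    (hyx : y + 1 ≤ x) (hs : ∀ z ∈ s, x ≤ z) {e : R[X]}
    (h : IsCurrent ((y + 1) ::ₘ x ::ₘ s) e) :
    IsCurrent (y ::ₘ (x + 1) ::ₘ s)
      (e.map (Ideal.Quotient.mkₐ ℂ (Ideal.span {e.coeff 0 ^ (y + 1)})).toRingHom) where
  degree_lt k hk := by rw [Polynomial.coeff_map, h.degree_lt k (by simpa using hk), map_zero]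
  adjoin_eq := adjoin_map_coeff Ideal.Quotient.mk_surjective h.adjoin_eq
  dvd r := by
    generalize hI : Ideal.span {e.coeff 0 ^ (y + 1)} = I
    set π := (Ideal.Quotient.mkₐ ℂ I).toRingHom with hπ
    have hz : π (e.coeff 0) ^ (y + 1) = 0 := by
      rw [← map_pow]
      exact Ideal.Quotient.eq_zero_iff_mem.2 (hI ▸ Ideal.subset_span rfl)
    -- For r ≤ x only the smallest element y counts and the required order is r - y. In the binomial
    -- expansion of (X · divX + e_0)^r, a term with fewer than r - y factors X contains e_0^{y+1},
    -- which is zero in the quotient.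
    by_cases hr : r ≤ x
    · have h1 : vanOrd (y ::ₘ (x + 1) ::ₘ s) r = r - y := by
        have := vanOrd_eq_zero (s := s) (r := r) fun z hz => hr.trans (hs z hz)
        rw [vanOrd_cons, vanOrd_cons, this]; omega
      rw [h1, ← Polynomial.X_mul_divX_add (e.map π), add_pow]
      refine Finset.dvd_sum fun i hi => ?_
      rw [Finset.mem_range] at hi
      by_cases hi2 : r - y ≤ i
      · rw [mul_pow]
        exact Dvd.dvd.mul_right (Dvd.dvd.mul_right
          (Dvd.dvd.mul_right (pow_dvd_pow _ hi2) _) _) _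
      · obtain ⟨j, hj⟩ : ∃ j, r - i = y + 1 + j := ⟨r - i - (y + 1), by omega⟩
        rw [hj, pow_add, Polynomial.coeff_map, ← Polynomial.C_pow, hz]
        simp
    -- For r > x, moving a unit from y + 1 to x does not change the order, since no truncation
    -- occurs; the old divisibility is simply mapped to the quotient.
    · have h1 : vanOrd (y ::ₘ (x + 1) ::ₘ s) r = vanOrd ((y + 1) ::ₘ x ::ₘ s) r := by
        simp only [vanOrd_cons]; omega
      have h2 := map_dvd (Polynomial.mapRingHom π) (h.dvd r)
      rw [h1]
      simpa using h2

/-- The quotient by the annihilator of the top power of the value of a current at the origin. -/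
lemma IsCurrent.annihilator {R : Type*} [CommRing R] [Algebra ℂ R] {s : Multiset ℕ} {x y : ℕ}
    (hyx : y ≤ x) (hs : ∀ z ∈ s, x ≤ z) {e : R[X]} (h : IsCurrent (y ::ₘ x ::ₘ s) e) :
    IsCurrent ((x - y) ::ₘ s)
      (e.map (Ideal.Quotient.mkₐ ℂ (Ideal.torsionOf R R (e.coeff 0 ^ y))).toRingHom).divX := by
  have h0 := h.pow_coeff_zero
  generalize hI : Ideal.torsionOf R R (e.coeff 0 ^ y) = I
  have hmem : ∀ r : R, e.coeff 0 ^ y * r = 0 → Ideal.Quotient.mk I r = 0 := fun r hr => by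
    rw [Ideal.Quotient.eq_zero_iff_mem, ← hI, Ideal.mem_torsionOf_iff, smul_eq_mul, mul_comm, hr]
  set π := (Ideal.Quotient.mkₐ ℂ I).toRingHom with hπ
  have hdeg : ∀ k, (y ::ₘ x ::ₘ s).card ≤ k → (e.map π).coeff k = 0 := fun k hk => by
    rw [Polynomial.coeff_map, h.degree_lt k hk, map_zero]
  refine isCurrent_divX (s := y ::ₘ x ::ₘ s) (by simp) hdeg
    (adjoin_map_coeff Ideal.Quotient.mk_surjective h.adjoin_eq) ?_ fun k => ?_
  · rw [Polynomial.coeff_map]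
    exact hmem _ (by rw [← pow_succ, h0])
  · have he0 : (e.map π).coeff 0 = 0 := by
      rw [Polynomial.coeff_map]
      exact hmem _ (by rw [← pow_succ, h0])
    -- For k ≤ x - y no element of the new multiset contributes, so only the factor X^k coming from
    -- the vanishing of the current at the origin is needed.
    by_cases hk : k ≤ x - y
    · have : vanOrd ((x - y) ::ₘ s) k = 0 := vanOrd_eq_zero fun z hz => by
        rcases Multiset.mem_cons.1 hz with rfl | hz
        · exact hk
        · have := hs z hz; omega
      rw [this, add_zero]
      exact pow_dvd_pow_of_dvd (Polynomial.X_dvd_iff.2 he0) k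
    · set m := (s.filter (· < k)).card with hm
      set S := (s.filter (· < k)).sum with hS
      -- A linear bound of slope m + 2 ≥ 2: the elements y and x account for the 2, whether or not
      -- they are below q, and the m elements of s below k account for the rest.
      have hlin : ∀ q, Polynomial.X ^ ((m + 2) * q - (x + y + S)) ∣ e ^ q := fun q => by
        refine (pow_dvd_pow _ ?_).trans (h.dvd q)
        have := card_filter_mul_le s k q
        rw [← hm, ← hS] at this
        rw [vanOrd_cons, vanOrd_cons, add_mul]; omega
      have h1 := X_pow_dvd_coeff_zero_pow_mul (by omega) hlin y k
      -- Multiplication by e_0^y gains 2y, which replaces -(x + y) by -(x - y). This is exactly the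
      -- order k + (k - (x - y)) demanded of the product before division by X^k, apart from s.
      have h2 : k + vanOrd ((x - y) ::ₘ s) k ≤ (m + 2) * k + 2 * y - (x + y + S) := by
        have := vanOrd_add_sum_filter s k
        rw [← hm, ← hS] at this
        rw [vanOrd_cons, add_mul]; omega
      have h3 := (pow_dvd_pow _ h2).trans h1
      rw [Polynomial.X_pow_dvd_iff] at h3 ⊢
      intro d hd
      have h4 := h3 d hd
      rw [Polynomial.coeff_C_mul] at h4
      rw [← Polynomial.map_pow, Polynomial.coeff_map]
      exact hmem _ h4

/-- The rank of an ideal `(w)` of a `ℂ`-algebra is that of the quotient by the annihilator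
of `w`. -/
lemma rank_eq_quotient_add_annihilator {R : Type} [CommRing R] [Algebra ℂ R] (w : R) :
    Module.rank ℂ R = Module.rank ℂ (R ⧸ Ideal.span {w}) +
      Module.rank ℂ (R ⧸ Ideal.torsionOf R R w) := by
  rw [← Submodule.rank_quotient_add_rank ((Ideal.span {w}).restrictScalars ℂ)]
  congr 1
  exact (((Ideal.quotTorsionOfEquivSpanSingleton R R w).restrictScalars ℂ).rank_eq).symm

lemma IsCurrent.rank_le_of_singleton {R : Type} [CommRing R] [Algebra ℂ R] {y : ℕ} {e : R[X]}
    (h : IsCurrent {y} e) : Module.rank ℂ R ≤ ((y + 1 : ℕ) : Cardinal) := by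
  have h0 : e.coeff 0 ^ (y + 1) = 0 := IsCurrent.pow_coeff_zero (s := 0) h
  classical
  have h1 : Algebra.adjoin ℂ {e.coeff 0} = ⊤ := by
    rw [eq_top_iff, ← h.adjoin_eq]
    refine Algebra.adjoin_le ?_
    rintro _ ⟨k, rfl⟩
    rcases k with _ | k
    · exact Algebra.subset_adjoin rfl
    · have hk : e.coeff (k + 1) = 0 := h.degree_lt _ (by simp)
      rw [SetLike.mem_coe, hk]; exact zero_mem _
  have h2 : Submodule.span ℂ
      (((Finset.range (y + 1)).image (e.coeff 0 ^ ·) : Finset R) : Set R) = ⊤ := by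
    rw [eq_top_iff]
    intro r _
    have hr : r ∈ Algebra.adjoin ℂ {e.coeff 0} := h1 ▸ Algebra.mem_top
    rw [Algebra.adjoin_singleton_eq_range_aeval] at hr
    obtain ⟨p, rfl⟩ := hr
    change Polynomial.aeval (e.coeff 0) p ∈ _
    rw [Polynomial.aeval_eq_sum_range]
    refine Submodule.sum_mem _ fun i _ => Submodule.smul_mem _ _ ?_
    by_cases hi : i < y + 1
    · exact Submodule.subset_span (by simpa using ⟨i, by omega, rfl⟩)
    · obtain ⟨j, rfl⟩ := Nat.exists_eq_add_of_le (Nat.le_of_not_lt hi)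
      rw [pow_add, h0, zero_mul]; exact zero_mem _
  rw [← rank_top, ← h2]
  refine (rank_span_finset_le _).trans ?_
  rw [Nat.cast_le]
  exact Finset.card_image_le.trans (by simp)

/-- An algebra generated by a current of type `s` has dimension at most `∏ (x + 1)`, `x ∈ s`. -/
theorem IsCurrent.rank_le (N : ℕ) : ∀ (s : Multiset ℕ), s.card = N →
    ∀ (R : Type) [CommRing R] [Algebra ℂ R] (e : R[X]), IsCurrent s e →
      Module.rank ℂ R ≤ ((s.map (· + 1)).prod : ℕ) := by
  induction N with
  | zero =>
    intro s hs R _ _ e h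
    rw [Multiset.card_eq_zero] at hs
    subst hs
    have h1 : (⊤ : Subalgebra ℂ R) = ⊥ := by
      rw [← h.adjoin_eq, eq_bot_iff]
      refine Algebra.adjoin_le ?_
      rintro _ ⟨k, rfl⟩
      rw [h.degree_lt k (by simp)]; exact zero_mem _
    have h2 : Function.Surjective (Algebra.linearMap ℂ R) := fun r => by
      have : r ∈ (⊥ : Subalgebra ℂ R) := h1 ▸ Algebra.mem_top
      exact Algebra.mem_bot.1 this
    simpa using LinearMap.rank_le_of_surjective _ h2
  | succ N ih =>
    intro s hs
    obtain ⟨y, t, rfl, ht⟩ := exists_min_cons (s := s) (by rintro rfl; simp at hs)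
    rw [Multiset.card_cons, Nat.add_right_cancel_iff] at hs
    -- Inner induction on the smallest element y. The rest t must vary, because the quotient step
    -- raises the second smallest element by one.
    induction y generalizing t with
    | zero =>
      -- Here the current vanishes at the origin, so dividing it by X removes the element 0 from the
      -- multiset.
      intro R _ _ e h
      have := ih t hs R e.divX (isCurrent_divX (s := 0 ::ₘ t) (by simp) h.degree_lt h.adjoin_eq
        (by simpa using h.pow_coeff_zero) fun r => by simpa using h.dvd r)
      simpa using this
    | succ y ihy =>
      intro R _ _ e h
      rcases eq_or_ne t 0 with rfl | h0
      · simpa using h.rank_le_of_singleton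
      obtain ⟨x, t, rfl, htx⟩ := exists_min_cons h0
      have hyx : y + 1 ≤ x := ht x (Multiset.mem_cons_self x t)
      -- The quotient keeps the number of elements and lowers the smallest one, while the
      -- annihilator quotient has one element fewer; the two induction hypotheses apply to them
      -- respectively.
      rw [rank_eq_quotient_add_annihilator (e.coeff 0 ^ (y + 1))]
      have h1 := ihy ((x + 1) ::ₘ t) (fun z hz => by
        have := ht z
        rcases Multiset.mem_cons.1 hz with rfl | hz
        · omega
        · have := ht z (Multiset.mem_cons_of_mem hz); omega) (by simpa using hs) _ _
          (h.quotient hyx htx)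
      have h2 := ih ((x - (y + 1)) ::ₘ t) (by simpa using hs) _ _ (h.annihilator hyx htx)
      refine (add_le_add h1 h2).trans ?_
      rw [← Nat.cast_add, Nat.cast_le]
      -- The remaining identity is (y + 2)(x + 1) = (y + 1)(x + 2) + (x - y), the dimension count of
      -- the Clebsch–Gordan splitting.
      obtain ⟨k, rfl⟩ := Nat.exists_eq_add_of_le hyx
      simp only [Multiset.map_cons, Multiset.prod_cons, ← mul_assoc, ← add_mul]
      refine Nat.mul_le_mul_right _ (le_of_eq ?_)
      rw [Nat.add_sub_cancel_left]; ring

/-! ### Truncated polynomials in the operators `e^{(i)}` -/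

section box

variable {n : ℕ} {K : Type*} [CommRing K]

/-- The exponents of a basis vector `v_{m_1} ⊗ ⋯ ⊗ v_{m_n}`. -/
noncomputable def idxExp {a : Fin n → ℕ} (m : Idx a) : Fin n →₀ ℕ :=
  Finsupp.equivFunOnFinite.symm fun i => (m i : ℕ)

@[simp] lemma idxExp_apply {a : Fin n → ℕ} (m : Idx a) (i : Fin n) : idxExp m i = m i := rfl

lemma idxExp_injective {a : Fin n → ℕ} : Function.Injective (idxExp (a := a)) := fun m m' h => by
  ext i
  exact DFunLike.congr_fun h i

/-- The application of a polynomial in `e^{(1)}, …, e^{(n)}` to the tensor product of the highest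
vectors, in coordinates. -/
noncomputable def box (a : Fin n → ℕ) : MvPolynomial (Fin n) K →ₗ[K] (Idx a → K) where
  toFun p m := p.coeff (idxExp m)
  map_add' p q := by ext m; simp
  map_smul' c p := by ext m; simp

@[simp] lemma box_apply (a : Fin n → ℕ) (p : MvPolynomial (Fin n) K) (m : Idx a) :
    box a p m = p.coeff (idxExp m) := rfl

lemma box_monomial (a : Fin n → ℕ) (m : Idx a) (c : K) :
    box a (MvPolynomial.monomial (idxExp m) c) = Pi.single m c := by
  classical
  ext m'
  simp [MvPolynomial.coeff_monomial, Pi.single_apply, idxExp_injective.eq_iff, eq_comm]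

lemma box_surjective (a : Fin n → ℕ) : Function.Surjective (box (K := K) a) := fun f => by
  classical
  refine ⟨∑ m, MvPolynomial.monomial (idxExp m) (f m), ?_⟩
  rw [map_sum]
  simp only [box_monomial]
  exact Finset.univ_sum_single f

/-- The ideal is monomial, so membership is tested on the support: every exponent must leave the
box. Hence `box` presents the tensor product as a cyclic module over the polynomials in the y_i,
over any base ring. -/
lemma box_eq_zero_iff {a : Fin n → ℕ} {p : MvPolynomial (Fin n) K} :
    box a p = 0 ↔
      p ∈ Ideal.span (Set.range fun i => (MvPolynomial.X i : MvPolynomial (Fin n) K) ^ a i) := by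
  have h : (Set.range fun i => (MvPolynomial.X i : MvPolynomial (Fin n) K) ^ a i) =
      (fun s => MvPolynomial.monomial s (1 : K)) ''
        Set.range fun i => Finsupp.single i (a i) := by
    rw [← Set.range_comp]
    congr 1
    ext1 i
    simp [MvPolynomial.X_pow_eq_monomial]
  rw [h, MvPolynomial.mem_ideal_span_monomial_image]
  simp only [Set.exists_range_iff, Finsupp.single_le_iff]
  constructor
  · intro hp μ hμ
    by_contra! hcon
    have h1 := congrFun hp fun i => ⟨μ i, hcon i⟩
    have h2 : idxExp (a := a) (fun i => ⟨μ i, hcon i⟩) = μ := by ext i; rfl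
    rw [box_apply, h2] at h1
    exact MvPolynomial.mem_support_iff.1 hμ h1
  · intro hp
    ext m
    by_contra hm
    obtain ⟨i, hi⟩ := hp _ (MvPolynomial.mem_support_iff.2 hm)
    exact absurd (m i).2 (not_lt.2 hi)

lemma box_mul_eq_zero {a : Fin n → ℕ} {p : MvPolynomial (Fin n) K} (q : MvPolynomial (Fin n) K)
    (hp : box a p = 0) : box a (q * p) = 0 := by
  rw [box_eq_zero_iff] at hp ⊢
  exact Ideal.mul_mem_left _ _ hp

lemma box_X_mul (a : Fin n → ℕ) (i : Fin n) (p : MvPolynomial (Fin n) K) (m : Idx a) :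
    box a (MvPolynomial.X i * p) m = ∑ q : Fin (a i),
      if (m i : ℕ) = q + 1 then box a p (Function.update m i q) else 0 := by
  classical
  rw [box_apply, MvPolynomial.coeff_X_mul']
  rcases Nat.eq_zero_or_pos (m i : ℕ) with h0 | h0
  · rw [if_neg (by simp [h0]), Finset.sum_eq_zero]
    intro q _
    rw [if_neg (by omega)]
  · have hlt := (m i).2
    rw [if_pos (by simp; omega), Finset.sum_eq_single (⟨m i - 1, by omega⟩ : Fin (a i))]
    · rw [if_pos (by simp only; omega), box_apply]
      congr 1
      ext l
      by_cases hl : l = i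
      · subst hl; simp
      · simp [hl]
    · intro q _ hq
      rw [if_neg]
      intro h
      apply hq
      ext
      simp only
      omega
    · simp

lemma box_X_mul_eq_actOn (a : Fin n → ℕ) (i : Fin n)
    (p : MvPolynomial (Fin n) (MvPolynomial (Fin n) ℂ)) :
    box a (MvPolynomial.X i * p) = actOn i (matE (a i)) (box a p) := by
  ext1 m
  rw [box_X_mul]
  change _ = ∑ q : Fin (a i), MvPolynomial.C (matE (a i) (m i) q) * _
  refine Finset.sum_congr rfl fun q _ => ?_
  simp only [matE, Matrix.of_apply]
  split_ifs <;> simp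

/-! ### Interpolation: which combinations of the y_i are polynomials in the e_k. -/

/-- The homomorphism `e_k ↦ ∑_i ζ_i^k y_i`. -/
noncomputable def currentHom (ζ : Fin n → K) :
    MvPolynomial (Fin n) K →ₐ[K] MvPolynomial (Fin n) K :=
  MvPolynomial.aeval fun k : Fin n =>
    ∑ i : Fin n, MvPolynomial.C (ζ i ^ (k : ℕ)) * MvPolynomial.X i

@[simp] lemma currentHom_X (ζ : Fin n → K) (k : Fin n) :
    currentHom ζ (MvPolynomial.X k) =
      ∑ i : Fin n, MvPolynomial.C (ζ i ^ (k : ℕ)) * MvPolynomial.X i := by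
  simp [currentHom]

/-- The combination ∑ p_k e_k has p(ζ_i) as coefficient of y_i. Finding elements of the range thus
becomes the choice of an interpolating polynomial of degree below n. -/
lemma mem_range_currentHom (ζ : Fin n → K) {p : K[X]} (hp : p.natDegree < n) :
    ∑ i : Fin n, MvPolynomial.C (p.eval (ζ i)) * MvPolynomial.X i ∈ (currentHom ζ).range := by
  refine ⟨∑ k : Fin n, MvPolynomial.C (p.coeff k) * MvPolynomial.X k, ?_⟩
  change currentHom ζ _ = _
  simp only [map_sum, map_mul, currentHom_X, ← MvPolynomial.algebraMap_eq, AlgHom.commutes,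
    Finset.mul_sum]
  rw [Finset.sum_comm]
  refine Finset.sum_congr rfl fun i _ => ?_
  rw [Polynomial.eval_eq_sum_range' hp, ← Fin.sum_univ_eq_sum_range
    (fun k => p.coeff k * ζ i ^ k), map_sum, Finset.sum_mul]
  refine Finset.sum_congr rfl fun k _ => ?_
  rw [map_mul, mul_assoc]

/-- The polynomial vanishing at all `ζ_l` with `l ∈ s`. -/
noncomputable def nodal (ζ : Fin n → K) (s : Finset (Fin n)) : K[X] :=
  ∏ l ∈ s, (Polynomial.X - Polynomial.C (ζ l))

lemma eval_nodal (ζ : Fin n → K) (s : Finset (Fin n)) (c : K) :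
    (nodal ζ s).eval c = ∏ l ∈ s, (c - ζ l) := by
  simp [nodal, Polynomial.eval_prod]

lemma eval_nodal_eq_zero (ζ : Fin n → K) {s : Finset (Fin n)} {l : Fin n} (hl : l ∈ s) :
    (nodal ζ s).eval (ζ l) = 0 := by
  rw [eval_nodal]
  exact Finset.prod_eq_zero hl (sub_self _)

lemma natDegree_nodal_le (ζ : Fin n → K) (s : Finset (Fin n)) :
    (nodal ζ s).natDegree ≤ s.card := by
  refine (Polynomial.natDegree_prod_le _ _).trans ?_
  rw [Finset.card_eq_sum_ones]
  exact Finset.sum_le_sum fun l _ => Polynomial.natDegree_X_sub_C_le _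

/-- Lagrange interpolation with the denominator kept as a factor, so that it is valid over ℂ[z_1, …,
z_n]. -/
lemma prod_sub_mul_X_mem_range (ζ : Fin n → K) (k : Fin n) :
    MvPolynomial.C (∏ l ∈ Finset.univ.erase k, (ζ k - ζ l)) * MvPolynomial.X k ∈
      (currentHom ζ).range := by
  have hn := k.pos
  have h := mem_range_currentHom ζ (p := nodal ζ (Finset.univ.erase k))
    ((natDegree_nodal_le _ _).trans_lt (by simp; omega))
  rw [Finset.sum_eq_single k] at h
  · rwa [eval_nodal] at h
  · intro l _ hl
    rw [eval_nodal_eq_zero _ (by simpa using hl)]; simp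
  · simp

lemma currentHom_surjective {F : Type*} [Field F] {ζ : Fin n → F} (hζ : Function.Injective ζ) :
    Function.Surjective (currentHom ζ) := by
  rw [← AlgHom.range_eq_top, eq_top_iff, ← MvPolynomial.adjoin_range_X]
  refine Algebra.adjoin_le ?_
  rintro _ ⟨k, rfl⟩
  have h0 : ∏ l ∈ Finset.univ.erase k, (ζ k - ζ l) ≠ 0 := by
    refine Finset.prod_ne_zero_iff.2 fun l hl => sub_ne_zero.2 fun h => ?_
    exact (Finset.ne_of_mem_erase hl) (hζ h).symm
  have h := (currentHom ζ).range.smul_mem (prod_sub_mul_X_mem_range ζ k)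
    (∏ l ∈ Finset.univ.erase k, (ζ k - ζ l))⁻¹
  rwa [MvPolynomial.smul_eq_C_mul, ← mul_assoc, ← map_mul, inv_mul_cancel₀ h0, map_one,
    one_mul] at h

/-- The application of a polynomial in the operators `e_k = ∑_i ζ_i^k e^{(i)}` to the tensor
product of the highest vectors. -/
noncomputable def orbit (a : Fin n → ℕ) (ζ : Fin n → K) :
    MvPolynomial (Fin n) K →ₗ[K] (Idx a → K) :=
  box a ∘ₗ (currentHom ζ).toLinearMap

lemma orbit_apply (a : Fin n → ℕ) (ζ : Fin n → K) (p : MvPolynomial (Fin n) K) :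
    orbit a ζ p = box a (currentHom ζ p) := rfl

lemma orbit_mul_eq_zero {a : Fin n → ℕ} {ζ : Fin n → K} {p : MvPolynomial (Fin n) K}
    (q : MvPolynomial (Fin n) K) (hp : orbit a ζ p = 0) : orbit a ζ (q * p) = 0 := by
  rw [orbit_apply] at *
  rw [map_mul]
  exact box_mul_eq_zero _ hp

lemma map_currentHom {L : Type*} [CommRing L] (ρ : K →+* L) (ζ : Fin n → K)
    (p : MvPolynomial (Fin n) K) :
    MvPolynomial.map ρ (currentHom ζ p) = currentHom (ρ ∘ ζ) (MvPolynomial.map ρ p) := by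
  induction p using MvPolynomial.induction_on with
  | C c => simp [currentHom]
  | add p q hp hq => simp [hp, hq]
  | mul_X p k hp => simp [hp]

/-- Base change links the generic orbit over ℂ[z] to its evaluations at points and to its version
over the fraction field. -/
lemma orbit_map {L : Type*} [CommRing L] (ρ : K →+* L) (a : Fin n → ℕ) (ζ : Fin n → K)
    (p : MvPolynomial (Fin n) K) (m : Idx a) :
    orbit a (ρ ∘ ζ) (MvPolynomial.map ρ p) m = ρ (orbit a ζ p m) := by
  rw [orbit_apply, orbit_apply, ← map_currentHom, box_apply, MvPolynomial.coeff_map, box_apply]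

lemma mem_genericIdeal_iff {a : Fin n → ℕ} {Z : Fin n → ℂ} {p : MvPolynomial (Fin n) ℂ} :
    p ∈ genericIdeal a Z ↔ orbit a Z p = 0 := by
  rw [orbit_apply, box_eq_zero_iff, genericIdeal, RingHom.mem_ker, ← Ideal.Quotient.eq_zero_iff_mem]
  rfl

end box

/-! ### Divisibility of the powers of the current -/

section divisibility

-- In the multinomial expansion, only terms with every exponent k_l ≤ a_l - 1 survive. Such a term
-- contains X - z_l with exponent r - k_l, since only the l-th summand lacks this factor.
open Polynomial in
lemma prod_pow_dvd_pow_sum {n : ℕ} {P : Type*} [CommRing P] (a : Fin n → ℕ) (y z : Fin n → P)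
    (hy : ∀ i, y i ^ a i = 0) (r : ℕ) :
    ∏ k, (X - C (z k)) ^ (r - (a k - 1)) ∣ (∑ j, C (y j) * nodal z (Finset.univ.erase j)) ^ r := by
  rw [Finset.sum_pow_eq_sum_piAntidiag]
  refine Finset.dvd_sum fun k hk => Dvd.dvd.mul_left ?_ _
  rw [Finset.mem_piAntidiag] at hk
  by_cases h : ∃ j, a j ≤ k j
  · obtain ⟨j, hj⟩ := h
    have h0 : (C (y j) * nodal z (Finset.univ.erase j)) ^ k j = 0 := by
      rw [mul_pow, ← C_pow, pow_eq_zero_of_le hj (hy j), C_0, zero_mul]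
    rw [Finset.prod_eq_zero (f := fun j => (C (y j) * nodal z (Finset.univ.erase j)) ^ k j)
      (Finset.mem_univ j) h0]
    exact dvd_zero _
  push Not at h
  simp only [mul_pow, Finset.prod_mul_distrib, nodal, ← Finset.prod_pow]
  refine Dvd.dvd.mul_left ?_ _
  have h1 : ∏ j, ∏ l ∈ Finset.univ.erase j, (X - C (z l)) ^ k j =
      ∏ l, ∏ j ∈ Finset.univ.erase l, (X - C (z l)) ^ k j :=
    Finset.prod_comm' (by simp [eq_comm])
  rw [h1]
  refine Finset.prod_dvd_prod_of_dvd _ _ fun l _ => ?_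
  rw [Finset.prod_pow_eq_pow_sum]
  refine pow_dvd_pow _ ?_
  have h2 := Finset.add_sum_erase Finset.univ k (Finset.mem_univ l)
  have h3 := h l
  have h4 : ∑ i, k i = r := hk.1
  omega

lemma coeff_divX_iterate {A : Type*} [CommRing A] (p : A[X]) (k m : ℕ) :
    (Polynomial.divX^[k] p).coeff m = p.coeff (m + k) := by
  induction k generalizing m with
  | zero => simp
  | succ k ihk =>
    rw [Function.iterate_succ_apply', Polynomial.coeff_divX, ihk]
    congr 1; ring

/-- Horner's scheme for division by X - c, stopped after N steps: the `divX` iterates supply the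
quotient, and the error telescopes. -/
lemma sum_pow_mul_divX_iterate {A : Type*} [CommRing A] (p : A[X]) (c : A) (N : ℕ) :
    (∑ k ∈ Finset.range N, Polynomial.C (c ^ k) * (Polynomial.divX^[k + 1] p)) *
        (Polynomial.X - Polynomial.C c) =
      p - Polynomial.C (c ^ N) * (Polynomial.divX^[N] p) -
        Polynomial.C (∑ k ∈ Finset.range N, p.coeff k * c ^ k) := by
  induction N with
  | zero => simp
  | succ N ih =>
    have h1 := Polynomial.X_mul_divX_add (Polynomial.divX^[N] p)
    rw [← Function.iterate_succ_apply' Polynomial.divX, coeff_divX_iterate, zero_add] at h1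
    rw [Finset.sum_range_succ, add_mul, ih, Finset.sum_range_succ]
    simp only [map_add, map_mul, map_pow] at h1 ⊢
    linear_combination Polynomial.C c ^ N * h1

/-- Division by a monic polynomial commutes with ring homomorphisms. The remainder of f by q has its
coefficients in ker θ, hence in ker π. No surjectivity of θ is needed, so a divisibility seen among
the y_i descends to quotients of the algebra of the e_k. -/
lemma map_dvd_map_of_ker_le {S P R : Type*} [CommRing S] [CommRing P] [CommRing R] {θ : S →+* P}
    {π : S →+* R} (hθπ : RingHom.ker θ ≤ RingHom.ker π) {q f : S[X]} (hq : q.Monic)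
    (h : q.map θ ∣ f.map θ) : q.map π ∣ f.map π := by
  have h1 : (f %ₘ q).map θ = 0 := by
    rw [Polynomial.map_modByMonic _ hq]
    exact (Polynomial.modByMonic_eq_zero_iff_dvd (hq.map θ)).2 h
  have h2 : (f %ₘ q).map π = 0 := by
    ext k
    rw [Polynomial.coeff_map, Polynomial.coeff_zero]
    refine hθπ (RingHom.mem_ker.2 ?_)
    rw [← Polynomial.coeff_map, h1, Polynomial.coeff_zero]
  rw [Polynomial.map_modByMonic _ hq] at h2
  exact (Polynomial.modByMonic_eq_zero_iff_dvd (hq.map π)).1 h2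

end divisibility

/-! ### The fiber at the origin -/

section fiberZero

variable {n : ℕ}

/-- The generating polynomial of the operators `e_k` whose image in the algebra of the `y_i` is
`∑_j y_j ∏_{l ≠ j} (X - ζ_l)`. -/
noncomputable def genPoly {A : Type*} [CommRing A] (ζ : Fin n → A) : (MvPolynomial (Fin n) A)[X] :=
  ∑ k : Fin n, Polynomial.C (MvPolynomial.X k) *
    (Polynomial.divX^[(k : ℕ) + 1] (nodal ζ Finset.univ)).map MvPolynomial.C

/-- Horner division of the full nodal polynomial by X - ζ_j. This explains the coefficients of
`genPoly`: weighting the e_k by these quotients turns powers of ζ_j into Lagrange products. -/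
lemma sum_pow_mul_divX_nodal {A : Type*} [CommRing A] (ζ : Fin n → A) (j : Fin n) :
    ∑ k : Fin n, Polynomial.C (ζ j ^ (k : ℕ)) *
        (Polynomial.divX^[(k : ℕ) + 1] (nodal ζ Finset.univ)) =
      nodal ζ (Finset.univ.erase j) := by
  have hmonic : (nodal ζ Finset.univ).Monic :=
    Polynomial.monic_prod_of_monic _ _ fun l _ => Polynomial.monic_X_sub_C _
  rw [Fin.sum_univ_eq_sum_range (fun k => Polynomial.C (ζ j ^ k) *
        (Polynomial.divX^[k + 1] (nodal ζ Finset.univ))) n]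
  have h := sum_pow_mul_divX_iterate (nodal ζ Finset.univ) (ζ j) n
  nontriviality A
  have hdeg : (nodal ζ Finset.univ).natDegree = n := by
    rw [nodal, Polynomial.natDegree_prod_of_monic _ _ fun l _ => Polynomial.monic_X_sub_C _]
    simp
  have hlead : (nodal ζ Finset.univ).coeff n = 1 := by
    have := hmonic.coeff_natDegree
    rwa [hdeg] at this
  have htop : Polynomial.divX^[n] (nodal ζ Finset.univ) = 1 := by
    ext m
    rw [coeff_divX_iterate, Polynomial.coeff_one]
    split_ifs with hm
    · rw [hm, zero_add, hlead]
    · exact Polynomial.coeff_eq_zero_of_natDegree_lt (by omega)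
  have heval := eval_nodal_eq_zero ζ (Finset.mem_univ j)
  rw [Polynomial.eval_eq_sum_range' (Nat.lt_succ_of_le hdeg.le), Finset.sum_range_succ] at heval
  rw [hlead, one_mul] at heval
  -- The last iterate is the leading coefficient 1, so the two error terms add up to the value of
  -- the nodal polynomial at ζ_j, which is zero.
  rw [htop, mul_one, sub_sub, ← map_add, add_comm (ζ j ^ n), heval, map_zero, sub_zero] at h
  refine (Polynomial.monic_X_sub_C (ζ j)).isRegular.right ?_
  change _ * _ = _ * _
  rw [h, nodal, nodal, Finset.prod_erase_mul _ _ (Finset.mem_univ j)]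

lemma genPoly_map_currentHom {A : Type*} [CommRing A] (ζ : Fin n → A) :
    (genPoly ζ).map (currentHom ζ).toRingHom =
      ∑ j, Polynomial.C (MvPolynomial.X j) *
        nodal (fun l => MvPolynomial.C (ζ l)) (Finset.univ.erase j) := by
  have hc : (currentHom ζ).toRingHom.comp MvPolynomial.C = MvPolynomial.C := by
    ext1 c
    exact (currentHom ζ).commutes c
  have h1 : ∀ j, nodal (fun l => (MvPolynomial.C (ζ l) : MvPolynomial (Fin n) A))
      (Finset.univ.erase j) = (nodal ζ (Finset.univ.erase j)).map MvPolynomial.C := fun j => by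
    simp [nodal, Polynomial.map_prod]
  simp only [h1, genPoly, Polynomial.map_sum, Polynomial.map_mul, Polynomial.map_C,
    Polynomial.map_map, hc]
  have h2 : ∀ k : Fin n, (currentHom ζ).toRingHom (MvPolynomial.X k) =
      ∑ j : Fin n, MvPolynomial.C (ζ j ^ (k : ℕ)) * MvPolynomial.X j := currentHom_X ζ
  simp only [h2, map_sum, Finset.sum_mul]
  rw [Finset.sum_comm]
  refine Finset.sum_congr rfl fun j _ => ?_
  rw [← sum_pow_mul_divX_nodal ζ j, Polynomial.map_sum, Finset.mul_sum]
  refine Finset.sum_congr rfl fun k _ => ?_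
  rw [Polynomial.map_mul, Polynomial.map_C, map_mul]
  ring

/-- The powers of the generating polynomial of the `e_k` are divisible by products of powers of
the `X - ζ_k` in every quotient of the algebra generated by the `e_k`. -/
lemma prod_pow_dvd_genPoly {A R : Type*} [CommRing A] [CommRing R] (a : Fin n → ℕ) (ζ : Fin n → A)
    (π : MvPolynomial (Fin n) A →+* R) (hπ : ∀ p, orbit a ζ p = 0 → π p = 0) (r : ℕ) :
    ∏ k, (Polynomial.X - Polynomial.C (π (MvPolynomial.C (ζ k)))) ^ (r - (a k - 1)) ∣
      ((genPoly ζ).map π) ^ r := by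
  set I : Ideal (MvPolynomial (Fin n) A) :=
    Ideal.span (Set.range fun i => (MvPolynomial.X i : MvPolynomial (Fin n) A) ^ a i) with hI
  set θ := (Ideal.Quotient.mk I).comp (currentHom ζ).toRingHom with hθ
  set q : (MvPolynomial (Fin n) A)[X] :=
    ∏ k, (Polynomial.X - Polynomial.C (MvPolynomial.C (ζ k))) ^ (r - (a k - 1)) with hq
  have hqπ : q.map π =
      ∏ k, (Polynomial.X - Polynomial.C (π (MvPolynomial.C (ζ k)))) ^ (r - (a k - 1)) := by
    simp [hq, Polynomial.map_prod]
  have hqθ : q.map θ =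
      ∏ k, (Polynomial.X - Polynomial.C (θ (MvPolynomial.C (ζ k)))) ^ (r - (a k - 1)) := by
    simp only [hq, Polynomial.map_prod, Polynomial.map_pow, Polynomial.map_sub, Polynomial.map_X,
      Polynomial.map_C]
  rw [← hqπ, ← Polynomial.map_pow]
  -- The divisibility is proved modulo the y_i^{a_i}, that is, after θ; its kernel annihilates the
  -- highest vector, hence is killed by π.
  refine map_dvd_map_of_ker_le (θ := θ) ?_
    (Polynomial.monic_prod_of_monic _ _ fun l _ => (Polynomial.monic_X_sub_C _).pow _) ?_
  · intro p hp
    refine RingHom.mem_ker.2 (hπ p ?_)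
    rw [orbit_apply, box_eq_zero_iff, ← Ideal.Quotient.eq_zero_iff_mem]
    exact RingHom.mem_ker.1 hp
  · have h1 := prod_pow_dvd_pow_sum a (fun j => Ideal.Quotient.mk I (MvPolynomial.X j))
      (fun j => Ideal.Quotient.mk I (MvPolynomial.C (ζ j))) (fun i => by
        rw [← map_pow, Ideal.Quotient.eq_zero_iff_mem]
        exact Ideal.subset_span ⟨i, rfl⟩) r
    have h2 : (genPoly ζ).map θ = ∑ j, Polynomial.C (Ideal.Quotient.mk I (MvPolynomial.X j)) *
        nodal (fun j => Ideal.Quotient.mk I (MvPolynomial.C (ζ j))) (Finset.univ.erase j) := by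
      rw [hθ, ← Polynomial.map_map, genPoly_map_currentHom]
      simp [nodal, Polynomial.map_prod, Polynomial.map_sum]
    have h3 : ∀ k, θ (MvPolynomial.C (ζ k)) = Ideal.Quotient.mk I (MvPolynomial.C (ζ k)) :=
      fun k => congrArg (Ideal.Quotient.mk I) ((currentHom ζ).commutes (ζ k))
    rw [hqθ, Polynomial.map_pow, h2]
    simpa only [h3] using h1

/-- The specialization of the coordinates `z_i` at the origin. -/
noncomputable def specZero (n : ℕ) :
    MvPolynomial (Fin n) (MvPolynomial (Fin n) ℂ) →+* MvPolynomial (Fin n) ℂ :=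
  MvPolynomial.map MvPolynomial.constantCoeff

lemma specZero_surjective : Function.Surjective (specZero n) :=
  MvPolynomial.map_surjective _ fun c => ⟨MvPolynomial.C c, by simp⟩

/-- The annihilator of the tensor product of the highest vectors. -/
noncomputable def orbitKer {K : Type*} [CommRing K] (a : Fin n → ℕ) (ζ : Fin n → K) :
    Ideal (MvPolynomial (Fin n) K) where
  carrier := {p | orbit a ζ p = 0}
  add_mem' := fun {p q} hp hq => by
    change orbit a ζ (p + q) = 0
    rw [map_add, show orbit a ζ p = 0 from hp, show orbit a ζ q = 0 from hq, add_zero]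
  zero_mem' := map_zero _
  smul_mem' := fun c p hp => orbit_mul_eq_zero c hp

/-- The annihilator of the class of the highest vector in the fiber at the origin. -/
noncomputable def zeroIdeal (a : Fin n → ℕ) : Ideal (MvPolynomial (Fin n) ℂ) :=
  (orbitKer a (MvPolynomial.X : Fin n → MvPolynomial (Fin n) ℂ)).map (specZero n)

/-- At z = 0 the nodal polynomial becomes X^n, so the generating polynomial becomes ∑ e_k X^{n-1-k}
and all the factors X - z_k become X; their exponents add up to `vanOrd`. -/
lemma isCurrent_fiberZero (a : Fin n → ℕ) :
    IsCurrent (Finset.univ.val.map fun i => a i - 1)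
      ((genPoly (MvPolynomial.X : Fin n → MvPolynomial (Fin n) ℂ)).map
        ((Ideal.Quotient.mk (zeroIdeal a)).comp (specZero n))) := by
  set π := (Ideal.Quotient.mk (zeroIdeal a)).comp (specZero n) with hπ
  have hC : ∀ c, π (MvPolynomial.C c) =
      Ideal.Quotient.mk (zeroIdeal a) (MvPolynomial.C (MvPolynomial.constantCoeff c)) := fun c => by
    simp [hπ, specZero]
  have hX : ∀ k, π (MvPolynomial.X k) = Ideal.Quotient.mk (zeroIdeal a) (MvPolynomial.X k) :=
    fun k => by simp [hπ, specZero]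
  have hcoeff : ∀ m, ((genPoly (MvPolynomial.X : Fin n → MvPolynomial (Fin n) ℂ)).map π).coeff m =
      ∑ k : Fin n, if m + (k + 1) = n then
        Ideal.Quotient.mk (zeroIdeal a) (MvPolynomial.X k) else 0 := by
    intro m
    simp only [genPoly, Polynomial.map_sum, Polynomial.finsetSum_coeff, Polynomial.map_mul,
      Polynomial.map_C, Polynomial.coeff_C_mul, hX, Polynomial.map_map]
    refine Finset.sum_congr rfl fun k _ => ?_
    have h1 : (nodal (MvPolynomial.X : Fin n → MvPolynomial (Fin n) ℂ) Finset.univ).map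
        (π.comp MvPolynomial.C) = Polynomial.X ^ n := by
      simp [nodal, Polynomial.map_prod, hC]
    rw [Polynomial.coeff_map, coeff_divX_iterate, ← Polynomial.coeff_map, h1,
      Polynomial.coeff_X_pow]
    simp
  constructor
  · intro k hk
    rw [hcoeff]
    refine Finset.sum_eq_zero fun l _ => if_neg ?_
    simp at hk
    omega
  · have h1 : Algebra.adjoin ℂ (Set.range fun k : Fin n =>
        Ideal.Quotient.mkₐ ℂ (zeroIdeal a) (MvPolynomial.X k)) = ⊤ := by
      have : (Set.range fun k : Fin n => Ideal.Quotient.mkₐ ℂ (zeroIdeal a) (MvPolynomial.X k)) =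
        (Ideal.Quotient.mkₐ ℂ (zeroIdeal a)) '' Set.range MvPolynomial.X := by
        rw [← Set.range_comp]; rfl
      rw [this, ← AlgHom.map_adjoin, MvPolynomial.adjoin_range_X, Algebra.map_top]
      exact (AlgHom.range_eq_top _).2 Ideal.Quotient.mk_surjective
    rw [eq_top_iff, ← h1]
    refine Algebra.adjoin_mono ?_
    rintro _ ⟨k, rfl⟩
    refine ⟨n - (k + 1), ?_⟩
    rw [hcoeff, Finset.sum_eq_single k]
    · rw [if_pos (by omega)]; rfl
    · intro l _ hl
      rw [if_neg]
      intro h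
      apply hl
      ext
      omega
    · simp
  · intro r
    have h := prod_pow_dvd_genPoly a (MvPolynomial.X : Fin n → MvPolynomial (Fin n) ℂ) π
      (fun p hp => Ideal.Quotient.eq_zero_iff_mem.2 (Ideal.mem_map_of_mem _ hp)) r
    simp only [hC, MvPolynomial.constantCoeff_X, map_zero, sub_zero, Finset.prod_pow_eq_pow_sum]
      at h
    rw [vanOrd, Multiset.map_map]
    exact h

/-- The fiber at the origin is spanned by the classes of at most `∏ a_i` monomials. -/
lemma exists_monomials_fiberZero (a : Fin n → ℕ) (ha : ∀ i, 0 < a i) :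
    ∃ (κ : Type) (_ : Fintype κ) (μ : κ → Fin n →₀ ℕ), Fintype.card κ ≤ ∏ i, a i ∧
      ∀ p : MvPolynomial (Fin n) ℂ, ∃ (c : κ → ℂ) (g : MvPolynomial (Fin n) (MvPolynomial (Fin n) ℂ)),
        orbit a MvPolynomial.X g = 0 ∧
          specZero n g = p - ∑ b, MvPolynomial.monomial (μ b) (c b) := by
  have hrank := IsCurrent.rank_le _ _ rfl _ _ (isCurrent_fiberZero a)
  have hprod : ((Finset.univ.val.map fun i => a i - 1).map (· + 1)).prod = ∏ i, a i := by
    rw [Multiset.map_map]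
    refine Finset.prod_congr rfl fun i _ => ?_
    have := ha i
    simp only [Function.comp_apply]
    omega
  rw [hprod] at hrank
  -- The basis is chosen among the monomials, because the later lifting from the origin relies on
  -- their values being homogeneous.
  obtain ⟨κ, f, -, hspan, hlin⟩ := exists_linearIndependent' ℂ
    (fun μ : Fin n →₀ ℕ => Ideal.Quotient.mk (zeroIdeal a) (MvPolynomial.monomial μ (1 : ℂ)))
  have hcard := hlin.cardinal_le_rank.trans hrank
  have hfin : Finite κ := Cardinal.lt_aleph0_iff_finite.1 (hcard.trans_lt Cardinal.natCast_lt_aleph0)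
  have := Fintype.ofFinite κ
  refine ⟨κ, inferInstance, f, by rwa [Cardinal.mk_fintype, Nat.cast_le] at hcard, fun p => ?_⟩
  have htop : Ideal.Quotient.mkₐ ℂ (zeroIdeal a) p ∈ Submodule.span ℂ (Set.range
      ((fun μ : Fin n →₀ ℕ => Ideal.Quotient.mk (zeroIdeal a) (MvPolynomial.monomial μ (1 : ℂ)))
        ∘ f)) := by
    rw [hspan, MvPolynomial.as_sum p, map_sum]
    refine Submodule.sum_mem _ fun μ _ => ?_
    rw [← mul_one (MvPolynomial.coeff μ p), ← smul_eq_mul, ← MvPolynomial.smul_monomial, map_smul]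
    exact Submodule.smul_mem _ _ (Submodule.subset_span ⟨μ, rfl⟩)
  obtain ⟨c, hc⟩ := (Submodule.mem_span_range_iff_exists_fun ℂ).1 htop
  have hmem : p - ∑ b, MvPolynomial.monomial (f b) (c b) ∈ zeroIdeal a := by
    rw [← Ideal.Quotient.eq_zero_iff_mem, map_sub, sub_eq_zero, map_sum]
    refine (hc.symm.trans (Finset.sum_congr rfl fun b _ => ?_))
    have : MvPolynomial.monomial (f b) (c b) = c b • MvPolynomial.monomial (f b) (1 : ℂ) := by
      rw [MvPolynomial.smul_monomial, smul_eq_mul, mul_one]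
    rw [this]
    exact (map_smul (Ideal.Quotient.mkₐ ℂ (zeroIdeal a)) _ _).symm
  obtain ⟨g, hg, hg2⟩ := (Ideal.mem_map_iff_of_surjective _ specZero_surjective).1 hmem
  exact ⟨c, g, hg, hg2⟩

end fiberZero

/-! ### A basis of the module generated by the highest vector -/

section basis

variable {n : ℕ}

/-- The factor r is the component of q of degree d - w. It is absent for d < w, and for d = w it is
the constant term, which is zero by assumption. -/
lemma exists_homogeneousComponent_mul {σ : Type*} {q : MvPolynomial σ ℂ}
    (hq : MvPolynomial.constantCoeff q = 0) (d w : ℕ) :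
    ∃ r : MvPolynomial σ ℂ, (d ≤ w → r = 0) ∧ ∀ h : MvPolynomial σ ℂ, h.IsHomogeneous w →
      MvPolynomial.homogeneousComponent d (q * h) = r * h := by
  classical
  refine ⟨∑ i ∈ Finset.range (q.totalDegree + 1),
    if i + w = d then MvPolynomial.homogeneousComponent i q else 0, fun hd => ?_, fun h hh => ?_⟩
  · refine Finset.sum_eq_zero fun i _ => ?_
    split_ifs with hi
    · have : i = 0 := by omega
      rw [this, MvPolynomial.homogeneousComponent_zero, ← MvPolynomial.constantCoeff_eq, hq, map_zero]
    · rfl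
  · conv_lhs => rw [← MvPolynomial.sum_homogeneousComponent q]
    rw [Finset.sum_mul, map_sum, Finset.sum_mul]
    refine Finset.sum_congr rfl fun i _ => ?_
    rw [MvPolynomial.homogeneousComponent_of_mem
      ((MvPolynomial.homogeneousComponent_isHomogeneous i q).mul hh)]
    split_ifs with h1 h2 h2
    · rfl
    · exact absurd h1.symm h2
    · exact absurd h2.symm h1
    · rw [zero_mul]

/-- All coefficients of `p` are homogeneous of degree `d`. -/
def CoeffHomogeneous (p : MvPolynomial (Fin n) (MvPolynomial (Fin n) ℂ)) (d : ℕ) : Prop :=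
  ∀ μ, (p.coeff μ).IsHomogeneous d

lemma CoeffHomogeneous.one :
    CoeffHomogeneous (1 : MvPolynomial (Fin n) (MvPolynomial (Fin n) ℂ)) 0 := fun μ => by
  classical
  rw [MvPolynomial.coeff_one]
  split_ifs
  · exact MvPolynomial.isHomogeneous_one _ _
  · exact MvPolynomial.isHomogeneous_zero _ _ _

lemma CoeffHomogeneous.mul {p q : MvPolynomial (Fin n) (MvPolynomial (Fin n) ℂ)} {d d' : ℕ}
    (hp : CoeffHomogeneous p d) (hq : CoeffHomogeneous q d') :
    CoeffHomogeneous (p * q) (d + d') := fun μ => by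
  rw [MvPolynomial.coeff_mul]
  exact MvPolynomial.IsHomogeneous.sum _ _ _ fun x _ => (hp x.1).mul (hq x.2)

lemma CoeffHomogeneous.pow {p : MvPolynomial (Fin n) (MvPolynomial (Fin n) ℂ)} {d : ℕ}
    (hp : CoeffHomogeneous p d) (N : ℕ) : CoeffHomogeneous (p ^ N) (d * N) := by
  induction N with
  | zero => rw [pow_zero]; exact CoeffHomogeneous.one
  | succ N ih => rw [pow_succ]; exact ih.mul hp

lemma CoeffHomogeneous.prod {p : Fin n → MvPolynomial (Fin n) (MvPolynomial (Fin n) ℂ)}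
    {d : Fin n → ℕ} (hp : ∀ k, CoeffHomogeneous (p k) (d k)) (s : Finset (Fin n)) :
    CoeffHomogeneous (∏ k ∈ s, p k) (∑ k ∈ s, d k) := by
  induction s using Finset.cons_induction with
  | empty => exact CoeffHomogeneous.one
  | cons k s hk ih => rw [Finset.prod_cons, Finset.sum_cons]; exact (hp k).mul ih

lemma currentHom_monomial {K : Type*} [CommRing K] (ζ : Fin n → K) (ν : Fin n →₀ ℕ) :
    currentHom ζ (MvPolynomial.monomial ν 1) =
      ∏ k : Fin n, (∑ i : Fin n, MvPolynomial.C (ζ i ^ (k : ℕ)) * MvPolynomial.X i) ^ ν k := by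
  rw [MvPolynomial.monomial_eq, map_one, one_mul, Finsupp.prod_fintype _ _ (fun k => pow_zero _),
    map_prod]
  simp

/-- The weight of a monomial, `e_k` being of weight `k`. -/
def weight (ν : Fin n →₀ ℕ) : ℕ := ∑ k : Fin n, (k : ℕ) * ν k

lemma coeffHomogeneous_currentHom (ν : Fin n →₀ ℕ) :
    CoeffHomogeneous (currentHom MvPolynomial.X (MvPolynomial.monomial ν 1)) (weight ν) := by
  classical
  rw [currentHom_monomial]
  refine CoeffHomogeneous.prod (fun k => CoeffHomogeneous.pow (fun μ => ?_) _) _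
  rw [MvPolynomial.coeff_sum]
  refine MvPolynomial.IsHomogeneous.sum _ _ _ fun i _ => ?_
  rw [MvPolynomial.coeff_C_mul, MvPolynomial.coeff_X]
  split_ifs
  · rw [mul_one]; exact MvPolynomial.isHomogeneous_X_pow i _
  · rw [mul_zero]; exact MvPolynomial.isHomogeneous_zero _ _ _

/-- The value of a monomial in the `e_k` on the highest vector. -/
noncomputable def monOrbit (a : Fin n → ℕ) (ν : Fin n →₀ ℕ) : PolyF a :=
  orbit a MvPolynomial.X (MvPolynomial.monomial ν 1)

lemma isHomogeneous_monOrbit (a : Fin n → ℕ) (ν : Fin n →₀ ℕ) (m : Idx a) :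
    (monOrbit a ν m).IsHomogeneous (weight ν) :=
  coeffHomogeneous_currentHom ν _

/-- The degree of a multi-index. -/
def idxDegree {a : Fin n → ℕ} (m : Idx a) : ℕ := ∑ i, (m i : ℕ)

lemma isHomogeneous_currentHom_monomial {K : Type*} [CommRing K] (ζ : Fin n → K)
    (ν : Fin n →₀ ℕ) : (currentHom ζ (MvPolynomial.monomial ν 1)).IsHomogeneous ν.degree := by
  rw [currentHom_monomial, Finsupp.degree_eq_sum]
  refine MvPolynomial.IsHomogeneous.prod _ _ _ fun k _ => ?_
  have h : (∑ i : Fin n, MvPolynomial.C (ζ i ^ (k : ℕ)) * MvPolynomial.X i :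
      MvPolynomial (Fin n) K).IsHomogeneous 1 :=
    MvPolynomial.IsHomogeneous.sum _ _ _ fun i _ => MvPolynomial.isHomogeneous_C_mul_X _ i
  have h2 := h.pow (ν k)
  rwa [one_mul] at h2

/-- A second grading besides the weight: every e_k raises the total tensor index by one. It controls
total degrees when the ideals are compared. -/
lemma monOrbit_eq_zero {a : Fin n → ℕ} {ν : Fin n →₀ ℕ} {m : Idx a}
    (h : idxDegree m ≠ ν.degree) : monOrbit a ν m = 0 := by
  refine (isHomogeneous_currentHom_monomial _ ν).coeff_eq_zero fun h2 => h ?_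
  rw [← h2, Finsupp.degree_eq_sum]
  rfl

lemma orbit_eq_sum_monOrbit (a : Fin n → ℕ)
    (p : MvPolynomial (Fin n) (MvPolynomial (Fin n) ℂ)) :
    orbit a MvPolynomial.X p = ∑ ν ∈ p.support, p.coeff ν • monOrbit a ν := by
  conv_lhs => rw [MvPolynomial.as_sum p, map_sum]
  refine Finset.sum_congr rfl fun ν _ => ?_
  rw [monOrbit, ← map_smul, MvPolynomial.smul_monomial, smul_eq_mul, mul_one]

/-- A family of monomials spanning the fiber at the origin spans the whole module generated by
the highest vector. -/
lemma orbit_mem_span {a : Fin n → ℕ} {κ : Type} [Fintype κ] {μ : κ → Fin n →₀ ℕ}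
    (hμ : ∀ p : MvPolynomial (Fin n) ℂ, ∃ (c : κ → ℂ)
      (g : MvPolynomial (Fin n) (MvPolynomial (Fin n) ℂ)), orbit a MvPolynomial.X g = 0 ∧
          specZero n g = p - ∑ b, MvPolynomial.monomial (μ b) (c b))
    (p : MvPolynomial (Fin n) (MvPolynomial (Fin n) ℂ)) :
    orbit a MvPolynomial.X p ∈
      Submodule.span (MvPolynomial (Fin n) ℂ) (Set.range fun b => monOrbit a (μ b)) := by
  -- Graded Nakayama lemma: strong induction on the weight, which is the degree in z of the values.
  suffices h : ∀ (d : ℕ) (ν : Fin n →₀ ℕ), weight ν = d → monOrbit a ν ∈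
      Submodule.span (MvPolynomial (Fin n) ℂ) (Set.range fun b => monOrbit a (μ b)) by
    rw [orbit_eq_sum_monOrbit]
    exact Submodule.sum_mem _ fun ν _ => Submodule.smul_mem _ _ (h _ ν rfl)
  intro d
  induction d using Nat.strong_induction_on with
  | _ d ih =>
  intro ν hν
  obtain ⟨c, g, hg0, hg⟩ := hμ (MvPolynomial.monomial ν 1)
  set ζ : MvPolynomial (Fin n) (MvPolynomial (Fin n) ℂ) :=
    MvPolynomial.monomial ν 1 - ∑ b, MvPolynomial.monomial (μ b) (MvPolynomial.C (c b)) - g with hζ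
  have hspec : specZero n ζ = 0 := by
    rw [hζ, map_sub, hg, map_sub, map_sum]
    simp [specZero, MvPolynomial.map_monomial]
  have hconst : ∀ l, MvPolynomial.constantCoeff (ζ.coeff l) = 0 := fun l => by
    have := congrArg (MvPolynomial.coeff l) hspec
    rwa [specZero, MvPolynomial.coeff_map, MvPolynomial.coeff_zero] at this
  have horb : monOrbit a ν = ∑ b, (MvPolynomial.C (c b) : MvPolynomial (Fin n) ℂ) • monOrbit a (μ b) +
      ∑ l ∈ ζ.support, ζ.coeff l • monOrbit a l := by
    rw [← orbit_eq_sum_monOrbit, hζ, map_sub, map_sub, hg0, sub_zero, map_sum]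
    have : ∀ b, orbit a MvPolynomial.X (MvPolynomial.monomial (μ b) (MvPolynomial.C (c b))) =
        MvPolynomial.C (c b) • monOrbit a (μ b) := fun b => by
      rw [monOrbit, ← map_smul, MvPolynomial.smul_monomial, smul_eq_mul, mul_one]
    rw [Finset.sum_congr rfl fun b _ => this b]
    change monOrbit a ν = _ + (monOrbit a ν - _)
    abel
  -- The coefficients of the correction ζ vanish at z = 0, so in its part of degree d only monomials
  -- of weight smaller than d remain.
  have hr : ∀ l, ∃ r : MvPolynomial (Fin n) ℂ, (d ≤ weight l → r = 0) ∧
      ∀ m, MvPolynomial.homogeneousComponent d (ζ.coeff l * monOrbit a l m) =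
        r * monOrbit a l m := fun l => by
    obtain ⟨r, h1, h2⟩ := exists_homogeneousComponent_mul (hconst l) d (weight l)
    exact ⟨r, h1, fun m => h2 _ (isHomogeneous_monOrbit a l m)⟩
  choose r hr0 hr using hr
  have hexp : monOrbit a ν = ∑ b,
      (if weight (μ b) = d then MvPolynomial.C (c b) else 0 : MvPolynomial (Fin n) ℂ) •
      monOrbit a (μ b) + ∑ l ∈ ζ.support, r l • monOrbit a l := by
    ext1 m
    have h1 := congrArg (MvPolynomial.homogeneousComponent d) (congrFun horb m)
    rw [MvPolynomial.homogeneousComponent_of_mem (isHomogeneous_monOrbit a ν m), if_pos hν.symm]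
      at h1
    rw [h1]
    simp only [Pi.add_apply, Finset.sum_apply, Pi.smul_apply, smul_eq_mul, map_add, map_sum, hr,
      MvPolynomial.homogeneousComponent_C_mul]
    congr 1
    refine Finset.sum_congr rfl fun b _ => ?_
    rw [MvPolynomial.homogeneousComponent_of_mem (isHomogeneous_monOrbit a (μ b) m)]
    by_cases hb : weight (μ b) = d
    · rw [if_pos hb, if_pos hb.symm]
    · rw [if_neg hb, if_neg (Ne.symm hb), mul_zero, zero_mul]
  rw [hexp]
  refine add_mem (Submodule.sum_mem _ fun b _ => Submodule.smul_mem _ _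
    (Submodule.subset_span ⟨b, rfl⟩)) (Submodule.sum_mem _ fun l _ => ?_)
  by_cases hl : d ≤ weight l
  · rw [hr0 l hl, zero_smul]; exact zero_mem _
  · exact Submodule.smul_mem _ _ (ih _ (not_le.1 hl) l rfl)

lemma orbit_comp_monomial {L : Type*} [CommRing L] (a : Fin n → ℕ)
    (ρ : MvPolynomial (Fin n) ℂ →+* L) (ν : Fin n →₀ ℕ) :
    orbit a (ρ ∘ MvPolynomial.X) (MvPolynomial.monomial ν 1) = fun m => ρ (monOrbit a ν m) := by
  ext m
  rw [monOrbit, ← orbit_map, MvPolynomial.map_monomial, map_one ρ]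

/-- At the points with distinct coordinates, the module generated by the highest vector is the
whole space. -/
lemma span_specialization {a : Fin n → ℕ} {κ : Type} [Fintype κ] {μ : κ → Fin n →₀ ℕ}
    (hspan : ∀ p, orbit a MvPolynomial.X p ∈
      Submodule.span (MvPolynomial (Fin n) ℂ) (Set.range fun b => monOrbit a (μ b)))
    {F : Type*} [Field F] (ρ : MvPolynomial (Fin n) ℂ →+* F)
    (hρ : Function.Injective (ρ ∘ MvPolynomial.X)) :
    ⊤ ≤ Submodule.span F (Set.range fun b => fun m => ρ (monOrbit a (μ b) m)) := by
  intro f _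
  obtain ⟨p, rfl⟩ := box_surjective a f
  -- Over a field with distinct ζ_i the e_k generate all the y_i, so every vector is the value of a
  -- polynomial in the e_k.
  obtain ⟨p, rfl⟩ := currentHom_surjective hρ p
  rw [← orbit_apply, MvPolynomial.as_sum p, map_sum]
  refine Submodule.sum_mem _ fun ν _ => ?_
  have h1 : MvPolynomial.monomial ν (MvPolynomial.coeff ν p) =
      MvPolynomial.coeff ν p • MvPolynomial.monomial ν 1 := by
    rw [MvPolynomial.smul_monomial, smul_eq_mul, mul_one]
  rw [h1, map_smul, orbit_comp_monomial]
  refine Submodule.smul_mem _ _ ?_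
  obtain ⟨c, hc⟩ := (Submodule.mem_span_range_iff_exists_fun _).1
    (hspan (MvPolynomial.monomial ν 1))
  have h2 : (fun m => ρ (monOrbit a ν m)) =
      ∑ b, ρ (c b) • fun m => ρ (monOrbit a (μ b) m) := by
    ext m
    have := congrFun hc m
    rw [monOrbit, ← this]
    simp
  rw [h2]
  exact Submodule.sum_mem _ fun b _ => Submodule.smul_mem _ _ (Submodule.subset_span ⟨b, rfl⟩)

/-- A family of monomials whose values on the highest vector form a basis of the module it
generates, and specialize to a basis at every point with distinct coordinates. -/
structure IsOrbitBasis (a : Fin n → ℕ) {κ : Type} [Fintype κ] (μ : κ → Fin n →₀ ℕ) : Prop where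
  card_eq : Fintype.card κ = ∏ i, a i
  span : ∀ p, orbit a MvPolynomial.X p ∈
    Submodule.span (MvPolynomial (Fin n) ℂ) (Set.range fun b => monOrbit a (μ b))
  linearIndependent : LinearIndependent (MvPolynomial (Fin n) ℂ) fun b => monOrbit a (μ b)
  linearIndependent_eval : ∀ Z ∈ distinctPoints n,
    LinearIndependent ℂ fun b => fun m => MvPolynomial.eval Z (monOrbit a (μ b) m)

/-- At most ∏ a_i vectors that span a space of dimension ∏ a_i form a basis. This is applied over ℂ
at each point with distinct coordinates, and over the fraction field, where it gives the exact
cardinality and independence over ℂ[z]. -/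
lemma exists_isOrbitBasis (a : Fin n → ℕ) (ha : ∀ i, 0 < a i) :
    ∃ (κ : Type) (_ : Fintype κ) (μ : κ → Fin n →₀ ℕ), IsOrbitBasis a μ := by
  obtain ⟨κ, _, μ, hcard, hμ⟩ := exists_monomials_fiberZero a ha
  have hspan := orbit_mem_span hμ
  have hli : ∀ {F : Type} [Field F] (ρ : MvPolynomial (Fin n) ℂ →+* F),
      Function.Injective (ρ ∘ MvPolynomial.X) →
      LinearIndependent F fun b => fun m => ρ (monOrbit a (μ b) m) := by
    intro F _ ρ hρ
    refine linearIndependent_of_top_le_span_of_card_le_finrank (span_specialization hspan ρ hρ) ?_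
    simpa using hcard
  set ρ := algebraMap (MvPolynomial (Fin n) ℂ) (FractionRing (MvPolynomial (Fin n) ℂ)) with hρ
  have hρinj : Function.Injective ρ := IsFractionRing.injective _ _
  have hX : Function.Injective (ρ ∘ MvPolynomial.X) := hρinj.comp MvPolynomial.X_injective
  refine ⟨κ, inferInstance, μ, ⟨le_antisymm hcard ?_, hspan, ?_, fun Z hZ => ?_⟩⟩
  · have h1 := finrank_le_of_span_eq_top (top_le_iff.1 (span_specialization hspan ρ hX))
    simpa using h1
  · have h1 := Fintype.linearIndependent_iff.1 (hli ρ hX)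
    refine Fintype.linearIndependent_iff.2 fun g hg b => hρinj ?_
    rw [map_zero]
    refine h1 (fun b => ρ (g b)) ?_ b
    ext m
    have := congrArg ρ (congrFun hg m)
    simpa using this
  · refine hli (MvPolynomial.eval Z) ?_
    have : (MvPolynomial.eval Z ∘ MvPolynomial.X : Fin n → ℂ) = Z := by ext; simp
    rw [this]; exact hZ

end basis

/-! ### The module generated by the highest vector is contained in `F^c` -/

section orbitLe

variable {n : ℕ}

lemma currentE_orbit (a : Fin n → ℕ) (k : Fin n)
    (p : MvPolynomial (Fin n) (MvPolynomial (Fin n) ℂ)) :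
    currentE a k (orbit a MvPolynomial.X p) =
      orbit a MvPolynomial.X (MvPolynomial.X k * p) := by
  rw [orbit_apply, orbit_apply, map_mul, currentHom_X, Finset.sum_mul, map_sum, currentE,
    LinearMap.sum_apply]
  refine Finset.sum_congr rfl fun i _ => ?_
  rw [LinearMap.smul_apply, ← box_X_mul_eq_actOn, ← map_smul, MvPolynomial.smul_eq_C_mul,
    mul_assoc]

lemma orbit_one (a : Fin n → ℕ) : orbit a MvPolynomial.X 1 = highest a := by
  classical
  ext1 m
  rw [orbit_apply, map_one, box_apply, MvPolynomial.coeff_one, highest]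
  refine if_congr ?_ rfl rfl
  rw [eq_comm, DFunLike.ext_iff]
  simp

lemma orbit_mem_Fc (a : Fin n → ℕ) (p : MvPolynomial (Fin n) (MvPolynomial (Fin n) ℂ)) :
    orbit a MvPolynomial.X p ∈ Fc a := by
  induction p using MvPolynomial.induction_on with
  | C c =>
    rw [← mul_one (MvPolynomial.C c), ← MvPolynomial.smul_eq_C_mul, map_smul, orbit_one]
    exact (Fc a).smul_mem c (highest_mem_Fc a)
  | add p q hp hq => rw [map_add]; exact add_mem hp hq
  | mul_X p k hp => rw [mul_comm, ← currentE_orbit]; exact currentE_mem _ hp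

end orbitLe

/-! ### The condition at one diagonal -/

section diagonal

variable {n : ℕ}

/-- A functional vanishing on V turns G into a polynomial that is zero at all points, hence zero, so
it also kills each coefficient vector; such functionals separate V from its complement. -/
lemma coeff_mem_of_forall_eval_mem {ι σ : Type*} [Fintype ι] (V : Submodule ℂ (ι → ℂ))
    (G : ι → MvPolynomial σ ℂ) (h : ∀ x : σ → ℂ, (fun p => MvPolynomial.eval x (G p)) ∈ V)
    (α : σ →₀ ℕ) : (fun p => MvPolynomial.coeff α (G p)) ∈ V := by
  classical
  by_contra hα
  obtain ⟨f, hf, hV⟩ := Submodule.exists_le_ker_of_notMem hα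
  have hsum : ∀ v : ι → ℂ, f v = ∑ p, f (Pi.single p 1) * v p := fun v => by
    conv_lhs => rw [← Finset.univ_sum_single v, map_sum]
    refine Finset.sum_congr rfl fun p _ => ?_
    have : (Pi.single p (v p) : ι → ℂ) = v p • Pi.single p 1 := by
      rw [← Pi.single_smul]; simp
    rw [this, map_smul, smul_eq_mul, mul_comm]
  have hzero : ∑ p, MvPolynomial.C (f (Pi.single p 1)) * G p = 0 := by
    refine MvPolynomial.funext fun x => ?_
    have := LinearMap.mem_ker.1 (hV (h x))
    rw [hsum] at this
    simpa using this
  apply hf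
  rw [hsum]
  have := congrArg (MvPolynomial.coeff α) hzero
  simpa [MvPolynomial.coeff_sum] using this

/-- The tensor `v ⊗ v_m`, where `v` is put at the places `i, j` and `v_m` is the basis vector
of the product of the other factors. -/
noncomputable def insertPair {a : Fin n → ℕ} (i j : Fin n) (m : Idx a) :
    (Fin (a i) × Fin (a j) → ℂ) →ₗ[ℂ] PolyF a where
  toFun v m' := MvPolynomial.C (if ∀ l, l ≠ i → l ≠ j → m' l = m l then v (m' i, m' j) else 0)
  map_add' v w := by ext1 m'; simp only [Pi.add_apply, ← map_add]; split_ifs <;> simp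
  map_smul' c v := by
    ext1 m'
    simp only [Pi.smul_apply, RingHom.id_apply, MvPolynomial.smul_eq_C_mul, ← map_mul]
    split_ifs <;> simp

lemma insertPair_apply {a : Fin n → ℕ} (i j : Fin n) (m : Idx a) (v : Fin (a i) × Fin (a j) → ℂ)
    (m' : Idx a) : insertPair i j m v m' =
      MvPolynomial.C (if ∀ l, l ≠ i → l ≠ j → m' l = m l then v (m' i, m' j) else 0) := rfl

lemma insertPair_single {a : Fin n → ℕ} {i j : Fin n} (hij : i ≠ j) (m : Idx a) (p : Fin (a i))
    (q : Fin (a j)) : insertPair i j m (Pi.single (p, q) 1) =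
      Pi.single (Function.update (Function.update m i p) j q) 1 := by
  classical
  ext1 m'
  rw [insertPair_apply, Pi.single_apply, Pi.single_apply]
  by_cases h : m' = Function.update (Function.update m i p) j q
  · rw [if_pos h, h, if_pos, if_pos, map_one]
    · simp [hij]
    · intro l hi hj
      simp [hi, hj]
  · rw [if_neg h]
    split_ifs with h1 h2
    · exfalso
      apply h
      rw [Prod.mk.injEq] at h2
      ext l
      by_cases hj : l = j
      · subst hj; simp [h2.2]
      · by_cases hi : l = i
        · subst hi; simp [hj, h2.1]
        · simp [hi, hj, h1 l hi hj]
    · simp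
    · simp

/-- The entries of m at i and j do not affect the slice; fixing them by m₀ makes each slice count
once. -/
lemma sum_insertPair_slice {a : Fin n → ℕ} {i j : Fin n} (hij : i ≠ j) (m₀ : Idx a)
    (w : Idx a → ℂ) :
    ∑ m ∈ Finset.univ.filter (fun m : Idx a => m i = m₀ i ∧ m j = m₀ j),
      insertPair i j m (slice i j m w) = fun m => MvPolynomial.C (w m) := by
  classical
  ext1 m'
  rw [Finset.sum_apply, Finset.sum_eq_single
    (Function.update (Function.update m' i (m₀ i)) j (m₀ j))]
  · rw [insertPair_apply, if_pos, slice]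
    · simp only
      congr 2
      ext l
      by_cases hj : l = j
      · subst hj; simp
      · by_cases hi : l = i
        · subst hi; simp [hj]
        · simp [hi, hj]
    · intro l hi hj
      simp [hi, hj]
  · intro m hm hne
    rw [insertPair_apply, if_neg, map_zero]
    intro h
    apply hne
    rw [Finset.mem_filter] at hm
    ext l
    by_cases hj : l = j
    · subst hj; simp [hm.2.2]
    · by_cases hi : l = i
      · subst hi; simp [hj, hm.2.1]
      · simp [hi, hj, h l hi hj]
  · intro h
    exfalso
    apply h
    simp [hij]

lemma actOn_insertPair {a : Fin n → ℕ} {i j : Fin n} (hij : i ≠ j) (m : Idx a)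
    (v : Fin (a i) × Fin (a j) → ℂ) :
    actOn i (matE (a i)) (insertPair i j m v) + actOn j (matE (a j)) (insertPair i j m v) =
      insertPair i j m ((tens (matE (a i)) (matE (a j))).mulVecLin v) := by
  classical
  ext1 m'
  change ∑ p : Fin (a i), MvPolynomial.C (matE (a i) (m' i) p) *
      insertPair i j m v (Function.update m' i p) +
    ∑ p : Fin (a j), MvPolynomial.C (matE (a j) (m' j) p) *
      insertPair i j m v (Function.update m' j p) = _
  simp only [insertPair_apply, ← map_mul, ← map_sum, ← map_add]
  have h1 : ∀ p : Fin (a i), (∀ l, l ≠ i → l ≠ j → Function.update m' i p l = m l) ↔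
      ∀ l, l ≠ i → l ≠ j → m' l = m l := fun p =>
    forall_congr' fun l => forall_congr' fun hi => by rw [Function.update_of_ne hi]
  have h2 : ∀ p : Fin (a j), (∀ l, l ≠ i → l ≠ j → Function.update m' j p l = m l) ↔
      ∀ l, l ≠ i → l ≠ j → m' l = m l := fun p =>
    forall_congr' fun l => forall_congr' fun _ => forall_congr' fun hj => by
      rw [Function.update_of_ne hj]
  simp only [h1, h2, Function.update_self, Function.update_of_ne hij, Function.update_of_ne hij.symm]
  congr 1
  split_ifs
  · simp only [tens, Matrix.mulVecLin_apply, Matrix.mulVec, dotProduct, Matrix.add_apply, add_mul,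
      Finset.sum_add_distrib, Matrix.kroneckerMap_apply]
    congr 1
    · rw [Fintype.sum_prod_type]
      refine Finset.sum_congr rfl fun p _ => ?_
      rw [Finset.sum_eq_single (m' j)]
      · simp
      · intro q _ hq
        rw [Matrix.one_apply_ne hq.symm]; simp
      · simp
    · rw [Fintype.sum_prod_type_right]
      refine Finset.sum_congr rfl fun p _ => ?_
      rw [Finset.sum_eq_single (m' i)]
      · simp
      · intro q _ hq
        rw [Matrix.one_apply_ne hq.symm]; simp
      · simp
  · simp

/-- The image of a vector of weight `k` under a homomorphism of `sl₂`-modules. -/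
lemma sl2Hom_highest_apply {a b k : ℕ} {Φ : Matrix (Fin a × Fin b) (Fin (a + b - 1 - 2 * k)) ℂ}
    (hΦ : IsSl2Hom a b _ Φ) (h0 : 0 < a + b - 1 - 2 * k) (p : Fin a × Fin b)
    (hp : (p.1 : ℕ) + p.2 ≠ k) : Φ.mulVec (Pi.single ⟨0, h0⟩ 1) p = 0 := by
  have h1 : (tens (matH a) (matH b)).mulVec (Φ.mulVec (Pi.single ⟨0, h0⟩ 1)) =
      -(((a + b - 1 - 2 * k : ℕ) : ℂ) - 1) • Φ.mulVec (Pi.single ⟨0, h0⟩ 1) := by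
    rw [Matrix.mulVec_mulVec, ← hΦ.map_h, ← Matrix.mulVec_mulVec, ← Matrix.mulVec_smul]
    congr 1
    ext q
    rw [matH, Matrix.mulVec_diagonal]
    by_cases hq : q = ⟨0, h0⟩
    · subst hq; simp
    · simp [hq]
  have h2 := congrFun h1 p
  rw [tens_h_mulVec, Pi.smul_apply, smul_eq_mul] at h2
  rcases mul_eq_mul_right_iff.1 h2 with h3 | h3
  · exfalso
    apply hp
    obtain ⟨d, hd⟩ : ∃ d, a + b = d + 2 + 2 * k := ⟨a + b - 2 - 2 * k, by omega⟩
    have h4 : a + b - 1 - 2 * k = d + 1 := by omega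
    have h5 : (a : ℂ) + b = d + 2 + 2 * k := by exact_mod_cast hd
    rw [h4] at h3
    have h6 : (2 : ℂ) * (((p.1 : ℕ) + (p.2 : ℕ) : ℕ) : ℂ) = 2 * (k : ℂ) := by
      push_cast at h3 ⊢
      linear_combination h3 + h5
    exact_mod_cast mul_left_cancel₀ two_ne_zero h6
  · exact h3

/-- The highest vector of a component ℂ^{a_i+a_j-1-2k'} with k' ≤ k is, by its weight, a combination
of the v_p ⊗ v_q with p + q = k'. The factor (z_i - z_j)^k therefore supplies one z_i - z_j for each
y_i and y_j needed to reach it. The rest of the component is obtained with y_i + y_j, which needs no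
denominator. -/
lemma insertPair_mem {a : Fin n → ℕ} {i j : Fin n} (hij : i ≠ j)
    {𝒯 : Subalgebra (MvPolynomial (Fin n) ℂ) (MvPolynomial (Fin n) (MvPolynomial (Fin n) ℂ))}
    (h1 : MvPolynomial.X i + MvPolynomial.X j ∈ 𝒯)
    (h2 : (MvPolynomial.X i - MvPolynomial.X j : MvPolynomial (Fin n) ℂ) •
      (MvPolynomial.X i : MvPolynomial (Fin n) (MvPolynomial (Fin n) ℂ)) ∈ 𝒯)
    (h3 : ∀ l, l ≠ i → l ≠ j → MvPolynomial.X l ∈ 𝒯) (m : Idx a) {k : ℕ}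
    {v : Fin (a i) × Fin (a j) → ℂ} (hv : v ∈ cgFiltration (a i) (a j) k) :
    (MvPolynomial.X i - MvPolynomial.X j : MvPolynomial (Fin n) ℂ) ^ k • insertPair i j m v ∈
      (Subalgebra.toSubmodule 𝒯).map (box a) := by
  classical
  set s : MvPolynomial (Fin n) ℂ := MvPolynomial.X i - MvPolynomial.X j with hs
  set N := (Subalgebra.toSubmodule 𝒯).map (box a) with hN
  have h2' : s • (MvPolynomial.X j : MvPolynomial (Fin n) (MvPolynomial (Fin n) ℂ)) ∈ 𝒯 := by
    have := sub_mem (𝒯.smul_mem h1 s) h2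
    rwa [smul_add, add_sub_cancel_left] at this
  set Q : Submodule ℂ (Fin (a i) × Fin (a j) → ℂ) :=
    (N.restrictScalars ℂ).comap ((LinearMap.lsmul (MvPolynomial (Fin n) ℂ) (PolyF a)
      (s ^ k)).restrictScalars ℂ ∘ₗ insertPair i j m) with hQ
  have hQmem : ∀ w, w ∈ Q ↔ s ^ k • insertPair i j m w ∈ N := fun w => Iff.rfl
  have hE : ∀ w ∈ Q, (tens (matE (a i)) (matE (a j))).mulVecLin w ∈ Q := by
    intro w hw
    rw [hQmem] at hw ⊢
    obtain ⟨g, hg, hgw⟩ := hw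
    refine ⟨(MvPolynomial.X i + MvPolynomial.X j) * g, 𝒯.mul_mem h1 hg, ?_⟩
    rw [add_mul, map_add, box_X_mul_eq_actOn, box_X_mul_eq_actOn, hgw, map_smul, map_smul,
      ← smul_add, actOn_insertPair hij]
  have hsingle : ∀ p : Fin (a i) × Fin (a j), (p.1 : ℕ) + p.2 ≤ k → Pi.single p 1 ∈ Q := by
    rintro ⟨p, q⟩ hpq
    simp only at hpq
    rw [hQmem, insertPair_single hij, ← box_monomial, ← map_smul]
    refine ⟨_, ?_, rfl⟩
    set m' := Function.update (Function.update m i p) j q with hm'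
    have hmi : m' i = p := by simp [hm', hij]
    have hmj : m' j = q := by simp [hm']
    obtain ⟨t, ht⟩ := Nat.exists_eq_add_of_le hpq
    -- The power s^k is split as s^t s^p s^q with k = p + q + t, one factor s per y_i and per y_j,
    -- the remaining s^t staying as a scalar.
    have hmon : s ^ k • (MvPolynomial.monomial (idxExp m') 1 :
        MvPolynomial (Fin n) (MvPolynomial (Fin n) ℂ)) =
        s ^ t • ((s • MvPolynomial.X i) ^ (p : ℕ) * ((s • MvPolynomial.X j) ^ (q : ℕ) *
          ∏ l ∈ (Finset.univ.erase i).erase j, MvPolynomial.X l ^ (m' l : ℕ))) := by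
      rw [MvPolynomial.monomial_eq, map_one, one_mul,
        Finsupp.prod_fintype _ _ (fun k => pow_zero _),
        ← Finset.mul_prod_erase _ _ (Finset.mem_univ i),
        ← Finset.mul_prod_erase _ _ (Finset.mem_erase.2 ⟨hij.symm, Finset.mem_univ j⟩)]
      simp only [idxExp_apply, hmi, hmj, smul_pow, smul_mul_assoc, mul_smul_comm, smul_smul, ht]
      congr 1
      ring
    rw [hmon]
    refine 𝒯.smul_mem (𝒯.mul_mem (𝒯.pow_mem h2 _) (𝒯.mul_mem (𝒯.pow_mem h2' _)
      (𝒯.prod_mem fun l hl => 𝒯.pow_mem (h3 l ?_ ?_) _))) _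
    · simp only [Finset.mem_erase] at hl; exact hl.2.1
    · simp only [Finset.mem_erase] at hl; exact hl.1
  refine cg_induction (P := fun w => w ∈ Q) (zero_mem _) (fun x y => add_mem) ?_ hv
  intro k' hk' Φ hΦ v
  rw [← Finset.univ_sum_single v, Matrix.mulVec_sum]
  refine Submodule.sum_mem _ fun r hr0 => ?_
  clear hr0
  have hr : (Pi.single r (v r) : Fin (a i + a j - 1 - 2 * k') → ℂ) = v r • Pi.single r 1 := by
    rw [← Pi.single_smul]; simp
  rw [hr, Matrix.mulVec_smul]
  refine Submodule.smul_mem _ _ ?_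
  obtain ⟨r, hrlt⟩ := r
  clear hr
  induction r with
  | zero =>
    rw [← Finset.univ_sum_single (Φ.mulVec (Pi.single ⟨0, hrlt⟩ 1))]
    refine Submodule.sum_mem _ fun p _ => ?_
    by_cases hp : (p.1 : ℕ) + p.2 = k'
    · have : (Pi.single p (Φ.mulVec (Pi.single ⟨0, hrlt⟩ 1) p) : Fin (a i) × Fin (a j) → ℂ) =
          Φ.mulVec (Pi.single ⟨0, hrlt⟩ 1) p • Pi.single p 1 := by
        rw [← Pi.single_smul]; simp
      rw [this]
      exact Submodule.smul_mem _ _ (hsingle p (hp.trans_le hk'))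
    · rw [sl2Hom_highest_apply hΦ hrlt p hp, Pi.single_zero]
      exact zero_mem _
  | succ r ih =>
    have h := hE _ (ih (by omega))
    rw [Matrix.mulVecLin_apply, Matrix.mulVec_mulVec, ← hΦ.map_e, ← Matrix.mulVec_mulVec] at h
    have hs : (matE (a i + a j - 1 - 2 * k')).mulVec (Pi.single ⟨r, by omega⟩ 1) =
        Pi.single ⟨r + 1, hrlt⟩ 1 := by
      ext q
      simp [matE, Pi.single_apply, Fin.ext_iff]
    rwa [hs] at h

/-! ### Expansion in powers of z_i - z_j and the membership criterion at one diagonal. -/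

/-- The substitution `s = z_i - z_j`, `t = z_i + z_j`. -/
noncomputable def undiag (i j : Fin n) : MvPolynomial (Fin n) ℂ →ₐ[ℂ] MvPolynomial (Fin n) ℂ :=
  MvPolynomial.aeval fun l => if l = i then MvPolynomial.X i + MvPolynomial.X j else
    MvPolynomial.X l

lemma eval_undiag_diagSubst {i j : Fin n} (hij : i ≠ j) (p : MvPolynomial (Fin n) ℂ) :
    (diagSubst i j p).eval₂ (undiag i j).toRingHom (MvPolynomial.X i - MvPolynomial.X j) = p := by
  have hC : ∀ c : ℂ, (algebraMap ℂ (MvPolynomial (Fin n) ℂ)[X] c).eval₂ (undiag i j).toRingHom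
      (MvPolynomial.X i - MvPolynomial.X j) = MvPolynomial.C c := fun c => by
    rw [Polynomial.algebraMap_apply, Polynomial.eval₂_C]
    exact (undiag i j).commutes c
  have h2 : MvPolynomial.C (2⁻¹ : ℂ) * 2 = (1 : MvPolynomial (Fin n) ℂ) := by
    have : (2 : MvPolynomial (Fin n) ℂ) = MvPolynomial.C 2 := (map_ofNat _ 2).symm
    rw [this, ← map_mul]; simp
  induction p using MvPolynomial.induction_on with
  | C c =>
    have : diagSubst i j (MvPolynomial.C c) = algebraMap ℂ _ c := (diagSubst i j).commutes c
    rw [this, hC]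
  | add p q hp hq => rw [map_add, Polynomial.eval₂_add, hp, hq]
  | mul_X p l hp =>
    rw [map_mul, Polynomial.eval₂_mul, hp]
    congr 1
    have hi : (undiag i j).toRingHom (MvPolynomial.X i) = MvPolynomial.X i + MvPolynomial.X j := by
      change undiag i j (MvPolynomial.X i) = _
      simp [undiag]
    rw [diagSubst, MvPolynomial.aeval_X]
    split_ifs with h h'
    · subst h
      rw [Algebra.smul_def, Polynomial.eval₂_mul, hC, Polynomial.eval₂_add, Polynomial.eval₂_C,
        Polynomial.eval₂_X, hi, one_div]
      linear_combination (MvPolynomial.X l) * h2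
    · subst h'
      rw [Algebra.smul_def, Polynomial.eval₂_mul, hC, Polynomial.eval₂_sub, Polynomial.eval₂_C,
        Polynomial.eval₂_X, hi, one_div]
      linear_combination (MvPolynomial.X l) * h2
    · rw [Polynomial.eval₂_C]
      change undiag i j (MvPolynomial.X l) = _
      simp [undiag, h]

/-- Expanding f in powers of s = z_i - z_j, and each coefficient in monomials, writes f as a
ℂ[z]-combination of terms s^k w with w a constant tensor whose slices lie in V(k). Each such term is
covered by `insertPair_mem`. -/
lemma mem_map_box_of_diagonal {a : Fin n → ℕ} {i j : Fin n} (hij : i ≠ j)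
    {𝒯 : Subalgebra (MvPolynomial (Fin n) ℂ) (MvPolynomial (Fin n) (MvPolynomial (Fin n) ℂ))}
    (h1 : MvPolynomial.X i + MvPolynomial.X j ∈ 𝒯)
    (h2 : (MvPolynomial.X i - MvPolynomial.X j : MvPolynomial (Fin n) ℂ) •
      (MvPolynomial.X i : MvPolynomial (Fin n) (MvPolynomial (Fin n) ℂ)) ∈ 𝒯)
    (h3 : ∀ l, l ≠ i → l ≠ j → MvPolynomial.X l ∈ 𝒯) {f : PolyF a}
    (hf : ∀ (k : ℕ) (x : Fin n → ℂ),
      SliceMem i j (cgFiltration (a i) (a j) k) (diagCoeff i j k f x)) :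
    f ∈ (Subalgebra.toSubmodule 𝒯).map (box a) := by
  classical
  set s : MvPolynomial (Fin n) ℂ := MvPolynomial.X i - MvPolynomial.X j with hs
  rcases isEmpty_or_nonempty (Idx a) with hemp | ⟨⟨m₀⟩⟩
  · rw [show f = 0 from Subsingleton.elim _ _]; exact zero_mem _
  set g : ℕ → PolyF a := fun k m => (diagSubst i j (f m)).coeff k with hg
  set K := Finset.univ.sup (fun m : Idx a => (diagSubst i j (f m)).natDegree) + 1 with hK
  set S : ℕ → Finset (Fin n →₀ ℕ) := fun k =>
    Finset.univ.biUnion fun m : Idx a => (g k m).support with hS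
  have hexp : f = ∑ k ∈ Finset.range K, ∑ α ∈ S k,
      undiag i j (MvPolynomial.monomial α 1) • s ^ k • fun m => MvPolynomial.C ((g k m).coeff α) := by
    ext1 m
    have hm : (diagSubst i j (f m)).natDegree < K :=
      Nat.lt_succ_of_le (Finset.le_sup (f := fun m : Idx a => (diagSubst i j (f m)).natDegree)
        (Finset.mem_univ m))
    conv_lhs => rw [← eval_undiag_diagSubst hij (f m)]
    rw [Polynomial.eval₂_eq_sum_range' _ hm]
    simp only [Finset.sum_apply, Pi.smul_apply, smul_eq_mul]
    refine Finset.sum_congr rfl fun k _ => ?_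
    change undiag i j (g k m) * s ^ k = _
    have h4 : g k m = ∑ α ∈ S k, MvPolynomial.monomial α ((g k m).coeff α) := by
      conv_lhs => rw [MvPolynomial.as_sum (g k m)]
      refine Finset.sum_subset (Finset.subset_biUnion_of_mem (fun m : Idx a => (g k m).support)
        (Finset.mem_univ m)) fun α _ hα => ?_
      rw [MvPolynomial.notMem_support_iff.1 hα, map_zero]
    conv_lhs => rw [h4, map_sum, Finset.sum_mul]
    refine Finset.sum_congr rfl fun α _ => ?_
    have h5 : MvPolynomial.monomial α ((g k m).coeff α) =
        (g k m).coeff α • MvPolynomial.monomial α (1 : ℂ) := by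
      rw [MvPolynomial.smul_monomial, smul_eq_mul, mul_one]
    rw [h5, map_smul, MvPolynomial.smul_eq_C_mul]
    ring
  rw [hexp]
  refine Submodule.sum_mem _ fun k _ => Submodule.sum_mem _ fun α _ => Submodule.smul_mem _ _ ?_
  rw [← sum_insertPair_slice hij m₀ fun m => (g k m).coeff α, Finset.smul_sum]
  refine Submodule.sum_mem _ fun m _ => insertPair_mem hij h1 h2 h3 m ?_
  exact coeff_mem_of_forall_eval_mem (cgFiltration (a i) (a j) k)
    (fun p => g k (Function.update (Function.update m i p.1) j p.2)) (fun x => hf k x m) α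

end diagonal

/-! ### `F^c` is generated by the highest vector -/

section generation

variable {n : ℕ}

/-- Setting z_i = z_j is a homomorphism to a domain whose kernel is generated by z_i - z_j. It does
not kill h, because h is nonzero at a point of the diagonal, so it kills p. -/
lemma X_sub_X_dvd {i j : Fin n} {h p q : MvPolynomial (Fin n) ℂ} {x : Fin n → ℂ}
    (hx : x i = x j) (hh : MvPolynomial.eval x h ≠ 0)
    (hpq : h * p = (MvPolynomial.X i - MvPolynomial.X j) * q) :
    MvPolynomial.X i - MvPolynomial.X j ∣ p := by
  set σ : MvPolynomial (Fin n) ℂ →ₐ[ℂ] MvPolynomial (Fin n) ℂ :=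
    MvPolynomial.aeval fun l => if l = i then MvPolynomial.X j else MvPolynomial.X l with hσ
  have h0 : σ (MvPolynomial.X i - MvPolynomial.X j) = 0 := by
    by_cases hij : j = i
    · simp [hij]
    · simp [hσ, hij]
  have hev : ∀ g, MvPolynomial.eval x (σ g) = MvPolynomial.eval x g := fun g => by
    have : (MvPolynomial.aeval x).comp σ = MvPolynomial.aeval x := by
      refine MvPolynomial.algHom_ext fun l => ?_
      by_cases hl : l = i
      · simp [hσ, hl, hx]
      · simp [hσ, hl]
    exact DFunLike.congr_fun this g
  have hσh : σ h ≠ 0 := fun h1 => hh (by rw [← hev, h1, map_zero])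
  have hσp : σ p = 0 := by
    have := congrArg σ hpq
    rw [map_mul, map_mul, h0, zero_mul] at this
    exact (mul_eq_zero.1 this).resolve_left hσh
  set I : Ideal (MvPolynomial (Fin n) ℂ) :=
    Ideal.span {MvPolynomial.X i - MvPolynomial.X j} with hI
  have hmk : (Ideal.Quotient.mkₐ ℂ I).comp σ = Ideal.Quotient.mkₐ ℂ I := by
    refine MvPolynomial.algHom_ext fun l => ?_
    by_cases hl : l = i
    · subst hl
      simp only [AlgHom.comp_apply, hσ, MvPolynomial.aeval_X, if_true]
      refine (Ideal.Quotient.eq.2 ?_).symm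
      exact Ideal.subset_span rfl
    · simp [hσ, hl]
  have h1 := DFunLike.congr_fun hmk p
  rw [AlgHom.comp_apply, hσp, map_zero] at h1
  exact Ideal.mem_span_singleton.1 (Ideal.Quotient.eq_zero_iff_mem.1 h1.symm)

/-! ### Clearing denominators away from the other diagonals. -/

/-- The polynomials in the `y_i` which become polynomials in the `e_k` after a multiplication by a
power of `h`. -/
noncomputable def saturation {K : Type*} [CommRing K] (ζ : Fin n → K) (h : K) :
    Subalgebra K (MvPolynomial (Fin n) K) where
  carrier := {g | ∃ N : ℕ, h ^ N • g ∈ (currentHom ζ).range}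
  mul_mem' := by
    rintro f g ⟨N, hf⟩ ⟨M, hg⟩
    refine ⟨N + M, ?_⟩
    rw [pow_add, ← smul_mul_smul_comm]
    exact mul_mem hf hg
  add_mem' := by
    rintro f g ⟨N, hf⟩ ⟨M, hg⟩
    refine ⟨N + M, ?_⟩
    rw [smul_add]
    refine add_mem ?_ ?_
    · rw [add_comm, pow_add, mul_smul]
      exact Subalgebra.smul_mem _ hf _
    · rw [pow_add, mul_smul]
      exact Subalgebra.smul_mem _ hg _
  algebraMap_mem' c := ⟨0, by rw [pow_zero, one_smul]; exact Subalgebra.algebraMap_mem _ c⟩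

lemma mem_saturation_of_dvd {K : Type*} [CommRing K] {ζ : Fin n → K} {h c : K} (hc : c ∣ h)
    {g : MvPolynomial (Fin n) K} (hg : MvPolynomial.C c * g ∈ (currentHom ζ).range) :
    g ∈ saturation ζ h := by
  obtain ⟨d, rfl⟩ := hc
  refine ⟨1, ?_⟩
  rw [pow_one, mul_comm, mul_smul, MvPolynomial.smul_eq_C_mul g]
  exact Subalgebra.smul_mem _ hg _

/-- The polynomial to invert away from the diagonal `z_i = z_j`. -/
noncomputable def offDiag {K : Type*} [CommRing K] (ζ : Fin n → K) (i j : Fin n) : K :=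
  (nodal ζ ((Finset.univ.erase i).erase j)).eval (ζ i) *
    (nodal ζ ((Finset.univ.erase i).erase j)).eval (ζ j) *
    ∏ k ∈ (Finset.univ.erase i).erase j, ∏ l ∈ Finset.univ.erase k, (ζ k - ζ l)

lemma X_mem_saturation_offDiag {K : Type*} [CommRing K] (ζ : Fin n → K) {i j l : Fin n}
    (hi : l ≠ i) (hj : l ≠ j) : MvPolynomial.X l ∈ saturation ζ (offDiag ζ i j) :=
  mem_saturation_of_dvd (Dvd.dvd.mul_left (Finset.dvd_prod_of_mem
    (fun k => ∏ l ∈ Finset.univ.erase k, (ζ k - ζ l)) (by simp [hi, hj])) _)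
    (prod_sub_mul_X_mem_range ζ l)

lemma sum_eval_nodal_mul {K : Type*} [CommRing K] (ζ : Fin n → K) {i j : Fin n} (hij : i ≠ j)
    (p : K[X]) :
    ∑ l : Fin n, MvPolynomial.C ((nodal ζ ((Finset.univ.erase i).erase j) * p).eval (ζ l)) *
        MvPolynomial.X l =
      MvPolynomial.C ((nodal ζ ((Finset.univ.erase i).erase j) * p).eval (ζ i)) *
        MvPolynomial.X i +
      MvPolynomial.C ((nodal ζ ((Finset.univ.erase i).erase j) * p).eval (ζ j)) *
        MvPolynomial.X j := by
  rw [← Finset.add_sum_erase _ _ (Finset.mem_univ i),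
    ← Finset.add_sum_erase _ _ (Finset.mem_erase.2 ⟨hij.symm, Finset.mem_univ j⟩),
    Finset.sum_eq_zero, add_zero]
  intro l hl
  rw [Polynomial.eval_mul, eval_nodal_eq_zero ζ hl, zero_mul, map_zero, zero_mul]

lemma natDegree_nodal_mul_lt {K : Type*} [CommRing K] (ζ : Fin n → K) {i j : Fin n} (hij : i ≠ j)
    {p : K[X]} (hp : p.natDegree ≤ 1) :
    (nodal ζ ((Finset.univ.erase i).erase j) * p).natDegree < n := by
  have h1 := natDegree_nodal_le ζ ((Finset.univ.erase i).erase j)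
  rw [Finset.card_erase_of_mem (Finset.mem_erase.2 ⟨hij.symm, Finset.mem_univ j⟩),
    Finset.card_erase_of_mem (Finset.mem_univ i), Finset.card_univ, Fintype.card_fin] at h1
  have h2 := Polynomial.natDegree_mul_le (p := nodal ζ ((Finset.univ.erase i).erase j)) (q := p)
  have h3 : (i : ℕ) ≠ j := fun h => hij (Fin.ext h)
  have := i.2
  have := j.2
  omega

/-- With q the nodal polynomial of the points other than i, j, the interpolating polynomial is q ·
p. Here p is linear and takes the value q(ζ_j) at ζ_i and q(ζ_i) at ζ_j, which makes the
coefficients of y_i and y_j equal. Its slope is a divided difference of q, so ζ_i - ζ_j is never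
inverted. -/
lemma X_add_X_mem_saturation {K : Type*} [CommRing K] (ζ : Fin n → K) {i j : Fin n}
    (hij : i ≠ j) :
    MvPolynomial.X i + MvPolynomial.X j ∈ saturation ζ (offDiag ζ i j) := by
  set q := nodal ζ ((Finset.univ.erase i).erase j) with hq
  obtain ⟨c, hc⟩ := Polynomial.sub_dvd_eval_sub (ζ j) (ζ i) q
  set p : K[X] := Polynomial.C (q.eval (ζ j)) -
    Polynomial.C c * (Polynomial.X - Polynomial.C (ζ i)) with hp
  have hdeg : p.natDegree ≤ 1 := by
    refine (Polynomial.natDegree_sub_le _ _).trans (max_le (by simp) ?_)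
    exact (Polynomial.natDegree_C_mul_le _ _).trans (Polynomial.natDegree_X_sub_C_le _)
  have h := mem_range_currentHom ζ (natDegree_nodal_mul_lt ζ hij hdeg)
  rw [sum_eval_nodal_mul ζ hij, ← hq] at h
  have hi : (q * p).eval (ζ i) = q.eval (ζ i) * q.eval (ζ j) := by
    simp [hp]
  have hj : (q * p).eval (ζ j) = q.eval (ζ i) * q.eval (ζ j) := by
    simp only [hp, Polynomial.eval_mul, Polynomial.eval_sub, Polynomial.eval_C, Polynomial.eval_X]
    linear_combination q.eval (ζ j) * hc
  rw [hi, hj, ← mul_add] at h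
  exact mem_saturation_of_dvd (Dvd.intro _ rfl) h

/-- The interpolating polynomial q(X)(X - ζ_j) vanishes at all points but ζ_i, where its value is
q(ζ_i)(ζ_i - ζ_j). -/
lemma X_sub_X_smul_mem_saturation {K : Type*} [CommRing K] (ζ : Fin n → K) {i j : Fin n}
    (hij : i ≠ j) :
    (ζ i - ζ j) • (MvPolynomial.X i : MvPolynomial (Fin n) K) ∈ saturation ζ (offDiag ζ i j) := by
  have h := mem_range_currentHom ζ (natDegree_nodal_mul_lt ζ hij
    (Polynomial.natDegree_X_sub_C_le (ζ j)))
  rw [sum_eval_nodal_mul ζ hij] at h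
  simp only [Polynomial.eval_mul, Polynomial.eval_sub, Polynomial.eval_X, Polynomial.eval_C,
    sub_self, mul_zero, map_zero, zero_mul, add_zero] at h
  rw [map_mul, mul_assoc, ← MvPolynomial.smul_eq_C_mul _ (ζ i - ζ j)] at h
  exact mem_saturation_of_dvd (Dvd.dvd.mul_right (Dvd.intro _ rfl) _) h

/-- The module generated by the highest vector under the `e_k`. -/
noncomputable def orbitModule (a : Fin n → ℕ) : Submodule (MvPolynomial (Fin n) ℂ) (PolyF a) :=
  LinearMap.range (orbit a MvPolynomial.X)

lemma exists_pow_smul_mem_orbitModule {a : Fin n → ℕ} {h : MvPolynomial (Fin n) ℂ} {f : PolyF a}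
    (hf : f ∈ (Subalgebra.toSubmodule (saturation
      (MvPolynomial.X : Fin n → MvPolynomial (Fin n) ℂ) h)).map (box a)) :
    ∃ N : ℕ, h ^ N • f ∈ orbitModule a := by
  obtain ⟨g, ⟨N, p, hp⟩, rfl⟩ := hf
  refine ⟨N, p, ?_⟩
  rw [orbit_apply, ← map_smul, ← hp]
  rfl

/-- The inclusion of F^c in the orbit module, localized near a generic point of one diagonal; only
the condition for the pair (i, j) is used. -/
lemma exists_offDiag_pow_smul_mem {a : Fin n → ℕ} {f : PolyF a} (hf : f ∈ Fc a) {i j : Fin n}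
    (hij : i < j) : ∃ N : ℕ, offDiag (MvPolynomial.X : Fin n → MvPolynomial (Fin n) ℂ) i j ^ N • f ∈ orbitModule a :=
  exists_pow_smul_mem_orbitModule (mem_map_box_of_diagonal hij.ne
    (X_add_X_mem_saturation _ hij.ne) (X_sub_X_smul_mem_saturation _ hij.ne)
    (fun _ hi hj => X_mem_saturation_offDiag _ hi hj) (hf i j hij))

lemma eval_offDiag_ne_zero (i j : Fin n) :
    ∃ x : Fin n → ℂ, x i = x j ∧
      MvPolynomial.eval x (offDiag (MvPolynomial.X : Fin n → MvPolynomial (Fin n) ℂ) i j) ≠ 0 := by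
  -- A point lying on this diagonal only: coordinates are the indices, except that the j-th one is
  -- set equal to the i-th.
  set x : Fin n → ℂ := fun l => if l = j then ((i : ℕ) : ℂ) else ((l : ℕ) : ℂ) with hx
  have hne : ∀ k l, k ≠ i → k ≠ j → k ≠ l → x k ≠ x l := by
    intro k l hi hj hl h
    simp only [hx, if_neg hj] at h
    split_ifs at h
    · exact hi (Fin.ext (Nat.cast_injective h))
    · exact hl (Fin.ext (Nat.cast_injective h))
  refine ⟨x, by simp [hx], ?_⟩
  simp only [offDiag, eval_nodal, map_mul, map_prod, map_sub, MvPolynomial.eval_X]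
  refine mul_ne_zero (mul_ne_zero ?_ ?_) ?_
  · refine Finset.prod_ne_zero_iff.2 fun l hl => sub_ne_zero.2 ?_
    simp only [Finset.mem_erase] at hl
    exact (hne l i hl.2.1 hl.1 hl.2.1).symm
  · refine Finset.prod_ne_zero_iff.2 fun l hl => sub_ne_zero.2 ?_
    simp only [Finset.mem_erase] at hl
    exact (hne l j hl.2.1 hl.1 hl.1).symm
  · refine Finset.prod_ne_zero_iff.2 fun k hk => Finset.prod_ne_zero_iff.2 fun l hl =>
      sub_ne_zero.2 ?_
    simp only [Finset.mem_erase] at hk hl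
    exact hne k l hk.2.1 hk.1 (Ne.symm hl.1)

lemma IsOrbitBasis.exists_sum_eq {a : Fin n → ℕ} {κ : Type} [Fintype κ] {μ : κ → Fin n →₀ ℕ}
    (hμ : IsOrbitBasis a μ) {f : PolyF a} (hf : f ∈ orbitModule a) :
    ∃ c : κ → MvPolynomial (Fin n) ℂ, ∑ b, c b • monOrbit a (μ b) = f := by
  obtain ⟨p, rfl⟩ := hf
  exact (Submodule.mem_span_range_iff_exists_fun _).1 (hμ.span p)

lemma IsOrbitBasis.sum_mem {a : Fin n → ℕ} {κ : Type} [Fintype κ] (μ : κ → Fin n →₀ ℕ)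
    (c : κ → MvPolynomial (Fin n) ℂ) : ∑ b, c b • monOrbit a (μ b) ∈ orbitModule a :=
  Submodule.sum_mem _ fun _ _ => Submodule.smul_mem _ _ ⟨_, rfl⟩

lemma IsOrbitBasis.eq_of_sum_eq {a : Fin n → ℕ} {κ : Type} [Fintype κ] {μ : κ → Fin n →₀ ℕ}
    (hμ : IsOrbitBasis a μ) {c d : κ → MvPolynomial (Fin n) ℂ}
    (h : ∑ b, c b • monOrbit a (μ b) = ∑ b, d b • monOrbit a (μ b)) (b : κ) : c b = d b := by
  rw [← sub_eq_zero, ← Finset.sum_sub_distrib] at h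
  simp only [← sub_smul] at h
  exact sub_eq_zero.1 (Fintype.linearIndependent_iff.1 hμ.linearIndependent _ h b)

/-- Division by `z_i - z_j` inside the module generated by the highest vector. -/
lemma IsOrbitBasis.mem_of_sub_smul_mem {a : Fin n → ℕ} {κ : Type} [Fintype κ]
    {μ : κ → Fin n →₀ ℕ} (hμ : IsOrbitBasis a μ) {i j : Fin n} (hij : i < j) {f : PolyF a}
    (hf : f ∈ Fc a)
    (hs : (MvPolynomial.X i - MvPolynomial.X j : MvPolynomial (Fin n) ℂ) • f ∈ orbitModule a) :
    f ∈ orbitModule a := by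
  obtain ⟨N, hN⟩ := exists_offDiag_pow_smul_mem hf hij
  obtain ⟨x, hx, hne⟩ := eval_offDiag_ne_zero i j
  obtain ⟨p, hp⟩ := hμ.exists_sum_eq hs
  obtain ⟨q, hq⟩ := hμ.exists_sum_eq hN
  set s : MvPolynomial (Fin n) ℂ := MvPolynomial.X i - MvPolynomial.X j with hsdef
  set h := (offDiag (MvPolynomial.X : Fin n → MvPolynomial (Fin n) ℂ) i j) ^ N with hh
  -- Both s f and h f lie in a free module, so computing h s f in two ways compares coordinates. As
  -- h is nonzero somewhere on the diagonal, s divides each coordinate of s f.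
  have hpq : ∀ b, h * p b = s * q b := by
    refine hμ.eq_of_sum_eq ?_
    simp only [mul_smul, ← Finset.smul_sum]
    rw [hp, hq, smul_comm]
  have hdvd : ∀ b, s ∣ p b := fun b =>
    X_sub_X_dvd hx (by rw [hh, map_pow]; exact pow_ne_zero _ hne) (hpq b)
  choose r hr using hdvd
  have hs0 : s ≠ 0 := sub_ne_zero.2 fun h0 => hij.ne (MvPolynomial.X_injective h0)
  have hfr : f = ∑ b, r b • monOrbit a (μ b) := by
    ext1 m
    refine mul_left_cancel₀ hs0 ?_
    have := congrFun hp m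
    simp only [Pi.smul_apply, smul_eq_mul, Finset.sum_apply, hr] at this ⊢
    rw [← this, Finset.mul_sum]
    exact Finset.sum_congr rfl fun b _ => mul_assoc _ _ _
  rw [hfr]
  exact IsOrbitBasis.sum_mem μ r

/-- `F^c` is generated by the highest vector. -/
theorem IsOrbitBasis.orbitModule_eq {a : Fin n → ℕ} {κ : Type} [Fintype κ]
    {μ : κ → Fin n →₀ ℕ} (hμ : IsOrbitBasis a μ) : orbitModule a = Fc a := by
  refine le_antisymm ?_ fun f hf => ?_
  · rintro _ ⟨p, rfl⟩
    exact orbit_mem_Fc a p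
  -- The polynomials that can be cancelled from a relation h f ∈ orbit module with f in F^c. They
  -- are closed under products because F^c is a module.
  set M : Submonoid (MvPolynomial (Fin n) ℂ) :=
    { carrier := {h | ∀ f ∈ Fc a, h • f ∈ orbitModule a → f ∈ orbitModule a}
      one_mem' := fun f _ h => by rwa [one_smul] at h
      mul_mem' := fun {g h} hg hh f hf hgh => by
        rw [mul_smul] at hgh
        exact hh f hf (hg _ ((Fc a).smul_mem h hf) hgh) } with hM
  have hlin : ∀ k l : Fin n, k ≠ l → MvPolynomial.X k - MvPolynomial.X l ∈ M := by
    intro k l hkl f hf h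
    rcases lt_or_gt_of_ne hkl with hlt | hlt
    · exact hμ.mem_of_sub_smul_mem hlt hf h
    · refine hμ.mem_of_sub_smul_mem hlt hf ?_
      rw [← neg_sub, neg_smul]
      exact neg_mem h
  set Δ : MvPolynomial (Fin n) ℂ :=
    ∏ k, ∏ l ∈ Finset.univ.erase k, (MvPolynomial.X k - MvPolynomial.X l) with hΔ
  have hΔM : Δ ∈ M := M.prod_mem fun k _ => M.prod_mem fun l hl =>
    hlin k l (Finset.ne_of_mem_erase hl).symm
  -- Once all differences are inverted, Lagrange interpolation makes every y_k a polynomial in the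
  -- e_k, so some power of Δ moves any f into the orbit module.
  have htop : saturation (MvPolynomial.X : Fin n → MvPolynomial (Fin n) ℂ) Δ = ⊤ := by
    rw [eq_top_iff, ← MvPolynomial.adjoin_range_X]
    refine Algebra.adjoin_le ?_
    rintro _ ⟨k, rfl⟩
    exact mem_saturation_of_dvd (Finset.dvd_prod_of_mem
      (fun k : Fin n => ∏ l ∈ Finset.univ.erase k, (MvPolynomial.X k - MvPolynomial.X l))
      (Finset.mem_univ k)) (prod_sub_mul_X_mem_range _ k)
  obtain ⟨N, hN⟩ := exists_pow_smul_mem_orbitModule (h := Δ) (f := f) (by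
    obtain ⟨g, rfl⟩ := box_surjective a f
    refine ⟨g, ?_, rfl⟩
    rw [htop]
    exact Submodule.mem_top)
  exact M.pow_mem hΔM N f hf hN

end generation

/-! ### Coordinates with respect to a basis of `F^c` -/

section coordinates

variable {n : ℕ} {a : Fin n → ℕ} {κ : Type} [Fintype κ] {μ : κ → Fin n →₀ ℕ}

/-- The value of a polynomial in the `e_k` on the highest vector, as an element of `F^c`. -/
noncomputable def fcOrbit (a : Fin n → ℕ) :
    MvPolynomial (Fin n) (MvPolynomial (Fin n) ℂ) →ₗ[MvPolynomial (Fin n) ℂ] Fc a :=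
  (orbit a MvPolynomial.X).codRestrict (Fc a) (orbit_mem_Fc a)

lemma IsOrbitBasis.fcOrbit_surjective (hμ : IsOrbitBasis a μ) :
    Function.Surjective (fcOrbit a) := by
  rintro ⟨f, hf⟩
  rw [← hμ.orbitModule_eq] at hf
  obtain ⟨p, rfl⟩ := hf
  exact ⟨p, rfl⟩

/-- The basis of `F^c` formed by the values of monomials in the `e_k` on the highest vector. -/
noncomputable def IsOrbitBasis.basis (hμ : IsOrbitBasis a μ) :
    Module.Basis κ (MvPolynomial (Fin n) ℂ) (Fc a) :=
  Module.Basis.mk (v := fun b => fcOrbit a (MvPolynomial.monomial (μ b) 1))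
    (LinearIndependent.of_comp (Fc a).subtype hμ.linearIndependent) (by
      rintro x -
      obtain ⟨p, rfl⟩ := hμ.fcOrbit_surjective x
      obtain ⟨c, hc⟩ := (Submodule.mem_span_range_iff_exists_fun _).1 (hμ.span p)
      refine (Submodule.mem_span_range_iff_exists_fun _).2 ⟨c, Subtype.ext ?_⟩
      rw [AddSubmonoidClass.coe_finsetSum]
      exact hc)

lemma IsOrbitBasis.basis_apply (hμ : IsOrbitBasis a μ) (b : κ) :
    hμ.basis b = fcOrbit a (MvPolynomial.monomial (μ b) 1) := Module.Basis.mk_apply _ _ b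

/-- The coordinates at the point `T` of an element of `F^c`. -/
noncomputable def IsOrbitBasis.coordAt (hμ : IsOrbitBasis a μ) (T : Fin n → ℂ) :
    Fc a →ₗ[ℂ] (κ → ℂ) where
  toFun x b := MvPolynomial.eval T (hμ.basis.repr x b)
  map_add' x y := by ext b; simp
  map_smul' c x := by
    ext b
    rw [← algebraMap_smul (MvPolynomial (Fin n) ℂ) c x]
    simp

lemma IsOrbitBasis.coordAt_apply (hμ : IsOrbitBasis a μ) (T : Fin n → ℂ) (x : Fc a) (b : κ) :
    hμ.coordAt T x b = MvPolynomial.eval T (hμ.basis.repr x b) := rfl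

/-- The value of a polynomial in the `e_k` with constant coefficients on the highest vector. -/
noncomputable def constOrbit (a : Fin n → ℕ) : MvPolynomial (Fin n) ℂ →ₗ[ℂ] Fc a where
  toFun p := fcOrbit a (MvPolynomial.map MvPolynomial.C p)
  map_add' p q := by rw [map_add, map_add]
  map_smul' c p := by
    rw [RingHom.id_apply, ← algebraMap_smul (MvPolynomial (Fin n) ℂ) c (fcOrbit a _), ← map_smul,
      MvPolynomial.smul_eq_C_mul, MvPolynomial.smul_eq_C_mul, map_mul, MvPolynomial.map_C]
    rfl

lemma constOrbit_apply (p : MvPolynomial (Fin n) ℂ) :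
    constOrbit a p = fcOrbit a (MvPolynomial.map MvPolynomial.C p) := rfl

lemma constOrbit_monomial (ν : Fin n →₀ ℕ) :
    constOrbit a (MvPolynomial.monomial ν 1) = fcOrbit a (MvPolynomial.monomial ν 1) := by
  rw [constOrbit_apply, MvPolynomial.map_monomial, map_one]

lemma constOrbit_one : constOrbit a 1 = ⟨highest a, highest_mem_Fc a⟩ := by
  rw [constOrbit_apply, map_one]
  exact Subtype.ext (orbit_one a)

lemma constOrbit_X_mul (k : Fin n) (p : MvPolynomial (Fin n) ℂ) :
    constOrbit a (MvPolynomial.X k * p) = fcE a k (constOrbit a p) := by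
  rw [constOrbit_apply, map_mul, MvPolynomial.map_X]
  exact Subtype.ext (currentE_orbit a k _).symm

lemma constOrbit_eq_sum (p : MvPolynomial (Fin n) ℂ) {S : Finset (Fin n →₀ ℕ)}
    (hS : p.support ⊆ S) :
    constOrbit a p = ∑ ν ∈ S, p.coeff ν • constOrbit a (MvPolynomial.monomial ν 1) := by
  conv_lhs => rw [MvPolynomial.as_sum p, map_sum]
  rw [← Finset.sum_subset hS fun ν _ hν => by
    rw [MvPolynomial.notMem_support_iff.1 hν, zero_smul]]
  refine Finset.sum_congr rfl fun ν _ => ?_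
  rw [← map_smul, MvPolynomial.smul_monomial, smul_eq_mul, mul_one]

lemma IsOrbitBasis.coordAt_monomial [DecidableEq κ] (hμ : IsOrbitBasis a μ) (T : Fin n → ℂ)
    (b : κ) : hμ.coordAt T (constOrbit a (MvPolynomial.monomial (μ b) 1)) = Pi.single b 1 := by
  ext b'
  rw [constOrbit_monomial, ← hμ.basis_apply, hμ.coordAt_apply, Module.Basis.repr_self,
    Finsupp.single_apply, Pi.single_apply]
  simp only [eq_comm]
  split_ifs <;> simp

lemma IsOrbitBasis.coordAt_surjective (hμ : IsOrbitBasis a μ) (T : Fin n → ℂ) (v : κ → ℂ) :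
    hμ.coordAt T (constOrbit a (∑ b, MvPolynomial.monomial (μ b) (v b))) = v := by
  classical
  rw [map_sum, map_sum]
  conv_rhs => rw [← Finset.univ_sum_single v]
  refine Finset.sum_congr rfl fun b _ => ?_
  have : MvPolynomial.monomial (μ b) (v b) = v b • MvPolynomial.monomial (μ b) (1 : ℂ) := by
    rw [MvPolynomial.smul_monomial, smul_eq_mul, mul_one]
  rw [this, map_smul, map_smul, hμ.coordAt_monomial, ← Pi.single_smul, smul_eq_mul, mul_one]

/-- The coordinates respect the grading by the degree in the `e_k`. -/
lemma IsOrbitBasis.coordAt_eq_zero_of_lt (hμ : IsOrbitBasis a μ) (T : Fin n → ℂ)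
    {p : MvPolynomial (Fin n) ℂ} {b : κ} (hb : p.totalDegree < (μ b).degree) :
    hμ.coordAt T (constOrbit a p) b = 0 := by
  set x := constOrbit a p with hx
  have hrepr : ∑ b, hμ.basis.repr x b • monOrbit a (μ b) = (x : PolyF a) := by
    conv_rhs => rw [← hμ.basis.sum_repr x, AddSubmonoidClass.coe_finsetSum]
    refine Finset.sum_congr rfl fun b _ => ?_
    rw [hμ.basis_apply]
    rfl
  have hlow : ∀ m : Idx a, p.totalDegree < idxDegree m → (x : PolyF a) m = 0 := by
    intro m hm
    have : (x : PolyF a) = ∑ ν ∈ p.support, p.coeff ν • monOrbit a ν := by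
      rw [hx, constOrbit_eq_sum p (Finset.Subset.refl _), AddSubmonoidClass.coe_finsetSum]
      refine Finset.sum_congr rfl fun ν _ => ?_
      rw [constOrbit_monomial]
      rfl
    rw [this, Finset.sum_apply]
    refine Finset.sum_eq_zero fun ν hν => ?_
    have h1 : ν.degree ≤ p.totalDegree := MvPolynomial.le_totalDegree hν
    rw [Pi.smul_apply, monOrbit_eq_zero (by omega), smul_zero]
  -- Each basis vector is supported on one tensor degree, so the part of the expansion above the
  -- degree of p can be isolated. It is zero because p(e)u has no components there, and independence
  -- then kills its coordinates.
  have hhigh : ∑ b, (if p.totalDegree < (μ b).degree then hμ.basis.repr x b else 0) •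
      monOrbit a (μ b) = 0 := by
    ext1 m
    simp only [Finset.sum_apply, Pi.smul_apply, Pi.zero_apply, smul_eq_mul]
    by_cases hm : p.totalDegree < idxDegree m
    · rw [← hlow m hm, ← hrepr, Finset.sum_apply]
      refine Finset.sum_congr rfl fun b _ => ?_
      by_cases hb : idxDegree m = (μ b).degree
      · rw [if_pos (by omega)]; rfl
      · rw [Pi.smul_apply, monOrbit_eq_zero hb]; simp
    · refine Finset.sum_eq_zero fun b _ => ?_
      split_ifs with hb
      · rw [monOrbit_eq_zero (by omega), mul_zero]
      · rw [zero_mul]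
  have h := Fintype.linearIndependent_iff.1 hμ.linearIndependent _ hhigh b
  rw [if_pos hb] at h
  rw [hμ.coordAt_apply, h, map_zero]

/-- Evaluating the basis expansion of p(e)u at Z gives the value of p at the specialized highest
vector, and the evaluated basis vectors stay independent at points with distinct coordinates. -/
lemma IsOrbitBasis.mem_genericIdeal_iff (hμ : IsOrbitBasis a μ) {Z : Fin n → ℂ}
    (hZ : Z ∈ distinctPoints n) {p : MvPolynomial (Fin n) ℂ} :
    p ∈ genericIdeal a Z ↔ hμ.coordAt Z (constOrbit a p) = 0 := by
  have hmap : MvPolynomial.map (MvPolynomial.eval Z) (MvPolynomial.map MvPolynomial.C p) = p := by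
    rw [MvPolynomial.map_map]
    have : (MvPolynomial.eval Z).comp MvPolynomial.C = RingHom.id ℂ := by ext1 c; simp
    rw [this, MvPolynomial.map_id]
  have hev : (MvPolynomial.eval Z ∘ MvPolynomial.X : Fin n → ℂ) = Z := by ext; simp
  have h1 : orbit a Z p = ∑ b, hμ.coordAt Z (constOrbit a p) b •
      fun m => MvPolynomial.eval Z (monOrbit a (μ b) m) := by
    ext m
    have h2 := orbit_map (MvPolynomial.eval Z) a MvPolynomial.X (MvPolynomial.map MvPolynomial.C p) m
    rw [hmap, hev] at h2
    rw [h2]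
    have h3 : ∑ b, hμ.basis.repr (constOrbit a p) b • monOrbit a (μ b) =
        (constOrbit a p : PolyF a) := by
      conv_rhs => rw [← hμ.basis.sum_repr (constOrbit a p), AddSubmonoidClass.coe_finsetSum]
      refine Finset.sum_congr rfl fun b _ => ?_
      rw [hμ.basis_apply]
      rfl
    have h4 := congrArg (MvPolynomial.eval Z) (congrFun h3 m)
    rw [Finset.sum_apply, map_sum] at h4
    rw [Finset.sum_apply]
    refine h4.symm.trans (Finset.sum_congr rfl fun b _ => ?_)
    rw [Pi.smul_apply, smul_eq_mul, map_mul]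
    rfl
  rw [FusionSl2.mem_genericIdeal_iff, h1]
  constructor
  · intro h
    ext b
    exact Fintype.linearIndependent_iff.1 (hμ.linearIndependent_eval Z hZ) _ h b
  · intro h
    simp [h]

end coordinates

/-! ### The limit of the ideals -/

section limits

variable {n : ℕ} {a : Fin n → ℕ} {κ : Type} [Fintype κ] {μ : κ → Fin n →₀ ℕ}

lemma neBot_distinctPoints (T : Fin n → ℂ) : (𝓝[distinctPoints n] T).NeBot := by
  -- A line through T in a direction with distinct coordinates: for small t ≠ 0 its points have
  -- distinct coordinates. This nontriviality of the filter is what makes limits unique below.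
  set γ : ℂ → Fin n → ℂ := fun t i => T i + t * (i : ℕ) with hγ
  have hcont : Continuous γ := by fun_prop
  have h0 : γ 0 = T := by ext i; simp [hγ]
  have hev : ∀ᶠ t in 𝓝[≠] (0 : ℂ), γ t ∈ distinctPoints n := by
    have h1 : ∀ i j : Fin n, i ≠ j → ∀ᶠ t in 𝓝[≠] (0 : ℂ), γ t i ≠ γ t j := by
      intro i j hij
      by_cases hT : T i = T j
      · filter_upwards [self_mem_nhdsWithin] with t ht h
        simp only [hγ, hT, add_right_inj] at h
        exact hij (Fin.ext (Nat.cast_injective (mul_left_cancel₀ ht h)))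
      · have h2 : ∀ᶠ t in 𝓝 (0 : ℂ), γ t i ≠ γ t j := by
          have hc : Continuous fun t => γ t i - γ t j := by fun_prop
          have := hc.continuousAt.eventually_ne (x := (0 : ℂ)) (y := 0)
            (by simpa [hγ] using sub_ne_zero.2 hT)
          filter_upwards [this] with t ht
          exact sub_ne_zero.1 ht
        exact h2.filter_mono nhdsWithin_le_nhds
    have h3 : ∀ᶠ t in 𝓝[≠] (0 : ℂ), ∀ i j : Fin n, i ≠ j → γ t i ≠ γ t j := by
      simp only [Filter.eventually_all]
      exact h1
    filter_upwards [h3] with t ht i j hij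
    by_contra hne
    exact ht i j hne hij
  have hlim : Filter.Tendsto γ (𝓝[≠] 0) (𝓝[distinctPoints n] T) :=
    tendsto_nhdsWithin_iff.2
      ⟨(h0 ▸ hcont.tendsto 0 : Filter.Tendsto γ (𝓝 0) (𝓝 T)).mono_left nhdsWithin_le_nhds, hev⟩
  exact hlim.neBot

lemma IsOrbitBasis.tendsto_coordAt (hμ : IsOrbitBasis a μ) {α : Type*} {l : Filter α}
    {Z : α → Fin n → ℂ} {T : Fin n → ℂ} (hZ : Filter.Tendsto Z l (𝓝 T)) (x : Fc a) (b : κ) :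
    Filter.Tendsto (fun r => hμ.coordAt (Z r) x b) l (𝓝 (hμ.coordAt T x b)) :=
  ((MvPolynomial.continuous_eval (hμ.basis.repr x b)).tendsto T).comp hZ

/-- The coordinates at Z are polynomial in Z and linear in the coefficients of q; they vanish along
the family, and both arguments converge. -/
lemma IsOrbitBasis.coordAt_eq_zero_of_tendsto (hμ : IsOrbitBasis a μ) {α : Type*} {l : Filter α}
    [l.NeBot] {Z : α → Fin n → ℂ} {T : Fin n → ℂ}
    (hZ : Filter.Tendsto Z l (𝓝[distinctPoints n] T)) {q : α → MvPolynomial (Fin n) ℂ} {d : ℕ}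
    (hq : ∀ᶠ r in l, q r ∈ genericIdeal a (Z r) ∧ (q r).totalDegree ≤ d)
    {p : MvPolynomial (Fin n) ℂ}
    (hp : ∀ m, Filter.Tendsto (fun r => (q r).coeff m) l (𝓝 (p.coeff m))) :
    hμ.coordAt T (constOrbit a p) = 0 := by
  classical
  obtain ⟨hZT, hZd⟩ := tendsto_nhdsWithin_iff.1 hZ
  -- The degree bound makes the coordinates a sum over a fixed finite set of exponents, so
  -- coefficientwise convergence suffices. The support of p is added so that no degree bound on p
  -- has to be shown.
  set S : Finset (Fin n →₀ ℕ) := (Finsupp.finite_of_degree_le d).toFinset ∪ p.support with hS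
  have hcoord : ∀ (Y : Fin n → ℂ) (f : MvPolynomial (Fin n) ℂ) (b : κ), f.support ⊆ S →
      hμ.coordAt Y (constOrbit a f) b =
        ∑ ν ∈ S, f.coeff ν * hμ.coordAt Y (constOrbit a (MvPolynomial.monomial ν 1)) b := by
    intro Y f b hf
    rw [constOrbit_eq_sum f hf, map_sum, Finset.sum_apply]
    refine Finset.sum_congr rfl fun ν _ => ?_
    rw [map_smul, Pi.smul_apply, smul_eq_mul]
  ext b
  have h1 : Filter.Tendsto (fun r => ∑ ν ∈ S, (q r).coeff ν *
      hμ.coordAt (Z r) (constOrbit a (MvPolynomial.monomial ν 1)) b) l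
      (𝓝 (hμ.coordAt T (constOrbit a p) b)) := by
    rw [hcoord T p b Finset.subset_union_right]
    exact tendsto_finsetSum _ fun ν _ => (hp ν).mul (hμ.tendsto_coordAt hZT _ b)
  have h2 : (fun r => ∑ ν ∈ S, (q r).coeff ν *
      hμ.coordAt (Z r) (constOrbit a (MvPolynomial.monomial ν 1)) b) =ᶠ[l] fun _ => 0 := by
    filter_upwards [hq, hZd] with r hr hZr
    rw [← hcoord, (hμ.mem_genericIdeal_iff hZr).1 hr.1, Pi.zero_apply]
    intro ν hν
    refine Finset.mem_union_left _ ((Finsupp.finite_of_degree_le d).mem_toFinset.2 ?_)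
    exact (MvPolynomial.le_totalDegree hν).trans hr.2
  exact tendsto_nhds_unique (h1.congr' h2) tendsto_const_nhds

/-- Subtracting from p its expansion at Z in the basis monomials gives an element of I(Z). The
correction tends to zero because the coordinates vanish at T, and it does not raise the degree by
`IsOrbitBasis.coordAt_eq_zero_of_lt`. -/
lemma IsOrbitBasis.exists_tendsto (hμ : IsOrbitBasis a μ) {T : Fin n → ℂ}
    {p : MvPolynomial (Fin n) ℂ} (hp : hμ.coordAt T (constOrbit a p) = 0) {d : ℕ}
    (hd : p.totalDegree ≤ d) :
    ∃ q : (Fin n → ℂ) → MvPolynomial (Fin n) ℂ,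
      (∀ᶠ Z in 𝓝[distinctPoints n] T, q Z ∈ genericIdeal a Z ∧ (q Z).totalDegree ≤ d) ∧
      ∀ m, Filter.Tendsto (fun Z => (q Z).coeff m) (𝓝[distinctPoints n] T) (𝓝 (p.coeff m)) := by
  classical
  refine ⟨fun Z => p - ∑ b, MvPolynomial.monomial (μ b) (hμ.coordAt Z (constOrbit a p) b), ?_,
    fun m => ?_⟩
  · filter_upwards [self_mem_nhdsWithin] with Z hZ
    constructor
    · rw [hμ.mem_genericIdeal_iff hZ, map_sub, map_sub, hμ.coordAt_surjective, sub_self]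
    · refine (MvPolynomial.totalDegree_sub _ _).trans (max_le hd ?_)
      refine MvPolynomial.totalDegree_finsetSum_le fun b _ => ?_
      by_cases hb : p.totalDegree < (μ b).degree
      · rw [hμ.coordAt_eq_zero_of_lt Z hb]; simp
      · refine (MvPolynomial.totalDegree_monomial_le _ _).trans ?_
        exact (not_lt.1 hb).trans hd
  · have h1 : Filter.Tendsto (fun Z : Fin n → ℂ => p.coeff m -
        ∑ b, if μ b = m then hμ.coordAt Z (constOrbit a p) b else 0) (𝓝[distinctPoints n] T)
        (𝓝 (p.coeff m - ∑ b, if μ b = m then hμ.coordAt T (constOrbit a p) b else 0)) := by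
      refine tendsto_const_nhds.sub (tendsto_finsetSum _ fun b _ => ?_)
      split_ifs
      · exact hμ.tendsto_coordAt (Filter.tendsto_id.mono_left nhdsWithin_le_nhds) _ b
      · exact tendsto_const_nhds
    simpa [MvPolynomial.coeff_sum, MvPolynomial.coeff_monomial, hp] using h1

lemma IsOrbitBasis.mem_limitIdeal_iff (hμ : IsOrbitBasis a μ) {T : Fin n → ℂ}
    {p : MvPolynomial (Fin n) ℂ} :
    p ∈ limitIdeal a T ↔ hμ.coordAt T (constOrbit a p) = 0 := by
  have := neBot_distinctPoints T
  constructor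
  · rintro ⟨d, q, hq, hp⟩
    exact hμ.coordAt_eq_zero_of_tendsto Filter.tendsto_id hq hp
  · intro hp
    exact ⟨_, hμ.exists_tendsto hp le_rfl⟩

lemma IsOrbitBasis.idealTendsto (hμ : IsOrbitBasis a μ) (T : Fin n → ℂ) :
    IdealTendsto (genericIdeal a) (𝓝[distinctPoints n] T) (limitIdeal a T) where
  lower _ _ hp hd := hμ.exists_tendsto (hμ.mem_limitIdeal_iff.1 hp) hd
  upper _ _ _ _ hZ hq hp := hμ.mem_limitIdeal_iff.2
    (hμ.coordAt_eq_zero_of_tendsto hZ (Filter.Eventually.of_forall hq) hp)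

end limits

/-! ### The fibers -/

section fibers

variable {n : ℕ} {a : Fin n → ℕ} {κ : Type} [Fintype κ] {μ : κ → Fin n →₀ ℕ}

lemma mem_pointIdeal_iff {T : Fin n → ℂ} {p : MvPolynomial (Fin n) ℂ} :
    p ∈ pointIdeal T ↔ MvPolynomial.eval T p = 0 := by
  constructor
  · intro hp
    have h : pointIdeal T ≤ RingHom.ker (MvPolynomial.eval T) := by
      refine Ideal.span_le.2 ?_
      rintro _ ⟨i, rfl⟩
      simp [RingHom.mem_ker]
    exact h hp
  · intro hp
    have h : (Algebra.ofId ℂ (MvPolynomial (Fin n) ℂ ⧸ pointIdeal T)).comp (MvPolynomial.aeval T) =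
        Ideal.Quotient.mkₐ ℂ (pointIdeal T) := by
      refine MvPolynomial.algHom_ext fun i => ?_
      rw [AlgHom.comp_apply, MvPolynomial.aeval_X]
      refine (Ideal.Quotient.eq.2 ?_).symm
      exact Ideal.subset_span ⟨i, rfl⟩
    have h1 := DFunLike.congr_fun h p
    have h2 : MvPolynomial.aeval T p = (0 : ℂ) := hp
    rw [AlgHom.comp_apply, h2, map_zero] at h1
    exact Ideal.Quotient.eq_zero_iff_mem.1 h1.symm

/-- Since F^c is free, reduction modulo R(T) acts coordinatewise. Membership in R(T)F^c thus becomes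
the condition that defines the limit ideal, which is how the fiber is identified. -/
lemma IsOrbitBasis.mem_pointIdeal_smul_iff (hμ : IsOrbitBasis a μ) {T : Fin n → ℂ} {x : Fc a} :
    x ∈ (pointIdeal T • ⊤ : Submodule (MvPolynomial (Fin n) ℂ) (Fc a)) ↔
      hμ.coordAt T x = 0 := by
  constructor
  · intro hx
    induction hx using Submodule.smul_induction_on' with
    | smul r hr y _ =>
      ext b
      rw [hμ.coordAt_apply, map_smul, Finsupp.smul_apply, smul_eq_mul, map_mul,
        mem_pointIdeal_iff.1 hr, zero_mul, Pi.zero_apply]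
    | add x _ y _ hx hy => rw [map_add, hx, hy, add_zero]
  · intro hx
    rw [← hμ.basis.sum_repr x]
    refine Submodule.sum_mem _ fun b _ => Submodule.smul_mem_smul ?_ Submodule.mem_top
    exact mem_pointIdeal_iff.2 (congrFun hx b)

/-- The value of a polynomial in the `e_k` on the class of the highest vector in the fiber. -/
noncomputable def fiberOrbit (a : Fin n → ℕ) (T : Fin n → ℂ) :
    MvPolynomial (Fin n) ℂ →ₗ[ℂ] Fiber a T :=
  (Submodule.mkQ (pointIdeal T • ⊤ : Submodule (MvPolynomial (Fin n) ℂ) (Fc a))).restrictScalars ℂ ∘ₗ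
    constOrbit a

lemma IsOrbitBasis.fiberOrbit_surjective (hμ : IsOrbitBasis a μ) (T : Fin n → ℂ) :
    Function.Surjective (fiberOrbit a T) := by
  intro y
  obtain ⟨x, rfl⟩ := Submodule.Quotient.mk_surjective _ y
  refine ⟨∑ b, MvPolynomial.monomial (μ b) (hμ.coordAt T x b), ?_⟩
  refine (Submodule.Quotient.eq _).2 ?_
  rw [hμ.mem_pointIdeal_smul_iff, map_sub, hμ.coordAt_surjective, sub_self]

lemma IsOrbitBasis.ker_fiberOrbit (hμ : IsOrbitBasis a μ) (T : Fin n → ℂ) :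
    LinearMap.ker (fiberOrbit a T) = (limitIdeal a T).restrictScalars ℂ := by
  ext p
  rw [LinearMap.mem_ker, Submodule.restrictScalars_mem, hμ.mem_limitIdeal_iff,
    ← hμ.mem_pointIdeal_smul_iff]
  exact Submodule.Quotient.mk_eq_zero _

/-- The isomorphism of `ℂ[e_0, …, e_{n-1}] / I(T)` with the fiber. -/
noncomputable def IsOrbitBasis.fiberEquiv (hμ : IsOrbitBasis a μ) (T : Fin n → ℂ) :
    (MvPolynomial (Fin n) ℂ ⧸ limitIdeal a T) ≃ₗ[ℂ] Fiber a T :=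
  (Submodule.Quotient.restrictScalarsEquiv ℂ (limitIdeal a T)).symm ≪≫ₗ
    Submodule.quotEquivOfEq _ _ (hμ.ker_fiberOrbit T).symm ≪≫ₗ
    (fiberOrbit a T).quotKerEquivOfSurjective (hμ.fiberOrbit_surjective T)

lemma IsOrbitBasis.fiberEquiv_mk (hμ : IsOrbitBasis a μ) (T : Fin n → ℂ)
    (p : MvPolynomial (Fin n) ℂ) :
    hμ.fiberEquiv T (Ideal.Quotient.mk (limitIdeal a T) p) = fiberOrbit a T p := rfl

lemma fiberOrbit_one (T : Fin n → ℂ) : fiberOrbit a T 1 = fiberU a T :=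
  congrArg (Submodule.Quotient.mk) constOrbit_one

lemma fiberOrbit_X_mul (T : Fin n → ℂ) (k : Fin n) (p : MvPolynomial (Fin n) ℂ) :
    fiberOrbit a T (MvPolynomial.X k * p) = fiberE a T k (fiberOrbit a T p) :=
  congrArg (Submodule.Quotient.mk) (constOrbit_X_mul k p)

end fibers

end FusionSl2

theorem theorem4p1 (n : ℕ) (a : Fin n → ℕ) (ha : ∀ i, 0 < a i) :
    -- `F^c` is free of rank `∏ a_i` over `ℂ[z_1, …, z_n]`
    (Module.Free (MvPolynomial (Fin n) ℂ) (FusionSl2.Fc a) ∧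
      Module.rank (MvPolynomial (Fin n) ℂ) (FusionSl2.Fc a) = ((∏ i, a i : ℕ) : Cardinal)) ∧
    ∀ T : Fin n → ℂ,
      -- the ideals `I(Z)` converge to `I(T)` as `Z → T`, the coordinates of `Z` being distinct
      FusionSl2.IdealTendsto (FusionSl2.genericIdeal a) (𝓝[FusionSl2.distinctPoints n] T)
        (FusionSl2.limitIdeal a T) ∧
      -- an isomorphism `ℂ[e_0, …, e_{n-1}] / I(T) ≅ M(T)` that maps `1` to `u` and commutes with
      -- the action of the basis `e_0, …, e_{n-1}` of the abelian Lie algebra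
      ∃ φ : (MvPolynomial (Fin n) ℂ ⧸ FusionSl2.limitIdeal a T) ≃ₗ[ℂ] FusionSl2.Fiber a T,
        φ 1 = FusionSl2.fiberU a T ∧
        ∀ (k : Fin n) (p : MvPolynomial (Fin n) ℂ ⧸ FusionSl2.limitIdeal a T),
          φ (Ideal.Quotient.mk (FusionSl2.limitIdeal a T) (MvPolynomial.X k) * p) =
            FusionSl2.fiberE a T k (φ p) := by
  obtain ⟨κ, _, μ, hμ⟩ := FusionSl2.exists_isOrbitBasis a ha
  refine ⟨⟨Module.Free.of_basis hμ.basis, ?_⟩, fun T => ⟨hμ.idealTendsto T, hμ.fiberEquiv T,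
    ?_, fun k p => ?_⟩⟩
  · rw [rank_eq_card_basis hμ.basis, hμ.card_eq]
  · exact (hμ.fiberEquiv_mk T 1).trans (FusionSl2.fiberOrbit_one T)
  · obtain ⟨p, rfl⟩ := Ideal.Quotient.mk_surjective p
    rw [← map_mul, hμ.fiberEquiv_mk, hμ.fiberEquiv_mk, FusionSl2.fiberOrbit_X_mul]
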